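/- **Setting.** Let $\mathcal H_B$ and $\mathcal H_A^{(1)},\dots,\mathcal H_A^{(K)}$ be finite-dimensional Hilbert spaces, $\mathcal H_A=\bigotimes_k\mathcal H_A^{(k)}$, and write $\mathcal D_L(\rho)=L\rho L^\dagger-\tfrac12L^\dagger L\rho-\tfrac12\rho L^\dagger L$. Operators on a tensor factor are extended by the identity. Consider on $\mathcal H_A\otimes\mathcal H_B$ $$\dot\rho=\sum_k\big(\mathcal L_A^{(k)}(\rho)+\varepsilon\mathcal L_{int}^{(k)}(\rho)\big)+\varepsilon\mathcal L_B(\rho)-i[\tilde H_B,\rho],$$ where $\mathcal L_A^{(k)}(\rho)=-i[H_A^{(k)},\rho]+\sum_\mu\mathcal D_{L^{(k)}_{A,\mu}}(\rho)$ is a Lindbladian on $\mathcal H_A^{(k)}$, $\mathcal L_{int}^{(k)}(\rho)=-i[A^{(k)}\otimes B^\dagger+A^{(k)\dagger}\otimes B,\rho]$, $\mathcal L_B$ is a Lindbladian on $\mathcal H_B$ and $\tilde H_B$ is Hermitian on $\mathcal H_B$. Assume that each $\mathcal L_A^{(k)}$ has a unique steady density operator $\bar\rho_A^{(k)}$ and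 that $e^{t\mathcal L_A^{(k)}}\sigma\to\bar\rho_A^{(k)}$ as $t\to\infty$ for every density operator $\sigma$. Put $\bar\rho_A=\bigotimes_k\bar\rho_A^{(k)}$, $\mathcal L_A=\sum_k\mathcal L_A^{(k)}$, $\mathcal L_{int}=\sum_k\mathcal L_{int}^{(k)}$. Assume $[\tilde H_B,B^\dagger]=cB^\dagger$ with $c=c_{B^\dagger}\in\mathbb R\setminus\{0\}$, and $\mathcal L_B=\mathcal L_{s,1}=0$. Let $B_1=B^\dagger$, $B_2=B$, $A_1^{(k)}=A^{(k)}$, $A_2^{(k)}=A^{(k)\dagger}$, $\mathcal L_{s,0}(\rho_s)=-i[\tilde H_B,\rho_s]$, $\mathcal K_0(\rho_s)=\bar\rho_A\otimes\rho_s$. **Theorem.** There are operators $F_1^{(k)},F_2^{(k)}$ on $\mathcal H_A^{(k)}$ with $$\mathcal L_A^{(k)}(F_1^{(k)}\bar\rho_A^{(k)})+A^{(k)}\bar\rho_A^{(k)}-ic\,F_1^{(k)}\bar\rho_A^{(k)}=0,\qquad \mathcal L_A^{(k)}(F_2^{(k)}\bar\rho_A^{(k)})+A^{(k)\dagger}\bar\rho_A^{(k)}+ic\,F_2^{(k)}\bar\rho_A^{(k)}=0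 .$$ For all such operators let $M=\sum_k\sum_jF_j^{(k)}\otimes B_j$, $\mathcal K_1(\rho_s)=-iM(\bar\rho_A\otimes\rho_s)+i(\bar\rho_A\otimes\rho_s)M^\dagger$, and $$\begin{aligned}\mathcal L_{s,2}(\rho_s)=\sum_k\Big(&-i\,\Im(z_1^{(k)})[BB^\dagger,\rho_s]-i\,\Im(z_2^{(k)})[B^\dagger B,\rho_s]+2\Re(z_1^{(k)})\mathcal D_{B^\dagger}(\rho_s)+2\Re(z_2^{(k)})\mathcal D_B(\rho_s)\Big)\\&+\sum_{k>k'}-i\,\delta^{(k,k')}\,[[B,B^\dagger],\rho_s],\end{aligned}$$ with $z_0^{(k)}=\mathrm{Tr}(A^{(k)}\bar\rho_A^{(k)})$, $z_1^{(k)}=\mathrm{Tr}(F_1^{(k)}\bar\rho_A^{(k)}A^{(k)\dagger})$, $z_2^{(k)}=\mathrm{Tr}(F_2^{(k)}\bar\rho_A^{(k)}A^{(k)})$ and $\delta^{(k,k')}=-2\Re(z_0^{(k)}z_0^{(k')*})/c$. Then $\mathcal L_{s,2}$ is a Lindbladian, and there is $\bar\tau>0$ such that the map $\mathcal K_2$ defined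 below satisfies, for all $\rho_s$, the second-order invariance equation $$\mathcal L_A(\mathcal K_2(\rho_s))+\mathcal L_{int}(\mathcal K_1(\rho_s))+\mathcal L_B(\mathcal K_1(\rho_s))-i[\tilde H_B,\mathcal K_2(\rho_s)]=\mathcal K_0(\mathcal L_{s,2}(\rho_s))+\mathcal K_1(\mathcal L_{s,1}(\rho_s))+\mathcal K_2(\mathcal L_{s,0}(\rho_s)),$$ and $\mathcal K_0+\varepsilon\mathcal K_1+\varepsilon^2\mathcal K_2$ is CPTP up to third-order terms, i.e. for small $\varepsilon>0$ it differs by $O(\varepsilon^3)$ from a completely positive trace-preserving map. **Definition of $\mathcal K_2$.** Put $\bar{\mathcal F}_{hj}^{(k)}=\sum_\mu[L_{A,\mu}^{(k)},F_h^{(k)}]\,\bar\rho_A^{(k)}\,[L_{A,\mu}^{(k)},F_j^{(k)}]^\dagger$, $b^{(k)}=-\frac1{2c}\mathrm{Tr}\,\bar{\mathcal F}_{21}^{(k)}$, $\beta_1^{(k)}=1$, $\beta_2^{(k)}=b^{(k)}$, $\mathcal S(X)=X-\bar\rho_A\otimes\mathrm{Tr}_AX$, $$W_\mu^{(k)}(t)=[L_{A,\mu}^{(k)},F_1^{(k)}]\otimes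 B^\dagger+e^{2ict}[L_{A,\mu}^{(k)},F_2^{(k)}]\otimes B,\qquad \mathfrak w^{(k)}(t)=B^\dagger+b^{(k)}e^{-2ict}B.$$ For $k\ne k'$ let $\bar\rho_A^{(k,k')}=\bar\rho_A^{(k)}\otimes\bar\rho_A^{(k')}$ and $\mathcal L_A^{(k,k')}=\mathcal L_A^{(k)}+\mathcal L_A^{(k')}$ on $\mathcal H_A^{(k)}\otimes\mathcal H_A^{(k')}$; for $k=k'$ let these be $\bar\rho_A^{(k)}$ and $\mathcal L_A^{(k)}$ on $\mathcal H_A^{(k)}$. Let $\mathcal S^{(k,k')}(X)=X-\mathrm{Tr}(X)\bar\rho_A^{(k,k')}$, $$q_j^{(k,k')}=\mathrm{Tr}\big(F_j^{(k)}\bar\rho_A^{(k,k')}F_j^{(k')\dagger}\big)+\mathbf 1_{k=k'}\Big(\bar\tau\,\mathrm{Tr}\,\bar{\mathcal F}_{jj}^{(k)}+\tfrac\pi2|\beta_j^{(k)}|^2\Big),\qquad f_j=\sum_{k,k'}q_j^{(k,k')},$$ $$\begin{aligned}\mathcal K_2^Q(\rho_s)=&\int_0^\infty e^{t\mathcal L_A}\Big(\mathcal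 S\Big(\sum_{k,\mu}W_\mu^{(k)}(t)(\bar\rho_A\otimes\rho_s)W_\mu^{(k)}(t)^\dagger\Big)\Big)dt\\&+\frac{c\bar\tau}{\pi}\,\bar\rho_A\otimes\mathrm{Tr}_A\Big[\int_0^{\pi/c}\sum_{k,\mu}W_\mu^{(k)}(t)(\bar\rho_A\otimes\rho_s)W_\mu^{(k)}(t)^\dagger dt\Big]\\&+c\,\bar\rho_A\otimes\sum_k\int_0^{\pi/(2c)}\mathfrak w^{(k)}(t)\rho_s\mathfrak w^{(k)}(t)^\dagger dt+\bar\rho_A\otimes\sum_jf_jB_j\rho_sB_j^\dagger ,\end{aligned}$$ where the improper integral converges absolutely. There are operators $U_{jh}^{(k,k')}$ ($j,h\in\{1,2\}$) on $\mathcal H_A^{(k)}\otimes\mathcal H_A^{(k')}$ (on $\mathcal H_A^{(k)}$ if $k=k'$) with $$\mathcal L_A^{(k,k')}\big(U_{jh}^{(k,k')}\bar\rho_A^{(k,k')}\big)+\mathcal S^{(k,k')}\Big(2ic(h-j)U_{jh}^{(k,k')}\bar\rho_A^{(k,k')}-A_j^{(k)\dagger}F_h^{(k')}\bar\rho_A^{(k,k')}\Big)=0,$$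 $$\mathrm{Tr}\big[2ic(h-j)U_{jh}^{(k,k')}\bar\rho_A^{(k,k')}\big]=\mathrm{Tr}\big[A_j^{(k)\dagger}F_h^{(k')}\bar\rho_A^{(k,k')}\big]\ (h\ne j),\qquad \mathrm{Tr}\big[U_{jj}^{(k,k')}\bar\rho_A^{(k,k')}\big]=-q_j^{(k,k')},$$ and for every such family, with $N=\sum_{k,k'}\sum_{h,j}U_{jh}^{(k,k')}\otimes B_j^\dagger B_h$, $$\mathcal K_2(\rho_s)=N(\bar\rho_A\otimes\rho_s)+(\bar\rho_A\otimes\rho_s)N^\dagger+M(\bar\rho_A\otimes\rho_s)M^\dagger+\mathcal K_2^Q(\rho_s)$$ has the properties stated above. -/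

import Mathlib

open scoped Matrix Kronecker Topology ComplexConjugate ComplexOrder
open Filter MeasureTheory

noncomputable section

namespace AdiabaticElimination

/-! ### Operators, Lindbladians, completely positive maps -/

/-- Operators on the finite-dimensional Hilbert space `ℂ^m`. -/
abbrev Op (m : Type*) := Matrix m m ℂ

section General

variable {m p : Type*} [Fintype m] [DecidableEq m] [Fintype p] [DecidableEq p]

/-- `D_L(ρ) = L ρ L† - ½ L†L ρ - ½ ρ L†L`. -/
def dissipator (L ρ : Op m) : Op m :=
  L * ρ * Lᴴ - (1 / 2 : ℂ) • (Lᴴ * L * ρ) - (1 / 2 : ℂ) • (ρ * (Lᴴ * L))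

/-- `ρ ↦ -i[H, ρ] + ∑_μ D_{L_μ}(ρ)`. -/
def lindblad {J : Type*} [Fintype J] (H : Op m) (L : J → Op m) (ρ : Op m) : Op m :=
  -(Complex.I • ⁅H, ρ⁆) + ∑ μ, dissipator (L μ) ρ

/-- A superoperator is a Lindbladian if it has the Lindblad form for some Hermitian Hamiltonian
and finitely many decoherence operators. -/
def IsLindbladian (Φ : Op m → Op m) : Prop :=
  ∃ H : Op m, H.IsHermitian ∧ ∃ (r : ℕ) (L : Fin r → Op m), ∀ ρ, Φ ρ = lindblad H L ρ

/-- Density operators. -/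
def IsDensity (ρ : Op m) : Prop := ρ.PosSemidef ∧ ρ.trace = 1

/-- `exp(tΦ)(X) = ∑_j t^j/j! Φ^j(X)`. -/
def semigroup (Φ : Op m → Op m) (t : ℝ) (X : Op m) : Op m :=
  ∑' j : ℕ, ((t : ℂ) ^ j / (j.factorial : ℂ)) • Φ^[j] X

/-- `σ` is the unique steady state of the generator `Φ`, and every initial state converges to it. -/
structure RelaxesTo (Φ : Op m → Op m) (σ : Op m) : Prop where
  density : IsDensity σ
  stationary : Φ σ = 0
  unique : ∀ τ, IsDensity τ → Φ τ = 0 → τ = σ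
  converges : ∀ τ, IsDensity τ → Tendsto (fun t : ℝ => semigroup Φ t τ) atTop (𝓝 σ)

/-- Completely positive (Kraus form) and trace-preserving. -/
def IsCPTP (Φ : Op m → Op p) : Prop :=
  (∃ (r : ℕ) (V : Fin r → Matrix p m ℂ), ∀ X, Φ X = ∑ l, V l * X * (V l)ᴴ) ∧
    ∀ X, (Φ X).trace = X.trace

/-- The family `Φ ε` is CPTP up to terms of order `q`: for all small `ε > 0` it differs from a
genuine CPTP map by `O(ε^q)`. -/
def IsCPTPUpTo (q : ℕ) (Φ : ℝ → Op m → Op p) : Prop :=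
  ∃ Ψ : ℝ → Op m → Op p, (∀ᶠ ε in 𝓝[>] (0 : ℝ), IsCPTP (Ψ ε)) ∧
    ∀ X i j, (fun ε : ℝ => (Φ ε X - Ψ ε X) i j) =O[𝓝[>] (0 : ℝ)] (fun ε : ℝ => ε ^ q)

/-- Entrywise integral of an operator-valued function over `[0, T]` (oriented if `T < 0`). -/
def opIntegral (T : ℝ) (X : ℝ → Op m) : Op m :=
  Matrix.of fun i j => ∫ t in (0 : ℝ)..T, X t i j

/-- Entrywise integral of an operator-valued function over `[0, ∞)`. -/
def opIntegralInfty (X : ℝ → Op m) : Op m :=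
  Matrix.of fun i j => ∫ t in Set.Ioi (0 : ℝ), X t i j

/-- Partial trace over the first tensor factor. -/
def partialTrace {n : Type*} (X : Op (m × n)) : Op n :=
  Matrix.of fun b b' => ∑ a, X (a, b) (a, b')

/-- `id ⊗ Φ`, for a superoperator `Φ` on the second tensor factor. -/
def onSecond {n : Type*} (Φ : Op n → Op n) (X : Op (m × n)) : Op (m × n) :=
  Matrix.of fun x y => Φ (Matrix.of fun b b' => X (x.1, b) (y.1, b')) x.2 y.2

end General

/-! ### Tensor products of finitely many spaces

The space `⨂_i ℂ^(d i)` has the basis indexed by `∀ i, d i`. -/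

section Tensor

variable {ι : Type*} [Fintype ι] [DecidableEq ι] {d : ι → Type*}
  [∀ i, Fintype (d i)] [∀ i, DecidableEq (d i)]

/-- `⨂_i ρ_i`. -/
def tensor (ρ : ∀ i, Op (d i)) : Op (∀ i, d i) :=
  Matrix.of fun a a' => ∏ i, ρ i (a i) (a' i)

/-- The operator `X` on the factor `k`, tensored with the identity on all other factors. -/
def site (k : ι) (X : Op (d k)) : Op (∀ i, d i) :=
  Matrix.of fun a a' => if ∀ i, i ≠ k → a i = a' i then X (a k) (a' k) else 0

/-- The operator `X` on the factors in `s`, tensored with the identity on all other factors. -/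
def onSub (s : Finset ι) (X : Op (∀ i : s, d i)) : Op (∀ i, d i) :=
  Matrix.of fun a a' =>
    if ∀ i, i ∉ s → a i = a' i then X (fun i => a i) (fun i => a' i) else 0

end Tensor

/-! ### The model -/

/-- A target system on `ℂ^n` coupled to `K` dissipative subsystems on `ℂ^(dA k)`, the `k`-th of
which has `mA k` decoherence operators. -/
structure Model (K : ℕ) (dA mA : Fin K → ℕ) (n : ℕ) where
  /-- Hamiltonians of the environment parts. -/
  HA : ∀ k, Op (Fin (dA k))
  HA_herm : ∀ k, (HA k).IsHermitian
  /-- Decoherence operators of the environment parts. -/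
  LA : ∀ k, Fin (mA k) → Op (Fin (dA k))
  /-- Steady states of the environment parts. -/
  ρA : ∀ k, Op (Fin (dA k))
  relaxes : ∀ k, RelaxesTo (lindblad (HA k) (LA k)) (ρA k)
  /-- Coupling operators. -/
  A : ∀ k, Op (Fin (dA k))
  B : Op (Fin n)
  /-- The fast Hamiltonian of the target system. -/
  HB : Op (Fin n)
  HB_herm : HB.IsHermitian
  /-- The slow Lindbladian of the target system. -/
  LB : Op (Fin n) → Op (Fin n)
  LB_lindbladian : IsLindbladian LB

namespace Model

variable {K : ℕ} {dA mA : Fin K → ℕ} {n : ℕ} (M : Model K dA mA n)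

/-- Operators on `H_A = ⨂_k H_A^(k)`. -/
abbrev OpA (dA : Fin K → ℕ) := Op (∀ k, Fin (dA k))

/-- Operators on `H_A ⊗ H_B`. -/
abbrev OpAB (dA : Fin K → ℕ) (n : ℕ) := Op ((∀ k, Fin (dA k)) × Fin n)

/-- Operators on `H_A^(k) ⊗ H_A^(k')`; this is `H_A^(k)` when `k = k'`. -/
abbrev OpPair (dA : Fin K → ℕ) (k k' : Fin K) :=
  Op (∀ i : ({k, k'} : Finset (Fin K)), Fin (dA i))

/-- `X` on `H_A^(k)`, as an operator on `H_A`. -/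
def siteA (k : Fin K) (X : Op (Fin (dA k))) : OpA dA :=
  site (d := fun i => Fin (dA i)) k X

/-- `L_A = ∑_k L_A^(k)` on `H_A ⊗ H_B`. -/
def LAtot (X : OpAB dA n) : OpAB dA n :=
  ∑ k, lindblad (siteA k (M.HA k) ⊗ₖ (1 : Op (Fin n)))
    (fun μ => siteA k (M.LA k μ) ⊗ₖ (1 : Op (Fin n))) X

/-- `L_int = ∑_k -i[A^(k) ⊗ B† + A^(k)† ⊗ B, ·]`. -/
def Lint (X : OpAB dA n) : OpAB dA n :=
  ∑ k, -(Complex.I • ⁅siteA k (M.A k) ⊗ₖ M.Bᴴ + siteA k (M.A k)ᴴ ⊗ₖ M.B, X⁆)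

/-- `-i[H_B, ·]` on `H_A ⊗ H_B`. -/
def adHB (X : OpAB dA n) : OpAB dA n :=
  -(Complex.I • ⁅(1 : OpA dA) ⊗ₖ M.HB, X⁆)

/-- The product `ρ̄_A` of the steady states. -/
def ρtot : OpA dA := tensor M.ρA

/-- The second-order invariance equation for
`K = K₀ + εK₁ + ε²K₂ + …` and `L_s = L₀ + εL₁ + ε²L₂ + …`. -/
def SecondOrderInvariance (K₀ K₁ K₂ : Op (Fin n) → OpAB dA n)
    (L₀ L₁ L₂ : Op (Fin n) → Op (Fin n)) : Prop :=
  ∀ ρs, M.LAtot (K₂ ρs) + M.Lint (K₁ ρs) + onSecond M.LB (K₁ ρs) + M.adHB (K₂ ρs) =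
    K₀ (L₂ ρs) + K₁ (L₁ ρs) + K₂ (L₀ ρs)

/-! Indexed operators; the index values `0, 1` stand for `1, 2`. -/

/-- `A_1 = A`, `A_2 = A†`. -/
def Aj (j : Fin 2) (k : Fin K) : Op (Fin (dA k)) := ![M.A k, (M.A k)ᴴ] j

/-- `B_1 = B†`, `B_2 = B`. -/
def Bj (j : Fin 2) : Op (Fin n) := ![M.Bᴴ, M.B] j

/-- `δ_{hj} = h - j`. -/
def idxDiff (h j : Fin 2) : ℂ := ((h : ℕ) : ℂ) - ((j : ℕ) : ℂ)

/-! ### Zeroth and first order -/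

/-- `L_{s,0} = -i[H_B, ·]`. -/
def Ls0 (ρs : Op (Fin n)) : Op (Fin n) := -(Complex.I • ⁅M.HB, ρs⁆)

/-- `K_0(ρ_s) = ρ̄_A ⊗ ρ_s`. -/
def K0 (ρs : Op (Fin n)) : OpAB dA n := M.ρtot ⊗ₖ ρs

/-- The equations that select the operators `F_1^(k)` and `F_2^(k)`. -/
def FirstOrderEqs (c : ℝ) (F : Fin 2 → ∀ k, Op (Fin (dA k))) : Prop :=
  ∀ k,
    lindblad (M.HA k) (M.LA k) (F 0 k * M.ρA k) + M.A k * M.ρA k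
      - (Complex.I * c) • (F 0 k * M.ρA k) = 0 ∧
    lindblad (M.HA k) (M.LA k) (F 1 k * M.ρA k) + (M.A k)ᴴ * M.ρA k
      + (Complex.I * c) • (F 1 k * M.ρA k) = 0

section SecondOrder

variable (c : ℝ) (F : Fin 2 → ∀ k, Op (Fin (dA k)))

/-- `M = ∑_k (F_1^(k) ⊗ B† + F_2^(k) ⊗ B)`. -/
def opM : OpAB dA n := ∑ k, ∑ j, siteA k (F j k) ⊗ₖ M.Bj j

/-- `K_1(ρ_s) = -i M (ρ̄_A ⊗ ρ_s) + i (ρ̄_A ⊗ ρ_s) M†`. -/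
def K1 (ρs : Op (Fin n)) : OpAB dA n :=
  -(Complex.I • (M.opM F * M.K0 ρs)) + Complex.I • (M.K0 ρs * (M.opM F)ᴴ)

/-! ### The second-order Lindbladian -/

def z0 (k : Fin K) : ℂ := (M.A k * M.ρA k).trace

def z1 (k : Fin K) : ℂ := (F 0 k * M.ρA k * (M.A k)ᴴ).trace

def z2 (k : Fin K) : ℂ := (F 1 k * M.ρA k * M.A k).trace

def δ (k k' : Fin K) : ℝ := -2 * (M.z0 k * conj (M.z0 k')).re / c

def Ls2 (ρs : Op (Fin n)) : Op (Fin n) :=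
  (∑ k,
    (-((Complex.I * ((M.z1 F k).im : ℂ)) • ⁅M.B * M.Bᴴ, ρs⁆)
      - (Complex.I * ((M.z2 F k).im : ℂ)) • ⁅M.Bᴴ * M.B, ρs⁆
      + (2 * ((M.z1 F k).re : ℂ)) • dissipator M.Bᴴ ρs
      + (2 * ((M.z2 F k).re : ℂ)) • dissipator M.B ρs))
  + ∑ k, ∑ k' ∈ Finset.Iio k, -((Complex.I * (M.δ c k k' : ℂ)) • ⁅⁅M.B, M.Bᴴ⁆, ρs⁆)

/-! ### The second-order correction of the Kraus map -/

/-- `F̄_{hj}^(k) = ∑_μ [L_μ^(k), F_h^(k)] ρ̄^(k) [L_μ^(k), F_j^(k)]†`. -/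
def Fbar (h j : Fin 2) (k : Fin K) : Op (Fin (dA k)) :=
  ∑ μ, ⁅M.LA k μ, F h k⁆ * M.ρA k * (⁅M.LA k μ, F j k⁆)ᴴ

/-- `b^(k) = -Tr(F̄_{21}^(k)) / (2c)`. -/
def b (k : Fin K) : ℂ := -(1 / (2 * (c : ℂ))) * (M.Fbar F 1 0 k).trace

/-- `W_μ^(k)(t) = [L_μ^(k), F_1^(k)] ⊗ B† + e^{2ict} [L_μ^(k), F_2^(k)] ⊗ B`. -/
def opW (k : Fin K) (μ : Fin (mA k)) (t : ℝ) : OpAB dA n :=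
  siteA k ⁅M.LA k μ, F 0 k⁆ ⊗ₖ M.Bᴴ
    + Complex.exp (2 * Complex.I * c * t) • (siteA k ⁅M.LA k μ, F 1 k⁆ ⊗ₖ M.B)

/-- `∑_{k,μ} W_μ^(k)(t) (ρ̄_A ⊗ ρ_s) W_μ^(k)(t)†`. -/
def sumW (ρs : Op (Fin n)) (t : ℝ) : OpAB dA n :=
  ∑ k, ∑ μ, M.opW c F k μ t * M.K0 ρs * (M.opW c F k μ t)ᴴ

/-- `w^(k)(t) = B† + b^(k) e^{-2ict} B`. -/
def opw (k : Fin K) (t : ℝ) : Op (Fin n) :=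
  M.Bᴴ + (M.b c F k * Complex.exp (-(2 * Complex.I * c * t))) • M.B

def gMap (ρs : Op (Fin n)) : Op (Fin n) :=
  ∑ k, opIntegral (Real.pi / (2 * c)) fun t => M.opw c F k t * ρs * (M.opw c F k t)ᴴ

def GMap (ρs : Op (Fin n)) : Op (Fin n) :=
  partialTrace (opIntegral (Real.pi / c) fun t => M.sumW c F ρs t)

/-- `S(X) = X - ρ̄_A ⊗ Tr_A X`. -/
def Sproj (X : OpAB dA n) : OpAB dA n := X - M.ρtot ⊗ₖ partialTrace X

/-- `exp(t L_A)(S(∑_{k,μ} W_μ^(k)(t) (ρ̄_A ⊗ ρ_s) W_μ^(k)(t)†))`. -/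
def K2Integrand (ρs : Op (Fin n)) (t : ℝ) : OpAB dA n :=
  semigroup M.LAtot t (M.Sproj (M.sumW c F ρs t))

/-! Operators on pairs of environment parts. -/

/-- `X` on the factor `k` of `H_A^(k) ⊗ H_A^(k')`. -/
def left (k k' : Fin K) (X : Op (Fin (dA k))) : OpPair dA k k' :=
  site (ι := ({k, k'} : Finset (Fin K))) (d := fun i => Fin (dA i)) ⟨k, by simp⟩ X

/-- `X` on the factor `k'` of `H_A^(k) ⊗ H_A^(k')`. -/
def right (k k' : Fin K) (X : Op (Fin (dA k'))) : OpPair dA k k' :=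
  site (ι := ({k, k'} : Finset (Fin K))) (d := fun i => Fin (dA i)) ⟨k', by simp⟩ X

/-- `ρ̄_A^(k,k') = ρ̄_A^(k) ⊗ ρ̄_A^(k')`, and `ρ̄_A^(k)` when `k = k'`. -/
def ρpair (k k' : Fin K) : OpPair dA k k' :=
  tensor (ι := ({k, k'} : Finset (Fin K))) (d := fun i => Fin (dA i)) fun i => M.ρA i

/-- `L_A^(k,k') = L_A^(k) + L_A^(k')`, and `L_A^(k)` when `k = k'`. -/
def LApair (k k' : Fin K) (X : OpPair dA k k') : OpPair dA k k' :=
  ∑ i : ({k, k'} : Finset (Fin K)),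
    lindblad (site (d := fun i : ({k, k'} : Finset (Fin K)) => Fin (dA i)) i (M.HA i))
      (fun μ => site (d := fun i : ({k, k'} : Finset (Fin K)) => Fin (dA i)) i (M.LA i μ)) X

/-- `S^(k,k')(X) = X - Tr(X) ρ̄_A^(k,k')`. -/
def Spair (k k' : Fin K) (X : OpPair dA k k') : OpPair dA k k' :=
  X - X.trace • M.ρpair k k'

variable (τ : ℝ)

/-- The number
`Tr(F_j^(k) ρ̄^(k,k') F_j^(k')†) + δ_{kk'} (τ̄ Tr F̄_{jj}^(k) + (π/2) |β_j^(k)|²)`,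
where `β_1^(k) = 1` and `β_2^(k) = b^(k)`. -/
def gauge (j : Fin 2) (k k' : Fin K) : ℂ :=
  (left k k' (F j k) * M.ρpair k k' * (right k k' (F j k'))ᴴ).trace
    + if k = k' then
        (τ : ℂ) * (M.Fbar F j j k).trace
          + ((Real.pi / 2 * ‖(![1, M.b c F k] : Fin 2 → ℂ) j‖ ^ 2 : ℝ) : ℂ)
      else 0

/-- `f_j = ∑_{k,k'} gauge_j^(k,k')`. -/
def fConst (j : Fin 2) : ℂ := ∑ k, ∑ k', M.gauge c F τ j k k'

def fMap (ρs : Op (Fin n)) : Op (Fin n) :=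
  ∑ j, M.fConst c F τ j • (M.Bj j * ρs * (M.Bj j)ᴴ)

def K2Q (ρs : Op (Fin n)) : OpAB dA n :=
  opIntegralInfty (M.K2Integrand c F ρs)
    + ((c * τ / Real.pi : ℝ) : ℂ) • (M.ρtot ⊗ₖ M.GMap c F ρs)
    + (c : ℂ) • (M.ρtot ⊗ₖ M.gMap c F ρs)
    + M.ρtot ⊗ₖ M.fMap c F τ ρs

variable (U : Fin 2 → Fin 2 → ∀ k k', OpPair dA k k')

/-- The equations that select the operators `U j h k k'`, that is `U_{B_j† B_h}^(k,k')`. -/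
structure SecondOrderEqs : Prop where
  balance : ∀ j h k k',
    M.LApair k k' (U j h k k' * M.ρpair k k')
      + M.Spair k k' ((2 * Complex.I * c * idxDiff h j) • (U j h k k' * M.ρpair k k')
          - left k k' (M.Aj j k)ᴴ * right k k' (F h k') * M.ρpair k k') = 0
  trace_offdiag : ∀ j h, h ≠ j → ∀ k k',
    ((2 * Complex.I * c * idxDiff h j) • (U j h k k' * M.ρpair k k')).trace
      = (left k k' (M.Aj j k)ᴴ * right k k' (F h k') * M.ρpair k k').trace
  trace_diag : ∀ j k k',
    (U j j k k' * M.ρpair k k').trace = -M.gauge c F τ j k k'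

/-- `N = ∑_{k,k'} ∑_{h,j} U_{B_j† B_h}^(k,k') ⊗ B_j† B_h`. -/
def opN : OpAB dA n :=
  ∑ k, ∑ k', ∑ h, ∑ j, onSub {k, k'} (U j h k k') ⊗ₖ ((M.Bj j)ᴴ * M.Bj h)

/-- `K_2(ρ_s) = N (ρ̄_A ⊗ ρ_s) + (ρ̄_A ⊗ ρ_s) N† + M (ρ̄_A ⊗ ρ_s) M† + K_2^Q(ρ_s)`, the coefficient
of `ε²` in `(1 - iεM + ε²N)(ρ̄_A ⊗ ρ_s)(1 - iεM + ε²N)† + ε² K_2^Q(ρ_s)`. -/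
def K2 (ρs : Op (Fin n)) : OpAB dA n :=
  M.opN U * M.K0 ρs + M.K0 ρs * (M.opN U)ᴴ + M.opM F * M.K0 ρs * (M.opM F)ᴴ + M.K2Q c F τ ρs

end SecondOrder

end Model

end AdiabaticElimination

end

open AdiabaticElimination

set_option linter.unusedSectionVars false

noncomputable section

/-! The `K` parts act as one environment. With `σ = ⨂ ρ̄_A^(k)`, `a = ∑ A^(k)`, `f_j = ∑ F_j^(k)`
and `u_jh = ∑ U_jh^(k,k')`, the sums satisfy the corrector equations of a single relaxing
Lindbladian (`FirstOrderEqs.total`, `SecondOrderEqs.total`). The core of the proof therefore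
concerns one environment.

Solvability. The kernel of a stationary state is invariant under the adjoint jumps and drift, so the
left ideal of operators `Zσ` is invariant under the generator. Relaxation rules out nonzero
imaginary eigenvalues, and the kernel is spanned by `σ`. Finite-dimensional injectivity then yields
correctors of the form `Zσ` (`exists_resolvent`, `exists_traceless_inverse`).

Invariance. Apply `L_A - i[H_B, ·]` to each term of `K₂`. The corrector equations turn the `N` and
`M` terms into the negative of `L_int K₁` plus scalar multiples of `σ`, up to the Leibniz defect `∑
[L_μ, M](σ ⊗ ρ)[L_μ, M]†` of the dissipative generator. `K₂^Q` is built to cancel this defect. Its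
improper integral is a Duhamel integral that removes the centered part. The oscillating part of the
partial trace, carried by `BρB` and `B†ρB†`, is removed by the finite integral, because these terms
have eigenvalues `±2ic`. The mean part stays and supplies the jump terms of `L_{s,2}`. Its
coefficients are traces of positive operators, so the rates are nonnegative
(`second_order_invariance`, `isLindbladian_effective`).

Positivity. Up to `O(ε³)` the expansion equals `(1 - iεM + ε²N)(σ ⊗ ρ)(1 - iεM + ε²N)† + ε²
K₂^Q(ρ)`, so it is enough that `K₂^Q` is completely positive. The improper integral is a difference
of completely positive maps. On the kernel of the Choi matrix of the mean noise the subtracted part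
vanishes, and a Finsler-type compactness argument provides `τ̄` (`exists_posSemidef_add_smul`,
`exists_isCP_noise`). The remaining quadratic terms are positive because `π/2 ≥ 1` allows completing
a square (`isCP_quadMap_osc`).

Trace. The prescribed traces of `U` make the first- and second-order traces vanish
(`trace_secondMap`). A correction of order `ε³` that keeps complete positivity then restores the
trace exactly (`isCPTPUpTo_three`). -/

namespace AdiabaticElimination

/-! ### Algebra of Lindblad generators -/

section LindbladAlgebra

variable {m p : Type*} [Fintype m] [DecidableEq m] [Fintype p] [DecidableEq p]
variable {J : Type*} [Fintype J]

/-- The operator `G` in `ℒ(ρ) = Gρ + ρG' + ∑_μ L_μ ρ L_μ†`. -/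
def drift (H : Op m) (L : J → Op m) : Op m :=
  -(Complex.I • H) - (1 / 2 : ℂ) • ∑ μ, (L μ)ᴴ * L μ

/-- The operator `G'` in `ℒ(ρ) = Gρ + ρG' + ∑_μ L_μ ρ L_μ†`. -/
def codrift (H : Op m) (L : J → Op m) : Op m :=
  Complex.I • H - (1 / 2 : ℂ) • ∑ μ, (L μ)ᴴ * L μ

theorem lindblad_eq (H : Op m) (L : J → Op m) (ρ : Op m) :
    lindblad H L ρ = drift H L * ρ + ρ * codrift H L + ∑ μ, L μ * ρ * (L μ)ᴴ := by
  simp only [lindblad, dissipator, drift, codrift, Ring.lie_def, Finset.sum_sub_distrib,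
    ← Finset.smul_sum, ← Finset.sum_mul, ← Finset.mul_sum, sub_mul, mul_sub, smul_mul_assoc,
    mul_smul_comm, neg_mul, smul_sub]
  abel

theorem conjTranspose_drift {H : Op m} (hH : H.IsHermitian) (L : J → Op m) :
    (drift H L)ᴴ = codrift H L := by
  simp [drift, codrift, Matrix.conjTranspose_sum, hH.eq]

theorem conjTranspose_codrift {H : Op m} (hH : H.IsHermitian) (L : J → Op m) :
    (codrift H L)ᴴ = drift H L := by
  rw [← conjTranspose_drift hH, Matrix.conjTranspose_conjTranspose]

/-- `lindblad H L` as a linear map. -/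
def lindbladMap (H : Op m) (L : J → Op m) : Op m →ₗ[ℂ] Op m where
  toFun := lindblad H L
  map_add' x y := by
    simp only [lindblad_eq, mul_add, add_mul, Finset.sum_add_distrib]; abel
  map_smul' a x := by
    simp only [lindblad_eq, mul_smul_comm, smul_mul_assoc, smul_add, Finset.smul_sum,
      RingHom.id_apply]

@[simp] theorem lindbladMap_apply (H : Op m) (L : J → Op m) (ρ : Op m) :
    lindbladMap H L ρ = lindblad H L ρ := rfl

theorem lindblad_sum {ι : Type*} (s : Finset ι) (H : Op m) (L : J → Op m) (x : ι → Op m) :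
    lindblad H L (∑ i ∈ s, x i) = ∑ i ∈ s, lindblad H L (x i) := map_sum (lindbladMap H L) x s

theorem trace_lindblad (H : Op m) (L : J → Op m) (ρ : Op m) : (lindblad H L ρ).trace = 0 := by
  have h : ∀ μ, (L μ * ρ * (L μ)ᴴ).trace = (ρ * ((L μ)ᴴ * L μ)).trace := fun μ => by
    rw [Matrix.mul_assoc, Matrix.trace_mul_comm, Matrix.mul_assoc]
  rw [lindblad_eq, Matrix.trace_add, Matrix.trace_add, Matrix.trace_mul_comm, ← Matrix.trace_add,
    ← mul_add, Matrix.trace_sum, Finset.sum_congr rfl fun μ _ => h μ, ← Matrix.trace_sum,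
    ← Matrix.trace_add, ← Finset.mul_sum, ← mul_add]
  have : drift H L + codrift H L + ∑ μ, (L μ)ᴴ * L μ = 0 := by
    simp only [drift, codrift]
    module
  rw [this, mul_zero, Matrix.trace_zero]

theorem lindblad_conjTranspose {H : Op m} (hH : H.IsHermitian) (L : J → Op m) (ρ : Op m) :
    lindblad H L ρᴴ = (lindblad H L ρ)ᴴ := by
  simp only [lindblad_eq, Matrix.conjTranspose_add, Matrix.conjTranspose_mul,
    conjTranspose_drift hH, conjTranspose_codrift hH, Matrix.conjTranspose_sum,
    Matrix.conjTranspose_conjTranspose, Matrix.mul_assoc]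
  abel

/-- The defect of the Leibniz rule for a Lindbladian. -/
theorem lindblad_mul_mul (H : Op m) (L : J → Op m) (X R Y : Op m) :
    lindblad H L (X * R * Yᴴ) = lindblad H L (X * R) * Yᴴ + X * lindblad H L (R * Yᴴ)
      - X * lindblad H L R * Yᴴ + ∑ μ, ⁅L μ, X⁆ * R * (⁅L μ, Y⁆)ᴴ := by
  have h : ∑ μ, ⁅L μ, X⁆ * R * (⁅L μ, Y⁆)ᴴ = ∑ μ, L μ * (X * R * Yᴴ) * (L μ)ᴴ
      - (∑ μ, L μ * (X * R) * (L μ)ᴴ) * Yᴴ - X * (∑ μ, L μ * (R * Yᴴ) * (L μ)ᴴ)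
      + X * (∑ μ, L μ * R * (L μ)ᴴ) * Yᴴ := by
    simp only [Finset.sum_mul, Finset.mul_sum, ← Finset.sum_sub_distrib, ← Finset.sum_add_distrib]
    refine Finset.sum_congr rfl fun μ _ => ?_
    simp only [Ring.lie_def, Matrix.conjTranspose_sub, Matrix.conjTranspose_mul]
    noncomm_ring
  rw [h]
  simp only [lindblad_eq]
  noncomm_ring

theorem lindblad_mul_left_of_commute {H : Op m} {L : J → Op m} {Z : Op m} (hH : Commute Z H)
    (hL : ∀ μ, Commute Z (L μ)) (hL' : ∀ μ, Commute Z (L μ)ᴴ) (X : Op m) :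
    lindblad H L (Z * X) = Z * lindblad H L X := by
  have hd : Commute Z (drift H L) := by
    refine ((hH.smul_right _).neg_right).sub_right (Commute.smul_right ?_ _)
    exact Commute.sum_right _ _ _ fun μ _ => (hL' μ).mul_right (hL μ)
  simp only [lindblad_eq, mul_add, Finset.mul_sum, ← mul_assoc, hd.eq, (hL _).eq]

theorem lindblad_mul_right_of_commute {H : Op m} {L : J → Op m} {Z : Op m} (hH : Commute Z H)
    (hL : ∀ μ, Commute Z (L μ)) (hL' : ∀ μ, Commute Z (L μ)ᴴ) (X : Op m) :
    lindblad H L (X * Z) = lindblad H L X * Z := by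
  have hd : Commute Z (codrift H L) := by
    refine (hH.smul_right _).sub_right (Commute.smul_right ?_ _)
    exact Commute.sum_right _ _ _ fun μ _ => (hL' μ).mul_right (hL μ)
  simp only [lindblad_eq, add_mul, Finset.sum_mul, mul_assoc, hd.eq, (hL' _).eq]

theorem map_lindblad (φ : Op m →⋆ₐ[ℂ] Op p) (H : Op m) (L : J → Op m) (X : Op m) :
    φ (lindblad H L X) = lindblad (φ H) (fun μ => φ (L μ)) (φ X) := by
  have hs : ∀ Y : Op m, φ Yᴴ = (φ Y)ᴴ := fun Y => map_star φ Y
  simp only [lindblad, dissipator, Ring.lie_def, map_add, map_neg, map_smul, map_sub, map_mul,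
    map_sum, hs]

/-- The common tool for passing to tensor factors: `φ` embeds one factor, `T` lives on the others,
and the generator of the embedded factor does not see `T`. -/
theorem lindblad_map_mul (φ : Op m →⋆ₐ[ℂ] Op p) (H : Op m) (L : J → Op m) (X : Op m) (T : Op p)
    (hT : ∀ Y, Commute T (φ Y)) :
    lindblad (φ H) (fun μ => φ (L μ)) (φ X * T) = φ (lindblad H L X) * T := by
  rw [lindblad_mul_right_of_commute (hT _) (fun μ => hT _), map_lindblad]
  intro μ
  have : (φ (L μ))ᴴ = φ (L μ)ᴴ := (map_star φ (L μ)).symm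
  rw [this]
  exact hT _

/-- This is what lets several environment parts be treated as one, with jumps indexed by a sigma
type. -/
theorem sum_lindblad {ι : Type*} [Fintype ι] {J : ι → Type*} [∀ i, Fintype (J i)]
    (H : ι → Op m) (L : ∀ i, J i → Op m) (X : Op m) :
    ∑ i, lindblad (H i) (L i) X = lindblad (∑ i, H i) (fun s : Σ i, J i => L s.1 s.2) X := by
  simp only [lindblad, Fintype.sum_sigma, Finset.sum_add_distrib, Ring.lie_def, Finset.sum_mul,
    Finset.mul_sum, smul_sub, Finset.smul_sum, Finset.sum_neg_distrib, Finset.sum_sub_distrib]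

end LindbladAlgebra

/-! ### Supports of stationary states -/

section Support

variable {m : Type*} [Fintype m] [DecidableEq m] {J : Type*} [Fintype J]

/-- `X` is a left multiple of `σ` if it vanishes on the kernel of `σ`. -/
theorem exists_mul_eq_of_ker_le (σ X : Op m) (h : ∀ v, σ *ᵥ v = 0 → X *ᵥ v = 0) :
    ∃ Y : Op m, X = Y * σ := by
  have hker : LinearMap.ker (Matrix.toLin' σ) ≤ LinearMap.ker (Matrix.toLin' X) := fun v hv => by
    simpa using h v (by simpa using hv)
  -- `σ` induces an injection of the quotient by its kernel, with left inverse `g`; `X` factors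
  -- through the same quotient.
  obtain ⟨g, hg⟩ := LinearMap.exists_leftInverse_of_injective
    ((LinearMap.ker (Matrix.toLin' σ)).liftQ (Matrix.toLin' σ) le_rfl)
    (Submodule.ker_liftQ_eq_bot _ _ _ le_rfl)
  refine ⟨LinearMap.toMatrix' (((LinearMap.ker (Matrix.toLin' σ)).liftQ _ hker) ∘ₗ g), ?_⟩
  apply Matrix.toLin'.injective
  rw [Matrix.toLin'_mul, Matrix.toLin'_toMatrix']
  ext1 v
  have := LinearMap.congr_fun hg (Submodule.Quotient.mk ((LinearMap.single ℂ _ v) 1))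
  simp only [LinearMap.comp_apply, Submodule.liftQ_apply, LinearMap.id_apply,
    ] at this ⊢
  ext1
  simp only [LinearMap.comp_apply]
  rw [this]
  simp

theorem posSemidef_mulVec_eq_zero {σ : Op m} (hσ : σ.PosSemidef) {v : m → ℂ}
    (h : star v ⬝ᵥ (σ *ᵥ v) = 0) : σ *ᵥ v = 0 :=
  (hσ.dotProduct_mulVec_zero_iff v).1 h

theorem star_dotProduct_conj_mulVec (L σ : Op m) (v : m → ℂ) :
    star v ⬝ᵥ ((L * σ * Lᴴ) *ᵥ v) = star (Lᴴ *ᵥ v) ⬝ᵥ (σ *ᵥ (Lᴴ *ᵥ v)) := by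
  rw [Matrix.star_mulVec, Matrix.conjTranspose_conjTranspose, ← Matrix.dotProduct_mulVec]
  simp only [Matrix.mulVec_mulVec, Matrix.mul_assoc]

/-- The kernel of a stationary state is invariant under the adjoint jump operators and the adjoint
drift. -/
theorem stationary_ker {H : Op m} {L : J → Op m} {σ : Op m}
    (hσ : σ.PosSemidef) (hst : lindblad H L σ = 0) {v : m → ℂ} (hv : σ *ᵥ v = 0) :
    (∀ μ, σ *ᵥ ((L μ)ᴴ *ᵥ v) = 0) ∧ σ *ᵥ (codrift H L *ᵥ v) = 0 := by
  have hv' : star v ᵥ* σ = 0 := by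
    have := congrArg star hv
    rwa [Matrix.star_mulVec, hσ.isHermitian.eq, star_zero] at this
  have h0 := hst
  rw [lindblad_eq] at h0
  -- Tested on `v` from both sides, the drift terms vanish, leaving a zero sum of nonnegative terms.
  have h1 : ∑ μ, star ((L μ)ᴴ *ᵥ v) ⬝ᵥ (σ *ᵥ ((L μ)ᴴ *ᵥ v)) = 0 := by
    have := congrArg (fun X : Op m => star v ⬝ᵥ (X *ᵥ v)) h0
    simp only [Matrix.add_mulVec, dotProduct_add, Matrix.zero_mulVec, dotProduct_zero,
      Matrix.sum_mulVec, dotProduct_sum, star_dotProduct_conj_mulVec] at this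
    rw [← Matrix.mulVec_mulVec, hv, ← Matrix.mulVec_mulVec, Matrix.dotProduct_mulVec _ σ, hv'] at this
    simpa using this
  have h2 : ∀ μ, σ *ᵥ ((L μ)ᴴ *ᵥ v) = 0 := fun μ =>
    posSemidef_mulVec_eq_zero hσ ((Finset.sum_eq_zero_iff_of_nonneg
      (fun μ _ => hσ.dotProduct_mulVec_nonneg _)).1 h1 μ (Finset.mem_univ _))
  refine ⟨h2, ?_⟩
  have := congrArg (fun X : Op m => X *ᵥ v) h0
  simp only [Matrix.add_mulVec, Matrix.zero_mulVec, Matrix.sum_mulVec, ← Matrix.mulVec_mulVec, hv,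
    h2] at this
  simpa using this

/-- The left multiples of a stationary state are invariant under the Lindbladian. -/
theorem lindblad_mul_stationary {H : Op m} {L : J → Op m} {σ : Op m}
    (hσ : σ.PosSemidef) (hst : lindblad H L σ = 0) (Y : Op m) :
    ∃ Z : Op m, lindblad H L (Y * σ) = Z * σ := by
  refine exists_mul_eq_of_ker_le _ _ fun v hv => ?_
  obtain ⟨h1, h2⟩ := stationary_ker hσ hst hv
  simp only [lindblad_eq, Matrix.add_mulVec, Matrix.sum_mulVec, ← Matrix.mulVec_mulVec, hv, h1, h2]
  simp

end Support

/-! ### One-parameter groups and Euler's formula -/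

section Flow

variable {E F : Type*} [NormedAddCommGroup E] [NormedSpace ℂ E] [CompleteSpace E]
  [NormedAddCommGroup F] [NormedSpace ℂ F] [CompleteSpace F]

/-- The one-parameter group `exp(tT)`. -/
def flow (T : E →L[ℂ] E) (t : ℝ) : E →L[ℂ] E := NormedSpace.exp ((t : ℂ) • T)

theorem hasSum_flow (T : E →L[ℂ] E) (t : ℝ) (x : E) :
    HasSum (fun j : ℕ => ((t : ℂ) ^ j / (j.factorial : ℂ)) • T^[j] x) (flow T t x) := by
  have h := NormedSpace.exp_series_hasSum_exp' (𝕂 := ℂ) ((t : ℂ) • T)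
  have h2 := h.mapL (ContinuousLinearMap.apply ℂ E x)
  refine h2.congr_fun fun j => ?_
  rw [smul_pow, smul_smul, ContinuousLinearMap.apply_apply, smul_apply,
    FunLike.coe_pow_eq_iterate, div_eq_inv_mul]

theorem flow_zero (T : E →L[ℂ] E) : flow T 0 = 1 := by simp [flow, NormedSpace.exp_zero]

theorem flow_add (T : E →L[ℂ] E) (s t : ℝ) : flow T (s + t) = flow T s * flow T t := by
  let _ : NormedAlgebra ℚ (E →L[ℂ] E) := NormedAlgebra.restrictScalars ℚ ℂ _
  rw [flow, Complex.ofReal_add, add_smul, NormedSpace.exp_add_of_commute]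
  · rfl
  · exact ((Commute.refl T).smul_left _).smul_right _

theorem hasDerivAt_flow (T : E →L[ℂ] E) (t : ℝ) :
    HasDerivAt (flow T) (T * flow T t) t := by
  have h := (hasDerivAt_exp_smul_const' (𝕂 := ℂ) T (t : ℂ)).scomp t
    (Complex.ofRealCLM.hasDerivAt (x := t))
  simpa [Function.comp_def, flow] using! h

theorem hasDerivAt_flow_apply (T : E →L[ℂ] E) (t : ℝ) {g : ℝ → E} {g' : E}
    (hg : HasDerivAt g g' t) :
    HasDerivAt (fun s => flow T s (g s)) (T (flow T t (g t)) + flow T t g') t := by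
  have hb := (isBoundedBilinearMap_apply (𝕜 := ℂ) (E := E) (F := E))
  have h := (hb.hasFDerivAt (flow T t, g t)).restrictScalars ℝ
  have h2 := h.comp_hasDerivAt t ((hasDerivAt_flow T t).prodMk hg)
  simpa [Function.comp_def, add_comm] using! h2

theorem commute_flow (T : E →L[ℂ] E) (t : ℝ) : Commute T (flow T t) := by
  let _ : NormedAlgebra ℚ (E →L[ℂ] E) := NormedAlgebra.restrictScalars ℚ ℂ _
  exact ((Commute.refl T).smul_right (t : ℂ)).exp_right

theorem flow_neg_mul (T : E →L[ℂ] E) (t : ℝ) : flow T t * flow T (-t) = 1 := by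
  rw [← flow_add, add_neg_cancel, flow_zero]

/-- Transporting `g` back by `flow (-T)` gives a function with zero derivative. Explicit flows are
identified below by this uniqueness. -/
theorem eq_flow_of_hasDerivAt (T : E →L[ℂ] E) {g : ℝ → E}
    (hg : ∀ t, HasDerivAt g (T (g t)) t) (t : ℝ) : g t = flow T t (g 0) := by
  have hd : ∀ s, HasDerivAt (fun s => flow (-T) s (g s)) 0 s := fun s => by
    have h := hasDerivAt_flow_apply (-T) s (hg s)
    have hc : flow (-T) s (T (g s)) = T (flow (-T) s (g s)) := by
      have := (commute_flow (-T) s).neg_left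
      rw [neg_neg] at this
      exact (DFunLike.congr_fun this.eq (g s)).symm
    rw [hc] at h
    simpa using h
  have hc : flow (-T) t (g t) = g 0 := by
    have := is_const_of_deriv_eq_zero (fun s => (hd s).differentiableAt) (fun s => (hd s).deriv) t 0
    simpa [flow_zero] using this
  have hf : flow (-T) t = flow T (-t) := by simp [flow]
  rw [← hc, hf]
  exact (DFunLike.congr_fun (flow_neg_mul T t) (g t)).symm

theorem map_flow (T : E →L[ℂ] E) (T' : F →L[ℂ] F) (S : E →L[ℂ] F)
    (h : ∀ x, S (T x) = T' (S x)) (t : ℝ) (x : E) : S (flow T t x) = flow T' t (S x) := by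
  have h1 : ∀ s, HasDerivAt (fun s => S (flow T s x)) (T' (S (flow T s x))) s := fun s => by
    have hx := hasDerivAt_flow_apply T s (hasDerivAt_const s x)
    have := ((S.restrictScalars ℝ).hasFDerivAt (x := flow T s x)).comp_hasDerivAt s hx
    simpa [Function.comp_def, h] using! this
  simpa [flow_zero] using eq_flow_of_hasDerivAt T' h1 t

/-- Telescoping. In the Euler scheme `R = exp(Ct/n)`, so `R ^ n` stays bounded and an error `o(1/n)`
per step is enough. -/
theorem norm_pow_sub_pow_le {𝔸 : Type*} [NormedRing 𝔸] [NormOneClass 𝔸] {a b : 𝔸} {R : ℝ}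
    (hR : 1 ≤ R) (ha : ‖a‖ ≤ R) (hb : ‖b‖ ≤ R) (n : ℕ) :
    ‖a ^ n - b ^ n‖ ≤ n * R ^ n * ‖a - b‖ := by
  have hR0 : 0 ≤ R := zero_le_one.trans hR
  induction n with
  | zero => simp
  | succ n ih =>
    have : a ^ (n + 1) - b ^ (n + 1) = a * (a ^ n - b ^ n) + (a - b) * b ^ n := by
      rw [pow_succ', pow_succ']; noncomm_ring
    rw [this]
    have hbn : ‖b ^ n‖ ≤ R ^ n := (norm_pow_le b n).trans (by gcongr)
    calc _ ≤ ‖a‖ * ‖a ^ n - b ^ n‖ + ‖a - b‖ * ‖b ^ n‖ :=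
          (norm_add_le _ _).trans (add_le_add (norm_mul_le _ _) (norm_mul_le _ _))
      _ ≤ R * (n * R ^ n * ‖a - b‖) + ‖a - b‖ * R ^ (n + 1) := by
          gcongr
          exact hbn.trans (pow_le_pow_right₀ hR (Nat.le_succ n))
      _ = _ := by push_cast; ring

theorem norm_exp_le_exp_norm {𝔸 : Type*} [NormedRing 𝔸] [NormOneClass 𝔸] [NormedAlgebra ℂ 𝔸]
    [CompleteSpace 𝔸] (x : 𝔸) : ‖NormedSpace.exp x‖ ≤ Real.exp ‖x‖ := by
  have h := NormedSpace.exp_series_hasSum_exp' (𝕂 := ℂ) x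
  have h2 := NormedSpace.exp_series_hasSum_exp' (𝕂 := ℝ) ‖x‖
  rw [← Real.exp_eq_exp_ℝ] at h2
  rw [← h.tsum_eq]
  refine tsum_of_norm_bounded h2 fun n => ?_
  rw [norm_smul, smul_eq_mul]
  gcongr
  · simp
  · exact norm_pow_le x n

/-- Euler's formula `exp(tT) = lim (1 + (t/n)T + (t/n)²K)^n`. -/
theorem tendsto_euler_flow [Nontrivial E] (T K : E →L[ℂ] E) {t : ℝ} (ht : 0 ≤ t) :
    Tendsto (fun n : ℕ => (1 + ((t / n : ℝ) : ℂ) • T + ((t / n : ℝ) : ℂ) ^ 2 • K) ^ n) atTop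
      (𝓝 (flow T t)) := by
  -- The term `‖K‖ * t` absorbs the quadratic part of a step, since `(t/n)² ≤ (t/n) t`.
  set C := ‖T‖ + ‖K‖ * t with hC
  have hC0 : 0 ≤ C := by positivity
  set a : ℕ → E →L[ℂ] E := fun n => 1 + ((t / n : ℝ) : ℂ) • T + ((t / n : ℝ) : ℂ) ^ 2 • K with ha
  set b : ℕ → E →L[ℂ] E := fun n => flow T (t / n) with hb
  have hbn : ∀ n : ℕ, n ≠ 0 → b n ^ n = flow T t := fun n hn => by
    have : ∀ j : ℕ, b n ^ j = flow T (j * (t / n)) := fun j => by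
      induction j with
      | zero => simp [flow_zero]
      | succ j ih => rw [pow_succ, ih, hb, ← flow_add]; congr 1; push_cast; ring
    rw [this]; congr 1; field_simp
  have hR : ∀ n : ℕ, n ≠ 0 → 1 ≤ Real.exp (C * t / n) := fun n _ =>
    Real.one_le_exp (by positivity)
  have hna : ∀ n : ℕ, n ≠ 0 → ‖a n‖ ≤ Real.exp (C * t / n) := fun n hn => by
    have hn1 : (1 : ℝ) ≤ n := by exact_mod_cast Nat.one_le_iff_ne_zero.2 hn
    have h0 : 0 ≤ t / n := by positivity
    have h1 : t / n ≤ t := div_le_self ht hn1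
    have e1 : ‖((t / n : ℝ) : ℂ)‖ = t / n := by
      rw [Complex.norm_real, Real.norm_of_nonneg h0]
    calc ‖a n‖ ≤ 1 + (t / n) * ‖T‖ + (t / n) ^ 2 * ‖K‖ := by
          refine (norm_add_le _ _).trans (add_le_add ((norm_add_le _ _).trans ?_) ?_)
          · rw [norm_smul, e1, norm_one]
          · rw [norm_smul, norm_pow, e1]
      _ ≤ C * t / n + 1 := by
          have : (t / n) ^ 2 * ‖K‖ ≤ (t / n) * t * ‖K‖ := by
            rw [sq]; gcongr
          rw [hC]
          have : (‖T‖ + ‖K‖ * t) * t / n = (t / n) * ‖T‖ + (t / n) * t * ‖K‖ := by ring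
          linarith
      _ ≤ _ := Real.add_one_le_exp _
  have hnb : ∀ n : ℕ, n ≠ 0 → ‖b n‖ ≤ Real.exp (C * t / n) := fun n hn => by
    have h0 : 0 ≤ t / n := by positivity
    refine (norm_exp_le_exp_norm _).trans ?_
    rw [norm_smul, Complex.norm_real, Real.norm_of_nonneg h0]
    refine Real.exp_le_exp.2 ?_
    rw [hC, mul_comm, mul_div_assoc]
    gcongr
    have : 0 ≤ ‖K‖ * t := by positivity
    linarith
  have hpow : ∀ n : ℕ, n ≠ 0 → Real.exp (C * t / n) ^ n = Real.exp (C * t) := fun n hn => by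
    rw [← Real.exp_nat_mul]; congr 1; field_simp
  -- `a n` and `b n` share the expansion `1 + (t/n)T`; `K` contributes only `O(1/n²)`.
  have hlim : Tendsto (fun n : ℕ => n * ‖a n - b n‖) atTop (𝓝 0) := by
    have hd := hasDerivAt_flow T 0
    rw [flow_zero, mul_one] at hd
    have ho := hd.isLittleO
    have htn : Tendsto (fun n : ℕ => t / n) atTop (𝓝 0) := tendsto_const_div_atTop_nhds_zero_nat t
    have ho2 := ho.comp_tendsto htn
    have ho3 : Tendsto (fun n : ℕ => n * ‖b n - 1 - (t / n) • T‖) atTop (𝓝 0) := by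
      have h1 : (fun n : ℕ => b n - 1 - (t / n) • T) =o[atTop] (fun n : ℕ => t / n) := by
        refine ho2.congr (fun n => ?_) (fun n => ?_)
        · simp [flow_zero, hb]
        · simp
      have h2 : (fun n : ℕ => b n - 1 - (t / n) • T) =o[atTop] (fun n : ℕ => (n : ℝ)⁻¹) := by
        refine h1.trans_isBigO (Asymptotics.IsBigO.of_bound t (Eventually.of_forall fun n => ?_))
        rw [div_eq_mul_inv, norm_mul, Real.norm_of_nonneg ht]
      have h3 := h2.norm_left.tendsto_div_nhds_zero
      refine h3.congr fun n => ?_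
      rw [div_inv_eq_mul, mul_comm]
    have hk : Tendsto (fun n : ℕ => t * (t / n) * ‖K‖) atTop (𝓝 0) := by
      simpa using (htn.const_mul t).mul_const ‖K‖
    refine squeeze_zero' (Eventually.of_forall fun n => by positivity) ?_
      (by simpa using ho3.add hk)
    filter_upwards [eventually_ne_atTop 0] with n hn
    have hn0 : (n : ℝ) ≠ 0 := by exact_mod_cast hn
    have e : a n - b n = -(b n - 1 - (t / n) • T) + ((t / n : ℝ) : ℂ) ^ 2 • K := by
      simp only [ha]
      rw [← Complex.coe_smul (t / n) T]
      abel
    have e1 : ‖((t / n : ℝ) : ℂ)‖ = t / n := by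
      rw [Complex.norm_real, Real.norm_of_nonneg (by positivity)]
    calc (n : ℝ) * ‖a n - b n‖ ≤ n * (‖b n - 1 - (t / n) • T‖ + (t / n) ^ 2 * ‖K‖) := by
          gcongr
          rw [e]
          refine (norm_add_le _ _).trans (le_of_eq ?_)
          rw [norm_neg, norm_smul, norm_pow, e1]
      _ = _ := by field_simp
  rw [tendsto_iff_norm_sub_tendsto_zero]
  refine squeeze_zero' (Eventually.of_forall fun n => norm_nonneg _) ?_
    (by simpa using hlim.mul_const (Real.exp (C * t)))
  filter_upwards [eventually_ne_atTop 0] with n hn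
  rw [← hbn n hn]
  refine (norm_pow_sub_pow_le (hR n hn) (hna n hn) (hnb n hn) n).trans (le_of_eq ?_)
  rw [hpow n hn]; ring

end Flow

/-! ### Exponential decay from pointwise decay -/

section Decay

variable {E : Type*} [NormedAddCommGroup E] [NormedSpace ℂ E] [FiniteDimensional ℂ E]

theorem tendsto_norm_clm_of_pointwise {α : Type*} {l : Filter α} (u : α → E →L[ℂ] E)
    (h : ∀ x, Tendsto (fun a => u a x) l (𝓝 0)) : Tendsto (fun a => ‖u a‖) l (𝓝 0) := by
  obtain ⟨C, hC, hu⟩ := (Module.finBasis ℂ E).exists_opNorm_le (F := E)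
  have hM : Tendsto (fun a => C * ∑ i, ‖u a (Module.finBasis ℂ E i)‖) l (𝓝 0) := by
    have := (tendsto_finsetSum Finset.univ fun i _ =>
      (h (Module.finBasis ℂ E i)).norm).const_mul C
    simpa using this
  refine squeeze_zero (fun a => norm_nonneg _) (fun a => ?_) hM
  exact hu (Finset.sum_nonneg fun i _ => norm_nonneg _) fun i =>
    Finset.single_le_sum (f := fun i => ‖u a (Module.finBasis ℂ E i)‖)
      (fun i _ => norm_nonneg _) (Finset.mem_univ i)

/-- Pointwise decay of `exp(tT)` on the range of a commuting projection is exponential. -/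
theorem exists_exponential_decay [CompleteSpace E] (T S : E →L[ℂ] E) (hS : S * S = S)
    (hT : Commute S T) (h : ∀ x, Tendsto (fun t => flow T t (S x)) atTop (𝓝 0)) :
    ∃ C γ : ℝ, 0 < γ ∧ ∀ t, 0 ≤ t → ‖flow T t * S‖ ≤ C * Real.exp (-γ * t) := by
  have hlim : Tendsto (fun t => ‖flow T t * S‖) atTop (𝓝 0) :=
    tendsto_norm_clm_of_pointwise _ h
  obtain ⟨t₀, ht₀, ht₁⟩ : ∃ t₀ : ℝ, ‖flow T t₀ * S‖ ≤ 1 / 2 ∧ 0 < t₀ :=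
    ((hlim.eventually_le_const (by norm_num : (0 : ℝ) < 1 / 2)).and (eventually_gt_atTop 0)).exists
  have hcomm : ∀ t, Commute S (flow T t) := fun t => by
    let _ : NormedAlgebra ℚ (E →L[ℂ] E) := NormedAlgebra.restrictScalars ℚ ℂ _
    exact (hT.smul_right (t : ℂ)).exp_right
  -- An idempotent commuting with the flow can be inserted between two time steps, so the norm is
  -- submultiplicative in time and the single bound `1/2` at `t₀` forces geometric decay.
  have hmul : ∀ s t, ‖flow T (s + t) * S‖ ≤ ‖flow T s * S‖ * ‖flow T t * S‖ := fun s t => by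
    have : flow T (s + t) * S = (flow T s * S) * (flow T t * S) := by
      rw [flow_add, mul_assoc (flow T s) S, ← mul_assoc S, (hcomm t).eq, mul_assoc, mul_assoc, hS]
    rw [this]
    exact norm_mul_le _ _
  have hn : ∀ n : ℕ, ∀ t, ‖flow T (n * t₀ + t) * S‖ ≤ (1 / 2) ^ n * ‖flow T t * S‖ := fun n => by
    induction n with
    | zero => simp
    | succ n ih =>
      intro t
      have e : ((n + 1 : ℕ) : ℝ) * t₀ + t = t₀ + (n * t₀ + t) := by push_cast; ring
      rw [e]
      refine (hmul _ _).trans ?_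
      calc _ ≤ 1 / 2 * ((1 / 2) ^ n * ‖flow T t * S‖) := by
            gcongr
            exact ih t
        _ = _ := by ring
  have hcont : Continuous fun t => ‖flow T t * S‖ :=
    ((continuous_iff_continuousAt.2 fun t => (hasDerivAt_flow T t).continuousAt).mul
      continuous_const).norm
  obtain ⟨C, hC⟩ := (isCompact_Icc (a := (0 : ℝ)) (b := t₀)).exists_bound_of_continuousOn
    hcont.continuousOn
  refine ⟨2 * C, Real.log 2 / t₀, div_pos (Real.log_pos one_lt_two) ht₁, fun t ht => ?_⟩
  set n := ⌊t / t₀⌋₊ with hnn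
  have h1 : (n : ℝ) ≤ t / t₀ := Nat.floor_le (by positivity)
  have h2 : t / t₀ < n + 1 := Nat.lt_floor_add_one _
  have h1' : n * t₀ ≤ t := (le_div_iff₀ ht₁).1 h1
  have h2' : t < (n + 1) * t₀ := (div_lt_iff₀ ht₁).1 h2
  have h3 := hn n (t - n * t₀)
  rw [add_sub_cancel] at h3
  have h4 : ‖flow T (t - n * t₀) * S‖ ≤ C := by
    have := hC (t - n * t₀) ⟨by linarith, by linarith⟩
    rwa [norm_norm] at this
  -- The factor `2` pays for rounding `t / t₀` down to `n`.
  have h5 : (1 / 2 : ℝ) ^ n ≤ 2 * Real.exp (-(Real.log 2 / t₀) * t) := by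
    have e1 : (1 / 2 : ℝ) ^ n = Real.exp (-(Real.log 2 * n)) := by
      rw [Real.exp_neg, mul_comm, Real.exp_nat_mul, Real.exp_log two_pos]; simp
    have e2 : (2 : ℝ) * Real.exp (-(Real.log 2 / t₀) * t)
        = Real.exp (Real.log 2 + -(Real.log 2 / t₀) * t) := by
      rw [Real.exp_add, Real.exp_log two_pos]
    rw [e1, e2]
    refine Real.exp_le_exp.2 ?_
    have : Real.log 2 / t₀ * t = Real.log 2 * (t / t₀) := by ring
    rw [neg_mul, this]
    nlinarith [Real.log_pos one_lt_two]
  calc _ ≤ (1 / 2) ^ n * ‖flow T (t - n * t₀) * S‖ := h3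
    _ ≤ 2 * Real.exp (-(Real.log 2 / t₀) * t) * C := by gcongr
    _ = _ := by ring

end Decay

/-! ### Relaxation, spectrum and solvability of the corrector equations -/

section Relaxation

attribute [local instance] Matrix.normedAddCommGroup Matrix.normedSpace

variable {m : Type*} [Fintype m] [DecidableEq m] {J : Type*} [Fintype J]

/-- The one-parameter group generated by a linear superoperator. -/
def opFlow (T : Op m →ₗ[ℂ] Op m) (t : ℝ) : Op m →L[ℂ] Op m :=
  flow (LinearMap.toContinuousLinearMap T) t

theorem semigroup_eq (T : Op m →ₗ[ℂ] Op m) (t : ℝ) (X : Op m) :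
    semigroup (⇑T) t X = opFlow T t X :=
  (hasSum_flow (LinearMap.toContinuousLinearMap T) t X).tsum_eq

theorem hasDerivAt_opFlow_apply (T : Op m →ₗ[ℂ] Op m) (t : ℝ) {g : ℝ → Op m} {g' : Op m}
    (hg : HasDerivAt g g' t) :
    HasDerivAt (fun s => opFlow T s (g s)) (T (opFlow T t (g t)) + opFlow T t g') t :=
  hasDerivAt_flow_apply _ t hg

theorem opFlow_eq_of_hasDerivAt (T : Op m →ₗ[ℂ] Op m) {g : ℝ → Op m}
    (hg : ∀ t, HasDerivAt g (T (g t)) t) (t : ℝ) : g t = opFlow T t (g 0) :=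
  eq_flow_of_hasDerivAt (LinearMap.toContinuousLinearMap T) hg t

theorem map_opFlow {p : Type*} [Fintype p] [DecidableEq p] (T : Op m →ₗ[ℂ] Op m)
    (T' : Op p →ₗ[ℂ] Op p) (S : Op m →ₗ[ℂ] Op p) (h : ∀ x, S (T x) = T' (S x)) (t : ℝ) (x : Op m) :
    S (opFlow T t x) = opFlow T' t (S x) :=
  map_flow _ (LinearMap.toContinuousLinearMap T') (LinearMap.toContinuousLinearMap S) h t x

theorem opFlow_zero (T : Op m →ₗ[ℂ] Op m) (X : Op m) : opFlow T 0 X = X := by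
  rw [opFlow, flow_zero]; rfl

theorem trace_opFlow {T : Op m →ₗ[ℂ] Op m} (hT : ∀ X, (T X).trace = 0) (t : ℝ) (X : Op m) :
    (opFlow T t X).trace = X.trace := by
  have h := hasDerivAt_opFlow_apply T
  have hd : ∀ s, HasDerivAt (fun s => (opFlow T s X).trace) 0 s := fun s => by
    have h1 := h s (hasDerivAt_const s X)
    have h2 := (((LinearMap.toContinuousLinearMap (Matrix.traceLinearMap m ℂ ℂ)).restrictScalars
      ℝ).hasFDerivAt (x := opFlow T s X)).comp_hasDerivAt s h1
    have h3 : HasDerivAt (fun s => (opFlow T s X).trace)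
        ((T (opFlow T s X) + opFlow T s 0).trace) s := h2
    rwa [map_zero, add_zero, hT] at h3
  have := is_const_of_deriv_eq_zero (fun s => (hd s).differentiableAt) (fun s => (hd s).deriv) t 0
  simpa [opFlow_zero] using this

/-- The positive semidefinite matrices span all matrices. -/
theorem eq_top_of_posSemidef_mem (S : Submodule ℂ (Op m)) (h : ∀ X : Op m, X.PosSemidef → X ∈ S) :
    S = ⊤ := by
  have hv : ∀ v : m → ℂ, Matrix.vecMulVec v (star v) ∈ S := fun v =>
    h _ (Matrix.posSemidef_vecMulVec_self_star v)
  have hd : ∀ a : m, Matrix.single a a (1 : ℂ) ∈ S := fun a => by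
    have := hv (Pi.single a 1)
    have e : star (Pi.single a (1 : ℂ) : m → ℂ) = Pi.single a 1 := by
      rw [Pi.star_single, star_one]
    rwa [e, ← Matrix.single_eq_single_vecMulVec_single] at this
  -- Polarization with `e_a + e_b` and `e_a + i e_b`: the first projection plus `i` times the second
  -- is `2 E_ab + (1 + i)(E_aa + E_bb)`.
  have hs : ∀ a b : m, Matrix.single a b (1 : ℂ) ∈ S := fun a b => by
    have h1 := hv (Pi.single a 1 + Pi.single b 1)
    have h2 := hv (Pi.single a 1 + Complex.I • Pi.single b 1)
    have h3 := S.add_mem (S.add_mem h1 (S.smul_mem Complex.I h2))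
      (S.smul_mem (-(1 + Complex.I)) (S.add_mem (hd a) (hd b)))
    have e : ∀ a : m, star (Pi.single a (1 : ℂ) : m → ℂ) = Pi.single a 1 := fun a => by
      rw [Pi.star_single, star_one]
    simp only [star_add, star_smul, e, Matrix.add_vecMulVec, Matrix.vecMulVec_add,
      Matrix.vecMulVec_smul, Matrix.smul_vecMulVec, ← Matrix.single_eq_single_vecMulVec_single,
      Complex.star_def, Complex.conj_I] at h3
    have h4 := S.smul_mem (1 / 2 : ℂ) h3
    convert h4 using 1
    simp only [smul_add, smul_smul]
    have : Complex.I * Complex.I = -1 := Complex.I_mul_I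
    match_scalars
    all_goals first
      | ring1
      | linear_combination (1 / 2 : ℂ) * this
      | linear_combination (-1 / 2 : ℂ) * this
      | linear_combination (Complex.I / 2 : ℂ) * this
  rw [eq_top_iff]
  rintro X -
  rw [Matrix.matrix_eq_sum_single X]
  refine S.sum_mem fun a _ => S.sum_mem fun b _ => ?_
  have := S.smul_mem (X a b) (hs a b)
  rwa [Matrix.smul_single, smul_eq_mul, mul_one] at this

/-- Every operator `X` relaxes to `Tr(X) σ`. -/
def Relaxing (T : Op m →ₗ[ℂ] Op m) (σ : Op m) : Prop :=
  ∀ X, Tendsto (fun t => opFlow T t X) atTop (𝓝 (X.trace • σ))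

/-- The convergence asserted is a linear condition on `X`; it holds for multiples of density
operators, and these span. -/
theorem RelaxesTo.relaxing {T : Op m →ₗ[ℂ] Op m} {σ : Op m} (h : RelaxesTo T σ) :
    Relaxing T σ := by
  let S : Submodule ℂ (Op m) :=
    { carrier := {X | Tendsto (fun t => opFlow T t X) atTop (𝓝 (X.trace • σ))}
      add_mem' := fun {X Y} hX hY => by
        simp only [Set.mem_ofPred_eq, map_add, Matrix.trace_add, add_smul] at *
        exact hX.add hY
      zero_mem' := by simp
      smul_mem' := fun a X hX => by
        simp only [Set.mem_ofPred_eq, map_smul, Matrix.trace_smul, smul_assoc] at *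
        exact hX.const_smul a }
  have hS : S = ⊤ := eq_top_of_posSemidef_mem S fun X hX => by
    by_cases h0 : X.trace = 0
    · rw [hX.trace_eq_zero_iff.1 h0]
      exact S.zero_mem
    · have hd : IsDensity (X.trace⁻¹ • X) := by
        refine ⟨hX.smul ?_, by simp [h0]⟩
        exact inv_nonneg_of_nonneg hX.trace_nonneg
      have h1 := h.converges _ hd
      simp only [semigroup_eq] at h1
      have h2 : X.trace⁻¹ • X ∈ S := by
        change Tendsto _ _ _
        rwa [hd.2, one_smul]
      have h3 := S.smul_mem X.trace h2
      rwa [smul_inv_smul₀ h0] at h3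
  intro X
  have : X ∈ S := hS ▸ Submodule.mem_top
  exact this

/-- An eigenvector would evolve as `exp(ist) X`, of constant norm. Convergence forces the limit to
equal its own negative, hence to be zero, and so `X = 0`. -/
theorem Relaxing.eq_zero_of_eigen {T : Op m →ₗ[ℂ] Op m} {σ : Op m} (h : Relaxing T σ) {s : ℝ}
    (hs : s ≠ 0) {X : Op m} (hX : T X = (Complex.I * s) • X) : X = 0 := by
  have hg : ∀ t : ℝ, opFlow T t X = Complex.exp (Complex.I * s * t) • X := fun t => by
    have hd : ∀ t : ℝ, HasDerivAt (fun t : ℝ => Complex.exp (Complex.I * s * t) • X)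
        (T (Complex.exp (Complex.I * s * t) • X)) t := fun t => by
      have h1 : HasDerivAt (fun t : ℝ => Complex.I * s * (t : ℂ)) (Complex.I * s) t := by
        simpa using (Complex.ofRealCLM.hasDerivAt (x := t)).const_mul (Complex.I * s)
      rw [map_smul, hX, smul_smul]
      exact h1.cexp.smul_const X
    have := opFlow_eq_of_hasDerivAt T hd t
    simpa using this.symm
  have hlim := h X
  simp only [hg] at hlim
  -- Advancing time by `π / s` reverses the sign of the orbit.
  have hsh : Tendsto (fun t : ℝ => t + Real.pi / s) atTop atTop :=
    tendsto_atTop_add_const_right _ _ tendsto_id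
  have hlim2 := hlim.comp hsh
  have hneg : (fun t : ℝ => Complex.exp (Complex.I * s * t) • X) ∘ (fun t : ℝ => t + Real.pi / s)
      = fun t : ℝ => -(Complex.exp (Complex.I * s * t) • X) := by
    funext t
    have hsC : (s : ℂ) ≠ 0 := by exact_mod_cast hs
    have e : Complex.I * s * ((t + Real.pi / s : ℝ) : ℂ)
        = Complex.I * s * t + Real.pi * Complex.I := by
      push_cast; field_simp
    simp only [Function.comp_apply, e, Complex.exp_add, Complex.exp_pi_mul_I, mul_neg, mul_one,
      neg_smul]
  rw [hneg] at hlim2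
  have h0 := tendsto_nhds_unique hlim2 hlim.neg
  have h1 : X.trace • σ = 0 := by
    have h2 := h0
    rw [eq_neg_iff_add_eq_zero, ← two_smul ℂ] at h2
    exact (smul_eq_zero.1 h2).resolve_left two_ne_zero
  rw [h1] at hlim
  have h2 := hlim.norm
  have h3 : ∀ t : ℝ, ‖Complex.exp (Complex.I * s * t) • X‖ = ‖X‖ := fun t => by
    rw [norm_smul, mul_assoc, mul_comm, ← Complex.ofReal_mul, mul_comm Complex.I, Complex.norm_exp_ofReal_mul_I,
      mul_one]
  simp only [h3, norm_zero] at h2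
  exact norm_eq_zero.1 (tendsto_nhds_unique tendsto_const_nhds h2)

theorem Relaxing.eq_of_map_eq_zero {T : Op m →ₗ[ℂ] Op m} {σ : Op m} (h : Relaxing T σ) {X : Op m}
    (hX : T X = 0) : X = X.trace • σ := by
  have hd : ∀ t : ℝ, HasDerivAt (fun _ : ℝ => X) (T X) t := fun t => by
    rw [hX]; exact hasDerivAt_const t X
  have hg : ∀ t, opFlow T t X = X := fun t => (opFlow_eq_of_hasDerivAt T hd t).symm
  have := h X
  simp only [hg] at this
  exact tendsto_nhds_unique tendsto_const_nhds this

/-- A linear map that preserves the left ideal generated by `σ` and is injective maps that ideal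
onto itself. -/
theorem exists_mul_eq_of_injective {σ : Op m} (T : Op m →ₗ[ℂ] Op m)
    (hT : ∀ Y, ∃ Z, T (Y * σ) = Z * σ) (hinj : ∀ X, T X = 0 → X = 0) (Y : Op m) :
    ∃ Z, T (Z * σ) = Y * σ := by
  let V := LinearMap.range (LinearMap.mulRight ℂ σ)
  have hV : ∀ X ∈ V, T X ∈ V := by
    rintro _ ⟨Z, rfl⟩
    obtain ⟨Z', h⟩ := hT Z
    exact ⟨Z', h.symm⟩
  have hi : Function.Injective (T.restrict hV) := by
    rw [injective_iff_map_eq_zero]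
    rintro ⟨X, hX⟩ h
    exact Subtype.ext (hinj X (congrArg Subtype.val h))
  obtain ⟨⟨_, Z, rfl⟩, hZ⟩ := (LinearMap.surjective_of_injective hi) ⟨Y * σ, Y, rfl⟩
  exact ⟨Z, congrArg Subtype.val hZ⟩

variable {H : Op m} {L : J → Op m} {σ : Op m}

/-- The generator shifted by `is` is injective, because `-is` is not an eigenvalue, and it preserves
the left ideal of `σ`; so it can be inverted inside that ideal even when `σ` is singular. -/
theorem exists_resolvent (hσ : σ.PosSemidef) (hst : lindblad H L σ = 0)
    (hr : Relaxing (lindbladMap H L) σ) {s : ℝ} (hs : s ≠ 0) (Y : Op m) :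
    ∃ Z, lindblad H L (Z * σ) + (Complex.I * s) • (Z * σ) = Y * σ := by
  refine exists_mul_eq_of_injective (lindbladMap H L + (Complex.I * s) • LinearMap.id)
    (fun Y => ?_) (fun X hX => ?_) Y
  · obtain ⟨Z, hZ⟩ := lindblad_mul_stationary hσ hst Y
    refine ⟨Z + (Complex.I * s) • Y, ?_⟩
    simp [hZ, add_mul]
  · refine hr.eq_zero_of_eigen (neg_ne_zero.2 hs) ?_
    rw [Complex.ofReal_neg, mul_neg, neg_smul]
    exact eq_neg_of_add_eq_zero_left hX

/-- At frequency zero the generator has the kernel `ℂσ`. Adding the rank-one map `X ↦ Tr(X) σ` makes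
it injective and trace preserving. Solving for `Yσ + qσ` then forces `Tr(Zσ) = q`, and the two
multiples of `σ` cancel. -/
theorem exists_traceless_inverse (hσ : IsDensity σ) (hst : lindblad H L σ = 0)
    (hr : Relaxing (lindbladMap H L) σ) {Y : Op m} (hY : (Y * σ).trace = 0) (q : ℂ) :
    ∃ Z, lindblad H L (Z * σ) = Y * σ ∧ (Z * σ).trace = q := by
  have hT : ∀ X, (lindbladMap H L + (Matrix.traceLinearMap m ℂ ℂ).smulRight σ) X
      = lindblad H L X + X.trace • σ := fun X => by simp
  have htr : ∀ X, ((lindbladMap H L + (Matrix.traceLinearMap m ℂ ℂ).smulRight σ) X).trace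
      = X.trace := fun X => by
    rw [hT, Matrix.trace_add, trace_lindblad, Matrix.trace_smul, hσ.2]; simp
  obtain ⟨Z, hZ⟩ := exists_mul_eq_of_injective
    (lindbladMap H L + (Matrix.traceLinearMap m ℂ ℂ).smulRight σ) (fun Y => by
      obtain ⟨Z, hZ⟩ := lindblad_mul_stationary hσ.1 hst Y
      refine ⟨Z + (Y * σ).trace • 1, ?_⟩
      rw [hT, hZ, add_mul, smul_mul_assoc, one_mul]) (fun X hX => by
      have h0 : X.trace = 0 := by rw [← htr X, hX, Matrix.trace_zero]
      rw [hT, h0, zero_smul, add_zero] at hX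
      rw [hr.eq_of_map_eq_zero hX, h0, zero_smul]) (Y + q • 1)
  have hq : (Z * σ).trace = q := by
    rw [← htr, hZ, add_mul, Matrix.trace_add, hY, smul_mul_assoc, one_mul, Matrix.trace_smul, hσ.2]
    simp
  refine ⟨Z, ?_, hq⟩
  rw [hT, hq, add_mul, smul_mul_assoc, one_mul] at hZ
  exact add_right_cancel hZ

end Relaxation

/-! ### Operators on finite tensor products -/

section TensorAlgebra

variable {ι : Type*} [Fintype ι] [DecidableEq ι] {d : ι → Type*}
  [∀ i, Fintype (d i)] [∀ i, DecidableEq (d i)]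

theorem tensor_mul (ρ σ : ∀ i, Op (d i)) :
    tensor ρ * tensor σ = tensor fun i => ρ i * σ i := by
  ext a a'
  simp only [Matrix.mul_apply, tensor, Matrix.of_apply, ← Finset.prod_mul_distrib,
    Finset.prod_univ_sum, Fintype.piFinset_univ]

theorem tensor_one : tensor (fun i => (1 : Op (d i))) = 1 := by
  ext a a'
  simp only [tensor, Matrix.of_apply, Matrix.one_apply, Finset.prod_ite_zero, funext_iff,
    Finset.mem_univ, true_implies, Finset.prod_const_one]

theorem conjTranspose_tensor (ρ : ∀ i, Op (d i)) : (tensor ρ)ᴴ = tensor fun i => (ρ i)ᴴ := by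
  ext a a'
  simp [tensor, Matrix.conjTranspose_apply]

theorem trace_tensor (ρ : ∀ i, Op (d i)) : (tensor ρ).trace = ∏ i, (ρ i).trace := by
  simp only [Matrix.trace, Matrix.diag, tensor, Matrix.of_apply, Finset.prod_univ_sum,
    Fintype.piFinset_univ]

theorem tensor_single (a a' : ∀ i, d i) :
    (tensor fun i => Matrix.single (a i) (a' i) (1 : ℂ)) = Matrix.single a a' 1 := by
  ext x y
  simp only [tensor, Matrix.of_apply, Matrix.single_apply, Finset.prod_ite_zero, funext_iff,
    Finset.mem_univ, true_implies, Finset.prod_const_one, forall_and]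

/-- With this the algebra of `site` reduces to factorwise multiplication of product operators. -/
theorem site_eq_tensor (k : ι) (X : Op (d k)) :
    site k X = tensor (Function.update (fun i => (1 : Op (d i))) k X) := by
  ext a a'
  simp only [site, tensor, Matrix.of_apply]
  rw [← Finset.mul_prod_erase Finset.univ _ (Finset.mem_univ k), Function.update_self]
  have : ∏ i ∈ Finset.univ.erase k,
      Function.update (fun i => (1 : Op (d i))) k X i (a i) (a' i)
      = if ∀ i, i ≠ k → a i = a' i then 1 else 0 := by
    rw [Finset.prod_congr rfl (g := fun i => if a i = a' i then (1 : ℂ) else 0)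
      (fun i hi => by
        rw [Function.update_of_ne (Finset.ne_of_mem_erase hi), Matrix.one_apply])]
    simp [Finset.prod_ite_zero]
  rw [this]
  split_ifs <;> simp

theorem tensor_update_mul_update (ρ σ : ∀ i, Op (d i)) (k : ι) (X Y : Op (d k)) :
    tensor (Function.update ρ k X) * tensor (Function.update σ k Y)
      = tensor (Function.update (fun i => ρ i * σ i) k (X * Y)) := by
  rw [tensor_mul]
  congr 1
  funext i
  rcases eq_or_ne i k with rfl | h
  · simp
  · simp [h]

theorem site_mul_tensor (k : ι) (X : Op (d k)) (ρ : ∀ i, Op (d i)) :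
    site k X * tensor ρ = tensor (Function.update ρ k (X * ρ k)) := by
  conv_lhs => rw [← Function.update_eq_self k ρ]
  rw [site_eq_tensor, tensor_update_mul_update]
  simp

theorem tensor_mul_site (k : ι) (X : Op (d k)) (ρ : ∀ i, Op (d i)) :
    tensor ρ * site k X = tensor (Function.update ρ k (ρ k * X)) := by
  conv_lhs => rw [← Function.update_eq_self k ρ]
  rw [site_eq_tensor, tensor_update_mul_update]
  simp

theorem site_mul (k : ι) (X Y : Op (d k)) : site k X * site k Y = site k (X * Y) := by
  rw [site_eq_tensor k X, site_eq_tensor k Y, tensor_update_mul_update, site_eq_tensor]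
  simp

theorem site_conjTranspose (k : ι) (X : Op (d k)) : (site k X)ᴴ = site k Xᴴ := by
  rw [site_eq_tensor, site_eq_tensor, conjTranspose_tensor]
  congr 1
  funext i
  rcases eq_or_ne i k with rfl | h
  · simp
  · simp [h]

theorem site_one (k : ι) : site k (1 : Op (d k)) = 1 := by
  rw [site_eq_tensor, ← tensor_one]
  congr 1
  funext i
  rcases eq_or_ne i k with rfl | h
  · simp
  · simp [h]

theorem site_add (k : ι) (X Y : Op (d k)) : site k (X + Y) = site k X + site k Y := by
  ext a a'
  simp only [site, Matrix.of_apply, Matrix.add_apply]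
  split_ifs <;> simp

theorem site_smul (k : ι) (z : ℂ) (X : Op (d k)) : site k (z • X) = z • site k X := by
  ext a a'
  simp only [site, Matrix.of_apply, Matrix.smul_apply]
  split_ifs <;> simp

/-- `site k` as a star-algebra homomorphism. -/
def siteHom (k : ι) : Op (d k) →⋆ₐ[ℂ] Op (∀ i, d i) where
  toFun := site k
  map_one' := site_one k
  map_mul' X Y := (site_mul k X Y).symm
  map_zero' := by simpa using site_smul k 0 (0 : Op (d k))
  map_add' := site_add k
  commutes' z := by
    rw [Algebra.algebraMap_eq_smul_one, Algebra.algebraMap_eq_smul_one, site_smul, site_one]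
  map_star' X := (site_conjTranspose k X).symm

@[simp] theorem siteHom_apply (k : ι) (X : Op (d k)) : siteHom k X = site k X := rfl

theorem commute_site {i k : ι} (h : i ≠ k) (X : Op (d i)) (Y : Op (d k)) :
    Commute (site i X) (site k Y) := by
  rw [commute_iff_eq, site_eq_tensor k Y, site_mul_tensor, tensor_mul_site]
  simp [Function.update_of_ne h]

theorem commute_tensor_update_one (k : ι) (ρ : ∀ i, Op (d i)) (X : Op (d k)) :
    Commute (tensor (Function.update ρ k 1)) (site k X) := by
  rw [commute_iff_eq, site_mul_tensor, tensor_mul_site]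
  simp

theorem tensor_eq_site_mul (k : ι) (ρ : ∀ i, Op (d i)) :
    tensor ρ = site k (ρ k) * tensor (Function.update ρ k 1) := by
  rw [site_mul_tensor]; simp

theorem trace_site_mul_tensor (k : ι) (X : Op (d k)) {ρ : ∀ i, Op (d i)}
    (hρ : ∀ i, (ρ i).trace = 1) : (site k X * tensor ρ).trace = (X * ρ k).trace := by
  rw [site_mul_tensor, trace_tensor, Fintype.prod_eq_single k]
  · simp
  · intro i hi
    rw [Function.update_of_ne hi, hρ]

theorem posSemidef_tensor {ρ : ∀ i, Op (d i)} (h : ∀ i, (ρ i).PosSemidef) :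
    (tensor ρ).PosSemidef := by
  open scoped MatrixOrder in
  choose S hS using fun i => CStarAlgebra.nonneg_iff_eq_star_mul_self.mp (h i).nonneg
  have : tensor ρ = (tensor S)ᴴ * tensor S := by
    rw [conjTranspose_tensor, tensor_mul]
    congr 1
    funext i
    exact hS i
  rw [this]
  exact Matrix.posSemidef_conjTranspose_mul_self _

theorem isDensity_tensor {ρ : ∀ i, Op (d i)} (h : ∀ i, IsDensity (ρ i)) : IsDensity (tensor ρ) :=
  ⟨posSemidef_tensor fun i => (h i).1, by simp [trace_tensor, (h _).2]⟩

/-! Operators on a subset of the factors. -/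

variable (s : Finset ι)

/-- Splitting the index set into `s` and its complement turns operators on a subset of the factors
into Kronecker products with the identity. -/
theorem onSub_eq (X : Op (∀ i : s, d i)) :
    onSub s X = (X ⊗ₖ (1 : Op (∀ i : {i // i ∉ s}, d i))).submatrix
      (Equiv.piEquivPiSubtypeProd (· ∈ s) d) (Equiv.piEquivPiSubtypeProd (· ∈ s) d) := by
  ext a a'
  simp [onSub, Matrix.kroneckerMap_apply, Matrix.one_apply, funext_iff]

/-- The factors outside `s`. -/
def offSub (Y : Op (∀ i : {i // i ∉ s}, d i)) : Op (∀ i, d i) :=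
  ((1 : Op (∀ i : s, d i)) ⊗ₖ Y).submatrix
    (Equiv.piEquivPiSubtypeProd (· ∈ s) d) (Equiv.piEquivPiSubtypeProd (· ∈ s) d)

theorem onSub_mul_offSub (X : Op (∀ i : s, d i)) (Y : Op (∀ i : {i // i ∉ s}, d i)) :
    onSub s X * offSub s Y = (X ⊗ₖ Y).submatrix
      (Equiv.piEquivPiSubtypeProd (· ∈ s) d) (Equiv.piEquivPiSubtypeProd (· ∈ s) d) := by
  rw [onSub_eq, offSub, Matrix.submatrix_mul_equiv, ← Matrix.mul_kronecker_mul, mul_one, one_mul]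

theorem commute_offSub_onSub (X : Op (∀ i : s, d i)) (Y : Op (∀ i : {i // i ∉ s}, d i)) :
    Commute (offSub s Y) (onSub s X) := by
  rw [commute_iff_eq, onSub_mul_offSub]
  rw [onSub_eq, offSub, Matrix.submatrix_mul_equiv, ← Matrix.mul_kronecker_mul, mul_one, one_mul]

theorem tensor_eq_onSub_mul_offSub (ρ : ∀ i, Op (d i)) :
    tensor ρ = onSub s (tensor fun i : s => ρ i) * offSub s (tensor fun i : {i // i ∉ s} => ρ i) := by
  rw [onSub_mul_offSub]
  ext a a'
  simp only [tensor, Matrix.of_apply, Matrix.submatrix_apply, Matrix.kroneckerMap_apply]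
  rw [← Fintype.prod_subtype_mul_prod_subtype (· ∈ s) fun i => ρ i (a i) (a' i)]
  congr 1
  exact Finset.prod_congr (by ext; simp) fun _ _ => rfl

theorem trace_submatrix_equiv {m p : Type*} [Fintype m] [Fintype p] (e : m ≃ p) (X : Op p) :
    (X.submatrix e e).trace = X.trace := by
  simp only [Matrix.trace, Matrix.diag, Matrix.submatrix_apply]
  exact e.sum_comp fun i => X i i

theorem onSub_mul (X Y : Op (∀ i : s, d i)) : onSub s X * onSub s Y = onSub s (X * Y) := by
  rw [onSub_eq, onSub_eq, onSub_eq, Matrix.submatrix_mul_equiv, ← Matrix.mul_kronecker_mul, mul_one]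

theorem onSub_add (X Y : Op (∀ i : s, d i)) : onSub s (X + Y) = onSub s X + onSub s Y := by
  rw [onSub_eq, onSub_eq, onSub_eq, Matrix.add_kronecker, Matrix.submatrix_add]; rfl

theorem onSub_smul (z : ℂ) (X : Op (∀ i : s, d i)) : onSub s (z • X) = z • onSub s X := by
  rw [onSub_eq, onSub_eq, Matrix.smul_kronecker, Matrix.submatrix_smul]; rfl

theorem onSub_one : onSub s (1 : Op (∀ i : s, d i)) = 1 := by
  rw [onSub_eq, Matrix.one_kronecker_one, Matrix.submatrix_one_equiv]

theorem onSub_conjTranspose (X : Op (∀ i : s, d i)) : (onSub s X)ᴴ = onSub s Xᴴ := by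
  rw [onSub_eq, onSub_eq, Matrix.conjTranspose_submatrix, Matrix.conjTranspose_kronecker,
    Matrix.conjTranspose_one]

/-- `onSub s` as a star-algebra homomorphism. -/
def onSubHom : Op (∀ i : s, d i) →⋆ₐ[ℂ] Op (∀ i, d i) where
  toFun := onSub s
  map_one' := onSub_one s
  map_mul' X Y := (onSub_mul s X Y).symm
  map_zero' := by simpa using onSub_smul s 0 (0 : Op (∀ i : s, d i))
  map_add' := onSub_add s
  commutes' z := by
    rw [Algebra.algebraMap_eq_smul_one, Algebra.algebraMap_eq_smul_one, onSub_smul, onSub_one]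
  map_star' X := (onSub_conjTranspose s X).symm

@[simp] theorem onSubHom_apply (X : Op (∀ i : s, d i)) : onSubHom s X = onSub s X := rfl

theorem trace_onSub_mul_tensor (X : Op (∀ i : s, d i)) {ρ : ∀ i, Op (d i)}
    (hρ : ∀ i, (ρ i).trace = 1) :
    (onSub s X * tensor ρ).trace = (X * tensor fun i : s => ρ i).trace := by
  rw [tensor_eq_onSub_mul_offSub s, ← mul_assoc, onSub_mul, onSub_mul_offSub,
    trace_submatrix_equiv, Matrix.trace_kronecker, trace_tensor (d := fun i : {i // i ∉ s} => d i)]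
  simp [hρ]

theorem onSub_site (k : s) (X : Op (d k)) :
    onSub s (site (d := fun i : s => d i) k X) = site (k : ι) X := by
  ext a a'
  simp only [onSub, site, Matrix.of_apply, ← ite_and]
  congr 1
  rw [eq_iff_iff]
  constructor
  · rintro ⟨h1, h2⟩ i hi
    by_cases his : i ∈ s
    · exact h2 ⟨i, his⟩ fun h => hi (congrArg Subtype.val h)
    · exact h1 i his
  · intro h
    refine ⟨fun i hi => h i fun hk => hi (hk ▸ k.2), fun i hi => h i fun hk => hi (Subtype.ext hk)⟩

theorem commute_site_onSub {k : ι} (hk : k ∉ s) (X : Op (d k)) (Y : Op (∀ i : s, d i)) :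
    Commute (site k X) (onSub s Y) := by
  have : site k X = offSub s (tensor fun i : {i // i ∉ s} =>
      Function.update (fun i => (1 : Op (d i))) k X i) := by
    rw [site_eq_tensor, tensor_eq_onSub_mul_offSub s]
    have : (tensor fun i : s => Function.update (fun i => (1 : Op (d i))) k X i) = 1 := by
      rw [← tensor_one]
      congr 1
      funext i
      rw [Function.update_of_ne]
      rintro rfl
      exact hk i.2
    rw [this, onSub_one, one_mul]
  rw [this]
  exact commute_offSub_onSub s Y _

end TensorAlgebra

/-! ### Sums of Lindbladians on tensor factors -/

section TensorLindblad

attribute [local instance] Matrix.normedAddCommGroup Matrix.normedSpace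

variable {ι : Type*} [Fintype ι] [DecidableEq ι] {d : ι → Type*}
  [∀ i, Fintype (d i)] [∀ i, DecidableEq (d i)] {J : ι → Type*} [∀ i, Fintype (J i)]

theorem lindblad_site_tensor {k : ι} {J : Type*} [Fintype J] (H : Op (d k)) (L : J → Op (d k))
    (X : ∀ i, Op (d i)) :
    lindblad (site k H) (fun μ => site k (L μ)) (tensor X)
      = tensor (Function.update X k (lindblad H L (X k))) := by
  have h := lindblad_map_mul (siteHom k) H L (X k) (tensor (Function.update X k 1))
    fun Y => commute_tensor_update_one k X Y
  simp only [siteHom_apply] at h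
  rw [← tensor_eq_site_mul] at h
  rw [h, site_mul_tensor]
  simp

/-- The sum of the Lindbladians of the factors, in Lindblad form. -/
def tensorLindblad (H : ∀ i, Op (d i)) (L : ∀ i, J i → Op (d i)) :
    Op (∀ i, d i) →ₗ[ℂ] Op (∀ i, d i) :=
  lindbladMap (∑ i, site i (H i)) fun s : Σ i, J i => site s.1 (L s.1 s.2)

theorem tensorLindblad_apply (H : ∀ i, Op (d i)) (L : ∀ i, J i → Op (d i)) (X : Op (∀ i, d i)) :
    tensorLindblad H L X = ∑ i, lindblad (site i (H i)) (fun μ => site i (L i μ)) X :=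
  (sum_lindblad _ (fun i μ => site i (L i μ)) X).symm

theorem hasDerivAt_tensor {g : ∀ i, ℝ → Op (d i)} {g' : ∀ i, Op (d i)} {t : ℝ}
    (h : ∀ i, HasDerivAt (g i) (g' i) t) :
    HasDerivAt (fun t => tensor fun i => g i t)
      (∑ i, tensor (Function.update (fun i => g i t) i (g' i))) t := by
  refine hasDerivAt_pi.2 fun a => hasDerivAt_pi.2 fun a' => ?_
  have he : ∀ i, HasDerivAt (fun t => g i t (a i) (a' i)) (g' i (a i) (a' i)) t := fun i =>
    hasDerivAt_pi.1 (hasDerivAt_pi.1 (h i) (a i)) (a' i)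
  have hp := HasDerivAt.fun_finsetProd (u := Finset.univ) fun i _ => he i
  convert! hp using 1
  refine (Matrix.sum_apply a a' _ _).trans (Finset.sum_congr rfl fun i _ => ?_)
  simp only [tensor, Matrix.of_apply]
  rw [← Finset.prod_erase_mul Finset.univ _ (Finset.mem_univ i), Function.update_self, smul_eq_mul]
  congr 1
  refine Finset.prod_congr rfl fun j hj => ?_
  rw [Function.update_of_ne (Finset.ne_of_mem_erase hj)]

/-- By the product rule the tensor product of the factor flows solves the equation of the summed
generator. -/
theorem opFlow_tensorLindblad (H : ∀ i, Op (d i)) (L : ∀ i, J i → Op (d i)) (X : ∀ i, Op (d i))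
    (t : ℝ) : opFlow (tensorLindblad H L) t (tensor X)
      = tensor fun i => opFlow (lindbladMap (H i) (L i)) t (X i) := by
  have hd : ∀ t, HasDerivAt (fun t => tensor fun i => opFlow (lindbladMap (H i) (L i)) t (X i))
      (tensorLindblad H L (tensor fun i => opFlow (lindbladMap (H i) (L i)) t (X i))) t := fun t => by
    have h := hasDerivAt_tensor fun i =>
      hasDerivAt_opFlow_apply (lindbladMap (H i) (L i)) t (hasDerivAt_const t (X i))
    simp only [map_zero, add_zero] at h
    convert! h using 1
    rw [tensorLindblad_apply]
    exact Finset.sum_congr rfl fun i _ => lindblad_site_tensor _ _ _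
  have := opFlow_eq_of_hasDerivAt (tensorLindblad H L) hd t
  simpa [opFlow_zero] using this.symm

theorem span_tensor (S : Submodule ℂ (Op (∀ i, d i))) (h : ∀ X, tensor X ∈ S) : S = ⊤ := by
  rw [eq_top_iff]
  rintro X -
  rw [Matrix.matrix_eq_sum_single X]
  refine S.sum_mem fun a _ => S.sum_mem fun b _ => ?_
  have := S.smul_mem (X a b) (h fun i => Matrix.single (a i) (b i) 1)
  rwa [tensor_single, Matrix.smul_single, smul_eq_mul, mul_one] at this

/-- Product operators span, and on them the flow factorizes, so the limits of the factors multiply.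
-/
theorem relaxing_tensorLindblad {H : ∀ i, Op (d i)} {L : ∀ i, J i → Op (d i)}
    {ρ : ∀ i, Op (d i)} (h : ∀ i, Relaxing (lindbladMap (H i) (L i)) (ρ i)) :
    Relaxing (tensorLindblad H L) (tensor ρ) := by
  let S : Submodule ℂ (Op (∀ i, d i)) :=
    { carrier := {X | Tendsto (fun t => opFlow (tensorLindblad H L) t X) atTop
        (𝓝 (X.trace • tensor ρ))}
      add_mem' := fun {X Y} hX hY => by
        simp only [Set.mem_ofPred_eq, map_add, Matrix.trace_add, add_smul] at *
        exact hX.add hY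
      zero_mem' := by simp
      smul_mem' := fun a X hX => by
        simp only [Set.mem_ofPred_eq, map_smul, Matrix.trace_smul, smul_assoc] at *
        exact hX.const_smul a }
  have hS : S = ⊤ := span_tensor S fun X => by
    change Tendsto _ _ _
    simp only [opFlow_tensorLindblad]
    refine tendsto_pi_nhds.2 fun a => tendsto_pi_nhds.2 fun a' => ?_
    have he : ((tensor X).trace • tensor ρ) a a'
        = ∏ i, ((X i).trace • ρ i) (a i) (a' i) := by
      simp only [Matrix.smul_apply, smul_eq_mul, Finset.prod_mul_distrib, ← trace_tensor]
      rfl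
    rw [he]
    refine tendsto_finsetProd _ fun i _ => ?_
    exact tendsto_pi_nhds.1 (tendsto_pi_nhds.1 (h i (X i)) (a i)) (a' i)
  intro X
  have : X ∈ S := hS ▸ Submodule.mem_top
  exact this

theorem tensorLindblad_stationary {H : ∀ i, Op (d i)} {L : ∀ i, J i → Op (d i)}
    {ρ : ∀ i, Op (d i)} (h : ∀ i, lindblad (H i) (L i) (ρ i) = 0) :
    tensorLindblad H L (tensor ρ) = 0 := by
  rw [tensorLindblad_apply]
  refine Finset.sum_eq_zero fun i _ => ?_
  rw [lindblad_site_tensor, h, tensor_eq_site_mul i]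
  simp [← siteHom_apply]

/-- The sum of the Lindbladians of all factors acts on `onSub s U * tensor ρ` through the factors
in `s` only. -/
theorem tensorLindblad_onSub {H : ∀ i, Op (d i)} {L : ∀ i, J i → Op (d i)}
    {ρ : ∀ i, Op (d i)} (h : ∀ i, lindblad (H i) (L i) (ρ i) = 0) (s : Finset ι)
    (U : Op (∀ i : s, d i)) :
    tensorLindblad H L (onSub s U * tensor ρ)
      = onSub s (tensorLindblad (fun i : s => H i) (fun i : s => L i)
          (U * tensor fun i : s => ρ i)) * offSub s (tensor fun i : {i // i ∉ s} => ρ i) := by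
  rw [tensorLindblad_apply, tensorLindblad_apply, ← onSubHom_apply s (∑ i, _), map_sum,
    Finset.sum_mul]
  have hin : ∀ i : s, lindblad (site (i : ι) (H i)) (fun μ => site (i : ι) (L i μ))
      (onSub s U * tensor ρ) = onSubHom s (lindblad (site i (H i)) (fun μ => site i (L i μ))
        (U * tensor fun i : s => ρ i)) * offSub s (tensor fun i : {i // i ∉ s} => ρ i) := fun i => by
    have h1 := lindblad_map_mul (onSubHom s) (site i (H i)) (fun μ => site i (L i μ))
      (U * tensor fun i : s => ρ i) (offSub s (tensor fun i : {i // i ∉ s} => ρ i))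
      (fun Y => commute_offSub_onSub s Y _)
    rw [← h1]
    simp only [onSubHom_apply, onSub_site]
    rw [← onSub_mul, mul_assoc, ← tensor_eq_onSub_mul_offSub]
  -- The generator of a factor outside `s` passes through `onSub s U` and annihilates its own
  -- stationary factor of `tensor ρ`.
  have hout : ∀ i, i ∉ s → lindblad (site i (H i)) (fun μ => site i (L i μ))
      (onSub s U * tensor ρ) = 0 := fun i hi => by
    rw [lindblad_mul_left_of_commute (commute_site_onSub s hi _ _).symm
      (fun μ => (commute_site_onSub s hi _ _).symm)
      (fun μ => by rw [site_conjTranspose]; exact (commute_site_onSub s hi _ _).symm),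
      lindblad_site_tensor, h, tensor_eq_site_mul i]
    simp [← siteHom_apply]
  rw [← Finset.sum_subset (Finset.subset_univ s) (fun i _ hi => hout i hi), ← Finset.sum_coe_sort]
  exact Finset.sum_congr rfl fun i _ => hin i

end TensorLindblad

/-! ### Completely positive maps and Choi matrices -/

section CompletelyPositive

variable {m p q : Type*} [Fintype m] [DecidableEq m] [Fintype p] [DecidableEq p]
  [Fintype q] [DecidableEq q]

/-- Completely positive maps, in Kraus form. -/
def IsCP (Φ : Op m → Op p) : Prop :=
  ∃ (r : ℕ) (V : Fin r → Matrix p m ℂ), ∀ X, Φ X = ∑ l, V l * X * (V l)ᴴ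

theorem isCP_of_kraus {α : Type*} [Fintype α] {Φ : Op m → Op p} (V : α → Matrix p m ℂ)
    (h : ∀ X, Φ X = ∑ l, V l * X * (V l)ᴴ) : IsCP Φ :=
  ⟨Fintype.card α, fun l => V ((Fintype.equivFin α).symm l), fun X => by
    rw [h]; exact ((Fintype.equivFin α).symm.sum_comp fun l => V l * X * (V l)ᴴ).symm⟩

theorem isCP_conj (V : Matrix p m ℂ) : IsCP fun X : Op m => (V * X * Vᴴ : Op p) :=
  isCP_of_kraus (fun _ : Unit => V) fun X => by simp

theorem IsCP.add {Φ Ψ : Op m → Op p} (h : IsCP Φ) (h' : IsCP Ψ) : IsCP fun X => Φ X + Ψ X := by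
  obtain ⟨r, V, hV⟩ := h
  obtain ⟨r', V', hV'⟩ := h'
  exact isCP_of_kraus (Sum.elim V V') fun X => by simp [hV, hV']

theorem isCP_zero : IsCP fun _ : Op m => (0 : Op p) :=
  isCP_of_kraus (fun l : Empty => l.elim) fun X => by simp

theorem IsCP.sum {α : Type*} (s : Finset α) {Φ : α → Op m → Op p} (h : ∀ a ∈ s, IsCP (Φ a)) :
    IsCP fun X => ∑ a ∈ s, Φ a X := by
  classical
  induction s using Finset.induction_on with
  | empty => simpa using isCP_zero
  | insert a s ha ih =>
    simp only [Finset.sum_insert ha]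
    exact (h a (Finset.mem_insert_self a s)).add
      (ih fun b hb => h b (Finset.mem_insert_of_mem hb))

theorem IsCP.smul {Φ : Op m → Op p} (h : IsCP Φ) {a : ℝ} (ha : 0 ≤ a) :
    IsCP fun X => (a : ℂ) • Φ X := by
  obtain ⟨r, V, hV⟩ := h
  refine ⟨r, fun l => ((Real.sqrt a : ℝ) : ℂ) • V l, fun X => ?_⟩
  have : ((Real.sqrt a : ℝ) : ℂ) * ((Real.sqrt a : ℝ) : ℂ) = a := by
    rw [← Complex.ofReal_mul, Real.mul_self_sqrt ha]
  simp only [hV, Finset.smul_sum, Matrix.conjTranspose_smul, Matrix.smul_mul, Matrix.mul_smul,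
    smul_smul, Complex.star_def, Complex.conj_ofReal, this]

theorem IsCP.comp {Ψ : Op p → Op q} {Φ : Op m → Op p} (h' : IsCP Ψ) (h : IsCP Φ) :
    IsCP fun X => Ψ (Φ X) := by
  obtain ⟨r, V, hV⟩ := h
  obtain ⟨r', V', hV'⟩ := h'
  refine isCP_of_kraus (fun l : Fin r' × Fin r => V' l.1 * V l.2) fun X => ?_
  simp only [hV, hV', Fintype.sum_prod_type, Matrix.mul_sum, Matrix.sum_mul,
    Matrix.conjTranspose_mul, Matrix.mul_assoc]

open scoped MatrixOrder in
theorem exists_conjTranspose_mul_self {X : Op m} (h : X.PosSemidef) : ∃ S : Op m, X = Sᴴ * S :=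
  CStarAlgebra.nonneg_iff_eq_star_mul_self.mp h.nonneg

/-- `X ↦ σ ⊗ X` is completely positive. -/
theorem isCP_kronecker {σ : Op p} (h : σ.PosSemidef) : IsCP fun X : Op m => σ ⊗ₖ X := by
  obtain ⟨S, hS⟩ := exists_conjTranspose_mul_self h
  refine isCP_of_kraus (fun l : p => Matrix.of fun (x : p × m) (b : m) =>
    star (S l x.1) * (1 : Op m) x.2 b) fun X => ?_
  ext ⟨i, a⟩ ⟨j, b⟩
  simp only [Matrix.sum_apply, Matrix.mul_apply, Matrix.of_apply, Matrix.conjTranspose_apply,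
    Matrix.kroneckerMap_apply, hS, Matrix.one_apply, star_mul', star_star]
  simp [Finset.sum_mul]
  exact Finset.sum_congr rfl fun l _ => by ring

/-- The Choi matrix. -/
def choi (Φ : Op m → Op p) : Op (p × m) :=
  Matrix.of fun x y => Φ (Matrix.single x.2 y.2 1) x.1 y.1

theorem linear_eq_sum_choi (Φ : Op m →ₗ[ℂ] Op p) (X : Op m) (i j : p) :
    Φ X i j = ∑ a, ∑ b, X a b * choi Φ (i, a) (j, b) := by
  conv_lhs => rw [Matrix.matrix_eq_sum_single X]
  simp only [map_sum, Matrix.sum_apply, choi, Matrix.of_apply]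
  refine Finset.sum_congr rfl fun a _ => Finset.sum_congr rfl fun b _ => ?_
  have : Matrix.single a b (X a b) = X a b • Matrix.single a b (1 : ℂ) := by
    rw [Matrix.smul_single, smul_eq_mul, mul_one]
  rw [this, map_smul, Matrix.smul_apply, smul_eq_mul]

/-- Choi's theorem: the rows of a square root of the Choi matrix, reshaped and conjugated, are Kraus
operators. -/
theorem isCP_of_posSemidef_choi (Φ : Op m →ₗ[ℂ] Op p) (h : (choi Φ).PosSemidef) : IsCP Φ := by
  obtain ⟨S, hS⟩ := exists_conjTranspose_mul_self h
  refine isCP_of_kraus (fun l : p × m => Matrix.of fun i a => star (S l (i, a))) fun X => ?_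
  ext i j
  rw [linear_eq_sum_choi, hS]
  simp only [Matrix.sum_apply, Matrix.mul_apply, Matrix.of_apply, Matrix.conjTranspose_apply,
    star_star, Finset.mul_sum, Finset.sum_mul]
  rw [Finset.sum_congr rfl fun a _ => Finset.sum_comm, Finset.sum_comm]
  refine Finset.sum_congr rfl fun l _ => ?_
  rw [Finset.sum_comm]
  exact Finset.sum_congr rfl fun a _ => Finset.sum_congr rfl fun b _ => by ring

theorem IsCP.posSemidef_choi {Φ : Op m → Op p} (h : IsCP Φ) : (choi Φ).PosSemidef := by
  obtain ⟨r, V, hV⟩ := h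
  have : choi Φ = ∑ l, Matrix.vecMulVec (fun x : p × m => V l x.1 x.2)
      (star fun x : p × m => V l x.1 x.2) := by
    ext ⟨i, a⟩ ⟨j, b⟩
    simp only [choi, Matrix.of_apply, hV, Matrix.sum_apply, Matrix.vecMulVec_apply, Pi.star_apply]
    refine Finset.sum_congr rfl fun l _ => ?_
    simp [Matrix.mul_apply, Matrix.single_apply, ite_and]
  rw [this]
  exact Matrix.posSemidef_sum _ fun l _ => Matrix.posSemidef_vecMulVec_self_star _

/-- Applied to Choi matrices, this makes complete positivity stable under limits, where Kraus
operators themselves need not converge. -/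
theorem posSemidef_of_tendsto {α : Type*} {l : Filter α} [l.NeBot] {X : α → Op m} {Y : Op m}
    (h : Tendsto X l (𝓝 Y)) (hX : ∀ a, (X a).PosSemidef) : Y.PosSemidef := by
  refine Matrix.PosSemidef.of_dotProduct_mulVec_nonneg ?_ fun v => ?_
  · have h1 : Tendsto (fun a => (X a)ᴴ) l (𝓝 Yᴴ) :=
      (continuous_id.matrix_conjTranspose.tendsto Y).comp h
    refine tendsto_nhds_unique h1 ?_
    simpa only [(hX _).isHermitian.eq] using h
  · have hc : Continuous fun Z : Op m => star v ⬝ᵥ (Z *ᵥ v) := by fun_prop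
    exact ge_of_tendsto' ((hc.tendsto Y).comp h) fun a => (hX a).dotProduct_mulVec_nonneg v

end CompletelyPositive

/-! ### Complete positivity of quantum dynamical semigroups -/

section SemigroupCP

attribute [local instance] Matrix.normedAddCommGroup Matrix.normedSpace

variable {m : Type*} [Fintype m] [DecidableEq m] {J : Type*} [Fintype J]

/-- A quantum dynamical semigroup is completely positive. -/
theorem isCP_opFlow {H : Op m} (hH : H.IsHermitian) (L : J → Op m) {t : ℝ} (ht : 0 ≤ t) :
    IsCP (opFlow (lindbladMap H L) t) := by
  refine isCP_of_posSemidef_choi (opFlow (lindbladMap H L) t).toLinearMap ?_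
  -- Euler's formula needs a nontrivial space, so that the identity has norm one.
  cases isEmpty_or_nonempty m
  · have : choi (opFlow (lindbladMap H L) t).toLinearMap = 0 := Subsingleton.elim _ _
    rw [this]
    exact Matrix.PosSemidef.zero
  let G := drift H L
  -- The second-order term `X ↦ G X G†` turns the Euler step into `(1 + hG) X (1 + hG)† + h ∑ L_μ X
  -- L_μ†`, which is visibly completely positive.
  let K : Op m →L[ℂ] Op m := LinearMap.toContinuousLinearMap
    (LinearMap.mulLeft ℂ G ∘ₗ LinearMap.mulRight ℂ Gᴴ)
  let T : Op m →L[ℂ] Op m := LinearMap.toContinuousLinearMap (lindbladMap H L)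
  have hstep : ∀ h : ℝ, 0 ≤ h → IsCP ⇑(1 + (h : ℂ) • T + (h : ℂ) ^ 2 • K) := fun h hh => by
    have h1 : IsCP fun X : Op m => (1 + (h : ℂ) • G) * X * (1 + (h : ℂ) • G)ᴴ
        + (h : ℂ) • ∑ μ, L μ * X * (L μ)ᴴ :=
      (isCP_conj _).add ((IsCP.sum _ fun μ _ => isCP_conj (L μ)).smul hh)
    convert h1 using 1
    funext X
    change X + (h : ℂ) • lindblad H L X + (h : ℂ) ^ 2 • (G * (X * Gᴴ)) = _
    rw [lindblad_eq, ← conjTranspose_drift hH]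
    simp only [Matrix.conjTranspose_add, Matrix.conjTranspose_one, Matrix.conjTranspose_smul,
      Complex.star_def, Complex.conj_ofReal, add_mul, mul_add, one_mul, mul_one, smul_mul_assoc,
      mul_smul_comm, smul_add, smul_smul, mul_assoc]
    change X + _ + _ = _
    simp only [← mul_assoc, sq]
    abel
  have hpow : ∀ A : Op m →L[ℂ] Op m, IsCP A → ∀ j : ℕ, IsCP ⇑(A ^ j) := fun A hA j => by
    induction j with
    | zero =>
      refine isCP_of_kraus (fun _ : Unit => (1 : Op m)) fun X => ?_
      rw [Fintype.sum_unique, one_mul, Matrix.conjTranspose_one, mul_one]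
      rfl
    | succ j ih =>
      rw [pow_succ]
      exact ih.comp hA
  have hlim := tendsto_euler_flow T K ht
  refine posSemidef_of_tendsto (l := atTop) (X := fun n : ℕ =>
    choi ⇑((1 + ((t / n : ℝ) : ℂ) • T + ((t / n : ℝ) : ℂ) ^ 2 • K) ^ n)) ?_
    fun n => (hpow _ (hstep (t / n) (by positivity)) n).posSemidef_choi
  refine tendsto_pi_nhds.2 fun x => tendsto_pi_nhds.2 fun y => ?_
  have h1 := ((ContinuousLinearMap.apply ℂ (Op m) (Matrix.single x.2 y.2 (1 : ℂ))).continuous.tendsto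
    _).comp hlim
  exact tendsto_pi_nhds.1 (tendsto_pi_nhds.1 h1 x.1) y.1

end SemigroupCP

/-! ### A Finsler-type lemma for Hermitian forms -/

section Finsler

variable {q : Type*} [Fintype q] [DecidableEq q]

theorem quadForm_add_of_ker {X : Op q} (hX : X.IsHermitian) {n w : q → ℂ} (hn : X *ᵥ n = 0) :
    star (n + w) ⬝ᵥ (X *ᵥ (n + w)) = star w ⬝ᵥ (X *ᵥ w) := by
  have h : star n ᵥ* X = 0 := by
    have := congrArg star hn
    rwa [Matrix.star_mulVec, hX.eq, star_zero] at this
  rw [Matrix.mulVec_add, hn, zero_add, star_add, add_dotProduct, Matrix.dotProduct_mulVec, h,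
    zero_dotProduct, zero_add]

theorem quadForm_im {X : Op q} (hX : X.IsHermitian) (v : q → ℂ) :
    (star v ⬝ᵥ (X *ᵥ v)).im = 0 := by
  refine Complex.conj_eq_iff_im.1 ?_
  have h : star (star v ⬝ᵥ (X *ᵥ v)) = star v ⬝ᵥ (X *ᵥ v) := by
    rw [← Matrix.star_dotProduct_star, star_star, Matrix.star_mulVec, hX.eq,
      ← Matrix.dotProduct_mulVec]
  exact h

theorem posSemidef_of_re {X : Op q} (hX : X.IsHermitian)
    (h : ∀ v, 0 ≤ (star v ⬝ᵥ (X *ᵥ v)).re) : X.PosSemidef :=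
  Matrix.PosSemidef.of_dotProduct_mulVec_nonneg hX fun v =>
    Complex.le_def.2 ⟨h v, (quadForm_im hX v).symm⟩

/-- If the Hermitian form `X` is nonnegative on the kernel of `Y ≥ 0`, with isotropic vectors there
lying in the kernel of `X`, then `X + τY ≥ 0` for some `τ > 0`. -/
theorem exists_posSemidef_add_smul {X Y : Op q} (hX : X.IsHermitian) (hY : Y.PosSemidef)
    (h0 : ∀ v, Y *ᵥ v = 0 → 0 ≤ (star v ⬝ᵥ (X *ᵥ v)).re)
    (h1 : ∀ v, Y *ᵥ v = 0 → (star v ⬝ᵥ (X *ᵥ v)).re = 0 → X *ᵥ v = 0) :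
    ∃ τ : ℝ, 0 < τ ∧ (X + (τ : ℂ) • Y).PosSemidef := by
  -- Both forms ignore the common kernel `N`, so the estimate is needed only on the unit sphere of a
  -- complement `C`.
  let N : Submodule ℂ (q → ℂ) := LinearMap.ker X.mulVecLin ⊓ LinearMap.ker Y.mulVecLin
  obtain ⟨C, hC⟩ := N.exists_isCompl
  let x : (q → ℂ) → ℝ := fun v => (star v ⬝ᵥ (X *ᵥ v)).re
  let y : (q → ℂ) → ℝ := fun v => (star v ⬝ᵥ (Y *ᵥ v)).re
  have hy : ∀ v, 0 ≤ y v := fun v => (Complex.le_def.1 (hY.dotProduct_mulVec_nonneg v)).1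
  have hxc : Continuous x := by fun_prop
  have hyc : Continuous y := by fun_prop
  -- Unit vectors of `C` at which `X + (n + 1) Y` is not yet positive: a decreasing sequence of
  -- compact sets. The coefficient `n + 1` keeps the eventual `τ` positive.
  let t : ℕ → Set (q → ℂ) := fun n =>
    (C : Set (q → ℂ)) ∩ Metric.sphere 0 1 ∩ {v | x v + (n + 1) * y v ≤ 0}
  have hclosed : ∀ n, IsClosed (t n) := fun n =>
    (C.closed_of_finiteDimensional.inter Metric.isClosed_sphere).inter
      (isClosed_le (by fun_prop) continuous_const)
  have hcompact : IsCompact (t 0) :=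
    (isCompact_sphere (0 : q → ℂ) 1).of_isClosed_subset (hclosed 0) fun v hv => hv.1.2
  have hmono : ∀ n, t (n + 1) ⊆ t n := fun n v hv => by
    refine ⟨hv.1, ?_⟩
    have h2 : x v + ((n + 1 : ℕ) + 1) * y v ≤ 0 := hv.2
    push_cast at h2
    change x v + (n + 1) * y v ≤ 0
    nlinarith [hy v]
  by_cases hne : ∀ n, (t n).Nonempty
  · exfalso
    obtain ⟨v, hv⟩ := IsCompact.nonempty_iInter_of_sequence_nonempty_isCompact_isClosed t hmono hne
      hcompact hclosed
    have hv' : ∀ n : ℕ, v ∈ t n := fun n => Set.mem_iInter.1 hv n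
    have hle : ∀ n : ℕ, x v + (n + 1) * y v ≤ 0 := fun n => (hv' n).2
    -- A vector in every `t n` has `y v = 0`, since otherwise `(n + 1) y v` outgrows `-x v`. The
    -- hypotheses then put it in `N`, which meets `C` only in zero.
    have hy0 : y v = 0 := by
      by_contra hne
      have hpos : 0 < y v := lt_of_le_of_ne (hy v) (Ne.symm hne)
      obtain ⟨n, hn⟩ := exists_nat_gt (-x v / y v)
      have := hle n
      rw [div_lt_iff₀ hpos] at hn
      nlinarith
    have hYv : Y *ᵥ v = 0 := (hY.dotProduct_mulVec_zero_iff v).1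
      (Complex.ext hy0 (quadForm_im hY.isHermitian v))
    have hx0 : x v = 0 := le_antisymm (by simpa [hy0] using hle 0) (h0 v hYv)
    have hXv : X *ᵥ v = 0 := h1 v hYv hx0
    have hvN : v ∈ N := ⟨hXv, hYv⟩
    have hv0 : v = 0 := (Submodule.disjoint_def.1 hC.disjoint) v hvN (hv' 0).1.1
    have := (hv' 0).1.2
    simp [hv0] at this
  · push Not at hne
    obtain ⟨n, hn⟩ := hne
    refine ⟨n + 1, by positivity, ?_⟩
    have hHerm : (X + ((n + 1 : ℝ) : ℂ) • Y).IsHermitian := by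
      refine hX.add ?_
      rw [Matrix.IsHermitian, Matrix.conjTranspose_smul, hY.isHermitian.eq]
      simp
    refine posSemidef_of_re hHerm fun v => ?_
    obtain ⟨a, ha, w, hw, rfl⟩ := Submodule.mem_sup.1
      (hC.sup_eq_top ▸ Submodule.mem_top : v ∈ N ⊔ C)
    have ha' : (X + ((n + 1 : ℝ) : ℂ) • Y) *ᵥ a = 0 := by
      have e1 : X *ᵥ a = 0 := ha.1
      have e2 : Y *ᵥ a = 0 := ha.2
      rw [Matrix.add_mulVec, Matrix.smul_mulVec, e1, e2, smul_zero, add_zero]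
    rw [quadForm_add_of_ker hHerm ha']
    have hform : ∀ u : q → ℂ, (star u ⬝ᵥ ((X + ((n + 1 : ℝ) : ℂ) • Y) *ᵥ u)).re
        = x u + (n + 1) * y u := fun u => by
      rw [Matrix.add_mulVec, dotProduct_add, Complex.add_re, Matrix.smul_mulVec, dotProduct_smul,
        smul_eq_mul, Complex.re_ofReal_mul]
    rcases eq_or_ne w 0 with rfl | hw0
    · simp
    · have hnw : 0 < ‖w‖ := norm_pos_iff.2 hw0
      have hu : (((‖w‖⁻¹ : ℝ) : ℂ) • w) ∉ t n := by rw [hn]; exact Set.notMem_empty _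
      have hmem : (((‖w‖⁻¹ : ℝ) : ℂ) • w) ∈ (C : Set (q → ℂ)) ∩ Metric.sphere 0 1 := by
        refine ⟨C.smul_mem _ hw, ?_⟩
        rw [mem_sphere_zero_iff_norm, norm_smul, Complex.norm_real, norm_inv, norm_norm,
          inv_mul_cancel₀ hnw.ne']
      have hlt : 0 < x (((‖w‖⁻¹ : ℝ) : ℂ) • w) + (n + 1) * y (((‖w‖⁻¹ : ℝ) : ℂ) • w) := by
        by_contra hle
        exact hu ⟨hmem, not_lt.1 hle⟩
      rw [← hform] at hlt
      rw [Matrix.mulVec_smul, dotProduct_smul, star_smul, smul_dotProduct, smul_smul,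
        Complex.star_def, Complex.conj_ofReal, ← Complex.ofReal_mul, smul_eq_mul,
        Complex.re_ofReal_mul] at hlt
      exact (pos_of_mul_pos_right hlt (by positivity)).le

end Finsler

/-! ### Restoring the trace of a completely positive expansion -/

section Normalization

variable {m p : Type*} [Fintype m] [DecidableEq m] [Fintype p] [DecidableEq p]

/-- A Hermitian matrix with small entries is dominated by a multiple of the identity. -/
theorem posSemidef_smul_one_sub {E : Op m} (hE : E.IsHermitian) {β : ℝ}
    (hβ : ∀ a b, ‖E a b‖ ≤ β) : (((Fintype.card m * β : ℝ) : ℂ) • (1 : Op m) - E).PosSemidef := by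
  refine posSemidef_of_re ?_ fun v => ?_
  · refine Matrix.IsHermitian.sub ?_ hE
    rw [Matrix.IsHermitian, Matrix.conjTranspose_smul, Complex.star_def, Complex.conj_ofReal,
      Matrix.conjTranspose_one]
  · have h1 : (star v ⬝ᵥ v).re = ∑ a, ‖v a‖ ^ 2 := by
      simp only [dotProduct, Pi.star_apply, Complex.star_def, Complex.re_sum, ← Complex.normSq_eq_conj_mul_self,
        Complex.ofReal_re, Complex.normSq_eq_norm_sq]
    have h2 : (star v ⬝ᵥ (E *ᵥ v)).re ≤ β * (∑ a, ‖v a‖) ^ 2 := by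
      refine (Complex.re_le_norm _).trans ?_
      simp only [dotProduct, Matrix.mulVec, Finset.mul_sum, sq, Finset.sum_mul]
      refine (norm_sum_le _ _).trans (Finset.sum_le_sum fun a _ => (norm_sum_le _ _).trans
        (Finset.sum_le_sum fun b _ => ?_))
      rw [norm_mul, norm_mul, Pi.star_apply, norm_star]
      have := mul_le_mul_of_nonneg_right (hβ a b) (mul_nonneg (norm_nonneg (v a)) (norm_nonneg (v b)))
      nlinarith [this]
    rw [Matrix.sub_mulVec, dotProduct_sub, Complex.sub_re, Matrix.smul_mulVec, Matrix.one_mulVec,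
      dotProduct_smul, smul_eq_mul, Complex.re_ofReal_mul, h1, sub_nonneg]
    refine h2.trans ?_
    cases isEmpty_or_nonempty m
    · simp
    · have hβ0 : 0 ≤ β := (norm_nonneg _).trans (hβ (Classical.arbitrary m) (Classical.arbitrary m))
      have := sq_sum_le_card_mul_sum_sq (s := Finset.univ) (f := fun a => ‖v a‖)
      rw [Finset.card_univ] at this
      calc _ ≤ β * (Fintype.card m * ∑ a, ‖v a‖ ^ 2) := by gcongr
        _ = _ := by ring

theorem norm_sq_le_conjTranspose_mul_self (S : Op m) (a b : m) :
    ‖S a b‖ ^ 2 ≤ ((Sᴴ * S) b b).re := by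
  have : ((Sᴴ * S) b b).re = ∑ a, ‖S a b‖ ^ 2 := by
    simp only [Matrix.mul_apply, Matrix.conjTranspose_apply, Complex.star_def, Complex.re_sum,
      ← Complex.normSq_eq_conj_mul_self, Complex.ofReal_re, Complex.normSq_eq_norm_sq]
  rw [this]
  exact Finset.single_le_sum (f := fun a => ‖S a b‖ ^ 2) (fun _ _ => sq_nonneg _) (Finset.mem_univ a)

/-- The matrix representing a linear functional through the trace pairing. -/
def traceRep (θ : Op m →ₗ[ℂ] ℂ) : Op m := Matrix.of fun a b => θ (Matrix.single b a 1)

theorem trace_traceRep_mul (θ : Op m →ₗ[ℂ] ℂ) (X : Op m) : (traceRep θ * X).trace = θ X := by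
  conv_rhs => rw [Matrix.matrix_eq_sum_single X]
  simp only [map_sum, Matrix.trace, Matrix.diag, Matrix.mul_apply, traceRep, Matrix.of_apply]
  rw [Finset.sum_comm]
  refine Finset.sum_congr rfl fun a _ => Finset.sum_congr rfl fun b _ => ?_
  have : Matrix.single a b (X a b) = X a b • Matrix.single a b (1 : ℂ) := by
    rw [Matrix.smul_single, smul_eq_mul, mul_one]
  rw [this, map_smul, smul_eq_mul, mul_comm]

theorem eq_traceRep {θ : Op m →ₗ[ℂ] ℂ} {T : Op m} (h : ∀ X, (T * X).trace = θ X) :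
    T = traceRep θ := by
  ext a b
  rw [traceRep, Matrix.of_apply, ← h, Matrix.trace_mul_single]
  simp

/-- The dual of a trace functional of a completely positive map is Hermitian. -/
theorem IsCP.isHermitian_traceRep {Φ : Op m → Op p} (h : IsCP Φ) {θ : Op m →ₗ[ℂ] ℂ}
    (hθ : ∀ X, θ X = (Φ X).trace) : (traceRep θ).IsHermitian := by
  obtain ⟨r, V, hV⟩ := h
  have : traceRep θ = ∑ l, (V l)ᴴ * V l := by
    refine (eq_traceRep fun X => ?_).symm
    rw [hθ, hV, Matrix.trace_sum, Matrix.sum_mul, Matrix.trace_sum]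
    refine Finset.sum_congr rfl fun l _ => ?_
    rw [Matrix.mul_assoc, Matrix.trace_mul_comm]
  rw [this, Matrix.IsHermitian, Matrix.conjTranspose_sum]
  simp

theorem norm_linear_apply_le (Φ : Op m →ₗ[ℂ] Op p) {X : Op m} {β : ℝ} (hβ : ∀ a b, ‖X a b‖ ≤ β)
    (i j : p) : ‖Φ X i j‖ ≤ β * ∑ a, ∑ b, ‖choi Φ (i, a) (j, b)‖ := by
  rw [linear_eq_sum_choi, Finset.mul_sum]
  refine (norm_sum_le _ _).trans (Finset.sum_le_sum fun a _ => ?_)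
  rw [Finset.mul_sum]
  refine (norm_sum_le _ _).trans (Finset.sum_le_sum fun b _ => ?_)
  rw [norm_mul]
  exact mul_le_mul_of_nonneg_right (hβ a b) (norm_nonneg _)

theorem le_sum_sum {α γ : Type*} [Fintype α] [Fintype γ] (f : α → γ → ℝ) (hf : ∀ a b, 0 ≤ f a b)
    (a : α) (b : γ) : f a b ≤ ∑ a, ∑ b, f a b :=
  (Finset.single_le_sum (f := f a) (fun b _ => hf a b) (Finset.mem_univ b)).trans
    (Finset.single_le_sum (f := fun a => ∑ b, f a b) (fun a _ => Finset.sum_nonneg fun b _ => hf a b)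
      (Finset.mem_univ a))

theorem norm_conj_apply_le {S X : Op m} {B : ℝ} (hS : ∀ a b, ‖S a b‖ ^ 2 ≤ B) (a b : m) :
    ‖(S * X * Sᴴ) a b‖ ≤ B * ∑ a, ∑ b, ‖X a b‖ := by
  have hSS : ∀ a b a' b', ‖S a b‖ * ‖S a' b'‖ ≤ B := fun a b a' b' => by
    nlinarith [hS a b, hS a' b', sq_nonneg (‖S a b‖ - ‖S a' b'‖)]
  rw [Matrix.mul_apply, Finset.mul_sum, Finset.sum_congr rfl fun x _ => Finset.mul_sum _ _ _,
    Finset.sum_comm]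
  refine (norm_sum_le _ _).trans (Finset.sum_le_sum fun x _ => ?_)
  rw [Matrix.mul_apply, Finset.sum_mul]
  refine (norm_sum_le _ _).trans (Finset.sum_le_sum fun y _ => ?_)
  rw [norm_mul, norm_mul, Matrix.conjTranspose_apply, norm_star]
  calc _ = (‖S a y‖ * ‖S b x‖) * ‖X y x‖ := by ring
    _ ≤ _ := mul_le_mul_of_nonneg_right (hSS _ _ _ _) (norm_nonneg _)

set_option maxHeartbeats 1000000 in
/-- A family that is completely positive up to third-order terms and preserves the trace to second
order is CPTP up to third-order terms. -/
theorem isCPTPUpTo_three (Φ₀ Φ₁ Φ₂ Φ₃ Φ₄ : Op m →ₗ[ℂ] Op p) (hcp₀ : IsCP Φ₀)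
    (h₀ : ∀ X, (Φ₀ X).trace = X.trace) (h₁ : ∀ X, (Φ₁ X).trace = 0) (h₂ : ∀ X, (Φ₂ X).trace = 0)
    (hcp : ∀ ε : ℝ, 0 < ε → IsCP fun X => Φ₀ X + (ε : ℂ) • Φ₁ X + (ε : ℂ) ^ 2 • Φ₂ X
      + (ε : ℂ) ^ 3 • Φ₃ X + (ε : ℂ) ^ 4 • Φ₄ X) :
    IsCPTPUpTo 3 fun ε X => Φ₀ X + (ε : ℂ) • Φ₁ X + (ε : ℂ) ^ 2 • Φ₂ X := by
  let Ξ : ℝ → Op m → Op p := fun ε X => Φ₀ X + (ε : ℂ) • Φ₁ X + (ε : ℂ) ^ 2 • Φ₂ X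
      + (ε : ℂ) ^ 3 • Φ₃ X + (ε : ℂ) ^ 4 • Φ₄ X
  -- The trace defect of the full expansion `Ξ ε` is `ε³ θ ε`, represented by the matrix `E ε`
  -- through the trace pairing.
  let θ : ℝ → Op m →ₗ[ℂ] ℂ := fun ε =>
    (Matrix.traceLinearMap p ℂ ℂ) ∘ₗ Φ₃ + (ε : ℂ) • ((Matrix.traceLinearMap p ℂ ℂ) ∘ₗ Φ₄)
  let E : ℝ → Op m := fun ε => traceRep (θ ε)
  have hθ : ∀ ε X, θ ε X = (Φ₃ X).trace + ε * (Φ₄ X).trace := fun ε X => by simp [θ]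
  have htr : ∀ ε X, (Ξ ε X).trace = X.trace + (ε : ℂ) ^ 3 * (E ε * X).trace := fun ε X => by
    simp only [Ξ, E, trace_traceRep_mul, hθ, Matrix.trace_add, Matrix.trace_smul, h₀, h₁, h₂,
      smul_eq_mul]
    ring
  -- `1 + ε³ E` represents the trace of a completely positive map and is thus of the form `∑ V†V`.
  have hE : ∀ ε, 0 < ε → (E ε).IsHermitian := fun ε hε => by
    have h := (hcp ε hε).isHermitian_traceRep
      (θ := Matrix.traceLinearMap m ℂ ℂ + (ε : ℂ) ^ 3 • θ ε) fun X => by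
        rw [htr ε X]; simp [E, trace_traceRep_mul]
    have e : traceRep (Matrix.traceLinearMap m ℂ ℂ + (ε : ℂ) ^ 3 • θ ε)
        = 1 + (ε : ℂ) ^ 3 • E ε := by
      refine (eq_traceRep fun X => ?_).symm
      simp [add_mul, E, trace_traceRep_mul]
    rw [e, Matrix.IsHermitian, Matrix.conjTranspose_add, Matrix.conjTranspose_one,
      Matrix.conjTranspose_smul, add_right_inj] at h
    have hne : (ε : ℂ) ^ 3 ≠ 0 := pow_ne_zero _ (by exact_mod_cast hε.ne')
    have hs : star ((ε : ℂ) ^ 3) = (ε : ℂ) ^ 3 := by simp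
    rw [hs] at h
    exact smul_right_injective _ hne h
  set β : ℝ := ∑ a, ∑ b, (‖(Φ₃ (Matrix.single b a 1)).trace‖ + ‖(Φ₄ (Matrix.single b a 1)).trace‖)
    with hβdef
  have hβ0 : 0 ≤ β := by positivity
  have hβ : ∀ ε : ℝ, 0 < ε → ε ≤ 1 → ∀ a b, ‖E ε a b‖ ≤ β := fun ε hε hε1 a b => by
    have h1 : ‖E ε a b‖ ≤ ‖(Φ₃ (Matrix.single b a 1)).trace‖ + ‖(Φ₄ (Matrix.single b a 1)).trace‖ := by
      simp only [E, traceRep, Matrix.of_apply, hθ]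
      refine (norm_add_le _ _).trans ?_
      rw [norm_mul, Complex.norm_real, Real.norm_of_nonneg hε.le]
      gcongr
      exact mul_le_of_le_one_left (norm_nonneg _) hε1
    exact h1.trans (le_sum_sum (fun a b => ‖(Φ₃ (Matrix.single b a 1)).trace‖
      + ‖(Φ₄ (Matrix.single b a 1)).trace‖) (fun _ _ => by positivity) a b)
  set κ : ℝ := Fintype.card m * β with hκ
  have hκ0 : 0 ≤ κ := by positivity
  set B : ℝ := κ + β with hB
  let C : Op m → ℝ := fun X =>
    ∑ i, ∑ j, (‖Φ₃ X i j‖ + ‖Φ₄ X i j‖ + κ * (‖Φ₀ X i j‖ + ‖Φ₁ X i j‖ + ‖Φ₂ X i j‖ + ‖Φ₃ X i j‖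
      + ‖Φ₄ X i j‖) + (B * ∑ a, ∑ b, ‖X a b‖) * ∑ a, ∑ b, ‖choi Φ₀ (i, a) (j, b)‖)
  have key : ∀ ε : ℝ, 0 < ε → ε ≤ 1 → κ * ε ^ 3 ≤ 1 → ∃ Ψ : Op m → Op p, IsCPTP Ψ ∧
      ∀ X i j, ‖((Φ₀ X + (ε : ℂ) • Φ₁ X + (ε : ℂ) ^ 2 • Φ₂ X) - Ψ X) i j‖ ≤ C X * ε ^ 3 := by
    intro ε hε hε1 hεκ
    -- Shrinking `Ξ ε` by `s` leaves room to fix the trace by adding a completely positive term: `s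
    -- (1 + ε³E) + ε³ (κ - sE) = 1`.
    set s : ℝ := 1 - κ * ε ^ 3 with hs
    have hs0 : 0 ≤ s := sub_nonneg.2 hεκ
    have hs1 : s ≤ 1 := by rw [hs]; nlinarith [mul_nonneg hκ0 (pow_nonneg hε.le 3)]
    have hsE : ((s : ℂ) • E ε).IsHermitian := by
      rw [Matrix.IsHermitian, Matrix.conjTranspose_smul, (hE ε hε).eq]; simp
    have hsβ : ∀ a b, ‖((s : ℂ) • E ε) a b‖ ≤ β := fun a b => by
      rw [Matrix.smul_apply, smul_eq_mul, norm_mul, Complex.norm_real, Real.norm_of_nonneg hs0]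
      exact (mul_le_of_le_one_left (norm_nonneg _) hs1).trans (hβ ε hε hε1 a b)
    -- Here `S†S = κ - sE`, positive by the choice of `κ`; since `Φ₀` preserves the trace, `X ↦ Φ₀(S
    -- X S†)` has exactly the required trace.
    obtain ⟨S, hS⟩ := exists_conjTranspose_mul_self (posSemidef_smul_one_sub hsE hsβ)
    have hSb : ∀ a b, ‖S a b‖ ^ 2 ≤ B := fun a b => by
      refine (norm_sq_le_conjTranspose_mul_self S a b).trans ?_
      rw [← hS, Matrix.sub_apply, Matrix.smul_apply, Matrix.one_apply_eq, smul_eq_mul, mul_one,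
        Complex.sub_re, Complex.ofReal_re]
      have h1 : -β ≤ (((s : ℂ) • E ε) b b).re :=
        (abs_le.1 ((Complex.abs_re_le_norm _).trans (hsβ b b))).1
      linarith
    refine ⟨fun X => (s : ℂ) • Ξ ε X + ((ε ^ 3 : ℝ) : ℂ) • Φ₀ (S * X * Sᴴ), ⟨?_, fun X => ?_⟩,
      fun X i j => ?_⟩
    · exact ((hcp ε hε).smul hs0).add ((hcp₀.comp (isCP_conj S)).smul (by positivity))
    · have h1 : (S * X * Sᴴ).trace = κ * X.trace - s * (E ε * X).trace := by
        rw [Matrix.mul_assoc, Matrix.trace_mul_comm, Matrix.mul_assoc, Matrix.trace_mul_comm, ← hS,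
          sub_mul, Matrix.trace_sub, smul_mul_assoc, smul_mul_assoc, one_mul, Matrix.trace_smul,
          Matrix.trace_smul]
        rfl
      rw [Matrix.trace_add, Matrix.trace_smul, Matrix.trace_smul, htr, h₀, h1, hs]
      simp only [smul_eq_mul]
      push_cast
      ring
    · have hB0 : 0 ≤ B := by positivity
      have hlast := norm_linear_apply_le Φ₀ (norm_conj_apply_le (X := X) hSb) i j
      have e : ((Φ₀ X + (ε : ℂ) • Φ₁ X + (ε : ℂ) ^ 2 • Φ₂ X)
          - ((s : ℂ) • Ξ ε X + ((ε ^ 3 : ℝ) : ℂ) • Φ₀ (S * X * Sᴴ))) i j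
          = (ε : ℂ) ^ 3 * (-(Φ₃ X i j + ε * Φ₄ X i j)
            + κ * (Φ₀ X i j + ε * Φ₁ X i j + ε ^ 2 * Φ₂ X i j + ε ^ 3 * Φ₃ X i j + ε ^ 4 * Φ₄ X i j)
            - Φ₀ (S * X * Sᴴ) i j) := by
        simp only [Ξ, hs, Matrix.sub_apply, Matrix.add_apply, Matrix.smul_apply, smul_eq_mul]
        push_cast
        ring
      have hεn : ‖(ε : ℂ)‖ = ε := by rw [Complex.norm_real, Real.norm_of_nonneg hε.le]
      have hp : ∀ (k : ℕ) (z : ℂ), ‖(ε : ℂ) ^ k * z‖ ≤ ‖z‖ := fun k z => by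
        rw [norm_mul, norm_pow, hεn]
        exact mul_le_of_le_one_left (norm_nonneg _) (pow_le_one₀ hε.le hε1)
      have hp1 : ∀ z : ℂ, ‖(ε : ℂ) * z‖ ≤ ‖z‖ := fun z => by simpa using hp 1 z
      rw [e, norm_mul, norm_pow, hεn, mul_comm]
      refine mul_le_mul_of_nonneg_right ?_ (by positivity)
      refine le_trans ?_ (le_sum_sum (fun i j => ‖Φ₃ X i j‖ + ‖Φ₄ X i j‖
        + κ * (‖Φ₀ X i j‖ + ‖Φ₁ X i j‖ + ‖Φ₂ X i j‖ + ‖Φ₃ X i j‖ + ‖Φ₄ X i j‖)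
        + (B * ∑ a, ∑ b, ‖X a b‖) * ∑ a, ∑ b, ‖choi Φ₀ (i, a) (j, b)‖)
        (fun _ _ => by positivity) i j)
      refine (norm_sub_le _ _).trans (add_le_add ((norm_add_le _ _).trans (add_le_add ?_ ?_)) hlast)
      · rw [norm_neg]
        exact (norm_add_le _ _).trans (add_le_add le_rfl (hp1 _))
      · rw [norm_mul, Complex.norm_real, Real.norm_of_nonneg hκ0]
        refine mul_le_mul_of_nonneg_left ?_ hκ0
        exact (norm_add_le _ _).trans (add_le_add ((norm_add_le _ _).trans (add_le_add
          ((norm_add_le _ _).trans (add_le_add ((norm_add_le _ _).trans (add_le_add le_rfl (hp1 _)))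
          (hp 2 _))) (hp 3 _))) (hp 4 _))
  have hev : ∀ᶠ ε in 𝓝[>] (0 : ℝ), 0 < ε ∧ ε ≤ 1 ∧ κ * ε ^ 3 ≤ 1 := by
    have h1 : ∀ᶠ ε in 𝓝[>] (0 : ℝ), ε ≤ 1 :=
      nhdsWithin_le_nhds (eventually_le_nhds one_pos)
    have h2 : ∀ᶠ ε in 𝓝[>] (0 : ℝ), κ * ε ^ 3 ≤ 1 := by
      have hc : Tendsto (fun ε : ℝ => κ * ε ^ 3) (𝓝 0) (𝓝 0) := by
        have : Continuous fun ε : ℝ => κ * ε ^ 3 := by fun_prop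
        simpa using this.tendsto 0
      exact nhdsWithin_le_nhds (hc.eventually_le_const one_pos)
    filter_upwards [self_mem_nhdsWithin, h1, h2] with ε h0 h1 h2 using ⟨h0, h1, h2⟩
  have hch : ∀ ε : ℝ, ∃ Ψ : Op m → Op p, (0 < ε ∧ ε ≤ 1 ∧ κ * ε ^ 3 ≤ 1) → IsCPTP Ψ ∧
      ∀ X i j, ‖((Φ₀ X + (ε : ℂ) • Φ₁ X + (ε : ℂ) ^ 2 • Φ₂ X) - Ψ X) i j‖ ≤ C X * ε ^ 3 := fun ε => by
    by_cases h : 0 < ε ∧ ε ≤ 1 ∧ κ * ε ^ 3 ≤ 1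
    · obtain ⟨Ψ, hΨ⟩ := key ε h.1 h.2.1 h.2.2
      exact ⟨Ψ, fun _ => hΨ⟩
    · exact ⟨0, fun h' => absurd h' h⟩
  choose Ψ hΨ using hch
  refine ⟨Ψ, hev.mono fun ε h => (hΨ ε h).1, fun X i j => ?_⟩
  refine Asymptotics.IsBigO.of_bound (C X) (hev.mono fun ε h => ?_)
  rw [norm_pow, Real.norm_of_nonneg h.1.le]
  exact (hΨ ε h).2 X i j

end Normalization

section LinearDecay

variable {E : Type*} [NormedAddCommGroup E] [NormedSpace ℂ E] [FiniteDimensional ℂ E]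

theorem exists_exponential_decay_apply [CompleteSpace E] (T S : E →ₗ[ℂ] E)
    (hS : ∀ x, S (S x) = S x) (hT : ∀ x, S (T x) = T (S x))
    (h : ∀ x, Tendsto (fun t => flow (LinearMap.toContinuousLinearMap T) t (S x)) atTop (𝓝 0)) :
    ∃ C γ : ℝ, 0 < γ ∧ ∀ t, 0 ≤ t → ∀ x,
      ‖flow (LinearMap.toContinuousLinearMap T) t (S x)‖ ≤ C * Real.exp (-γ * t) * ‖x‖ := by
  obtain ⟨C, γ, hγ, h⟩ := exists_exponential_decay (LinearMap.toContinuousLinearMap T)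
    (LinearMap.toContinuousLinearMap S) (ContinuousLinearMap.ext hS) (ContinuousLinearMap.ext hT) h
  refine ⟨C, γ, hγ, fun t ht x => ?_⟩
  exact ((flow (LinearMap.toContinuousLinearMap T) t * LinearMap.toContinuousLinearMap S).le_opNorm
    x).trans (mul_le_mul_of_nonneg_right (h t ht) (norm_nonneg x))

end LinearDecay

/-! ### An environment acting on environment and target -/

section Environment

attribute [local instance] Matrix.normedAddCommGroup Matrix.normedSpace

variable {e n : Type*} [Fintype e] [DecidableEq e] [Fintype n] [DecidableEq n]
  {J : Type*} [Fintype J]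

/-- `X ↦ X ⊗ 1` as a star-algebra homomorphism. -/
def kronHom : Op e →⋆ₐ[ℂ] Op (e × n) where
  toFun X := X ⊗ₖ (1 : Op n)
  map_one' := Matrix.one_kronecker_one
  map_mul' X Y := by rw [← Matrix.mul_kronecker_mul, mul_one]
  map_zero' := Matrix.zero_kronecker _
  map_add' X Y := Matrix.add_kronecker _ _ _
  commutes' z := by
    rw [Algebra.algebraMap_eq_smul_one, Algebra.algebraMap_eq_smul_one, Matrix.smul_kronecker,
      Matrix.one_kronecker_one]
  map_star' X := by
    simp only [Matrix.star_eq_conjTranspose, Matrix.conjTranspose_kronecker,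
      Matrix.conjTranspose_one]

@[simp] theorem kronHom_apply (X : Op e) : (kronHom X : Op (e × n)) = X ⊗ₖ (1 : Op n) := rfl

/-- The Lindbladian of the environment, acting on environment and target. -/
def envLindblad (n : Type*) [Fintype n] [DecidableEq n] (H : Op e) (L : J → Op e) :
    Op (e × n) →ₗ[ℂ] Op (e × n) :=
  lindbladMap (H ⊗ₖ (1 : Op n)) fun s => L s ⊗ₖ (1 : Op n)

theorem envLindblad_kronecker (H : Op e) (L : J → Op e) (X : Op e) (Y : Op n) :
    envLindblad n H L (X ⊗ₖ Y) = lindblad H L X ⊗ₖ Y := by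
  have hc : ∀ Z : Op e, Commute ((1 : Op e) ⊗ₖ Y) (kronHom Z) := fun Z => by
    rw [commute_iff_eq, kronHom_apply, ← Matrix.mul_kronecker_mul, ← Matrix.mul_kronecker_mul,
      one_mul, mul_one, one_mul, mul_one]
  have h := lindblad_map_mul kronHom H L X ((1 : Op e) ⊗ₖ Y) hc
  simp only [kronHom_apply, ← Matrix.mul_kronecker_mul, one_mul, mul_one] at h
  exact h

/-- `X ↦ X ⊗ Y` as a linear map. -/
def kronRight (Y : Op n) : Op e →ₗ[ℂ] Op (e × n) where
  toFun X := X ⊗ₖ Y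
  map_add' X X' := Matrix.add_kronecker X X' Y
  map_smul' z X := Matrix.smul_kronecker z X Y

/-- `Y ↦ X ⊗ Y` as a linear map. -/
def kronLeft (X : Op e) : Op n →ₗ[ℂ] Op (e × n) where
  toFun Y := X ⊗ₖ Y
  map_add' Y Y' := Matrix.kronecker_add X Y Y'
  map_smul' z Y := Matrix.kronecker_smul z X Y

@[simp] theorem kronRight_apply (X : Op e) (Y : Op n) : kronRight Y X = X ⊗ₖ Y := rfl

@[simp] theorem kronLeft_apply (X : Op e) (Y : Op n) : kronLeft X Y = X ⊗ₖ Y := rfl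

theorem opFlow_envLindblad (H : Op e) (L : J → Op e) (t : ℝ) (X : Op e) (Y : Op n) :
    opFlow (envLindblad n H L) t (X ⊗ₖ Y) = opFlow (lindbladMap H L) t X ⊗ₖ Y :=
  (map_opFlow (lindbladMap H L) (envLindblad n H L) (kronRight Y)
    (fun X => (envLindblad_kronecker H L X Y).symm) t X).symm

theorem span_kronecker (S : Submodule ℂ (Op (e × n)))
    (h : ∀ (X : Op e) (Y : Op n), X ⊗ₖ Y ∈ S) : S = ⊤ := by
  rw [eq_top_iff]
  rintro X -
  rw [Matrix.matrix_eq_sum_single X]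
  refine S.sum_mem fun a _ => S.sum_mem fun b _ => ?_
  have h1 := S.smul_mem (X a b) (h (Matrix.single a.1 b.1 1) (Matrix.single a.2 b.2 1))
  have h2 : (Matrix.single a.1 b.1 (1 : ℂ)) ⊗ₖ (Matrix.single a.2 b.2 (1 : ℂ))
      = Matrix.single a b 1 := by
    rw [Matrix.single_kronecker_single, mul_one]
  rwa [h2, Matrix.smul_single, smul_eq_mul, mul_one] at h1

/-- `partialTrace` as a linear map. -/
def partialTraceMap : Op (e × n) →ₗ[ℂ] Op n where
  toFun := partialTrace
  map_add' X Y := by ext; simp [partialTrace, Finset.sum_add_distrib]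
  map_smul' z X := by ext; simp [partialTrace, Finset.mul_sum]

@[simp] theorem partialTraceMap_apply (X : Op (e × n)) : partialTraceMap X = partialTrace X := rfl

theorem partialTrace_kronecker (X : Op e) (Y : Op n) :
    partialTrace (X ⊗ₖ Y) = X.trace • Y := by
  ext b b'
  simp [partialTrace, Matrix.trace, Finset.sum_mul]

theorem trace_partialTrace (X : Op (e × n)) : (partialTrace X).trace = X.trace := by
  simp only [Matrix.trace, Matrix.diag, partialTrace, Matrix.of_apply, Fintype.sum_prod_type]
  exact Finset.sum_comm

/-- Linear maps on `Op (e × n)` are determined by their values on product operators. -/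
theorem ext_kronecker {V : Type*} [AddCommGroup V] [Module ℂ V] {S T : Op (e × n) →ₗ[ℂ] V}
    (h : ∀ (X : Op e) (Y : Op n), S (X ⊗ₖ Y) = T (X ⊗ₖ Y)) : S = T :=
  LinearMap.eqLocus_eq_top.1 (span_kronecker (LinearMap.eqLocus S T) h)

theorem partialTrace_envLindblad (H : Op e) (L : J → Op e) (X : Op (e × n)) :
    partialTrace (envLindblad n H L X) = 0 := by
  have : partialTraceMap ∘ₗ envLindblad n H L = 0 := ext_kronecker fun X Y => by
    simp [envLindblad_kronecker, partialTrace_kronecker, trace_lindblad]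
  exact LinearMap.congr_fun this X

/-- `S(X) = X - σ ⊗ Tr_A X`. -/
def centering (σ : Op e) : Op (e × n) →ₗ[ℂ] Op (e × n) :=
  LinearMap.id - kronLeft σ ∘ₗ partialTraceMap

theorem centering_apply (σ : Op e) (X : Op (e × n)) :
    centering σ X = X - σ ⊗ₖ partialTrace X := rfl

variable {H : Op e} {L : J → Op e} {σ : Op e}

/-- Linearity reduces the claim to product operators, where only the environment factor evolves. -/
theorem tendsto_opFlow_envLindblad (hr : Relaxing (lindbladMap H L) σ) (X : Op (e × n)) :
    Tendsto (fun t => opFlow (envLindblad n H L) t X) atTop (𝓝 (σ ⊗ₖ partialTrace X)) := by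
  let S : Submodule ℂ (Op (e × n)) :=
    { carrier := {X | Tendsto (fun t => opFlow (envLindblad n H L) t X) atTop
        (𝓝 ((kronLeft σ ∘ₗ partialTraceMap) X))}
      add_mem' := fun {X Y} hX hY => by
        simp only [Set.mem_ofPred_eq, map_add] at *
        exact hX.add hY
      zero_mem' := by
        simp only [Set.mem_ofPred_eq, map_zero]
        exact tendsto_const_nhds
      smul_mem' := fun a X hX => by
        simp only [Set.mem_ofPred_eq, map_smul] at *
        exact hX.const_smul a }
  have hS : S = ⊤ := span_kronecker S fun X Y => by
    change Tendsto _ _ _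
    simp only [opFlow_envLindblad, LinearMap.comp_apply, partialTraceMap_apply,
      partialTrace_kronecker, kronLeft_apply, Matrix.kronecker_smul]
    rw [← Matrix.smul_kronecker]
    have hc : Continuous fun X : Op e => X ⊗ₖ Y :=
      (LinearMap.toContinuousLinearMap (kronRight Y)).continuous
    exact (hc.tendsto _).comp (hr X)
  have : X ∈ S := hS ▸ Submodule.mem_top
  exact this

theorem opFlow_stationary (hst : lindblad H L σ = 0) (t : ℝ) (Y : Op n) :
    opFlow (envLindblad n H L) t (σ ⊗ₖ Y) = σ ⊗ₖ Y := by
  refine (opFlow_eq_of_hasDerivAt (envLindblad n H L) (g := fun _ => σ ⊗ₖ Y) (fun t => ?_) t).symm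
  rw [envLindblad_kronecker, hst, Matrix.zero_kronecker]
  exact hasDerivAt_const t _

theorem partialTrace_centering (hσ : σ.trace = 1) (X : Op (e × n)) :
    partialTrace (centering σ X) = 0 := by
  rw [← partialTraceMap_apply, centering_apply, map_sub, partialTraceMap_apply,
    partialTraceMap_apply, partialTrace_kronecker, hσ, one_smul, sub_self]

/-- `centering σ` is a projection that commutes with the generator and kills the partial trace, so
the flow tends to zero on its range. -/
theorem centering_exponential_decay (hσ : σ.trace = 1) (hst : lindblad H L σ = 0)
    (hr : Relaxing (lindbladMap H L) σ) :
    ∃ C γ : ℝ, 0 < γ ∧ ∀ t, 0 ≤ t → ∀ X : Op (e × n),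
      ‖opFlow (envLindblad n H L) t (centering σ X)‖ ≤ C * Real.exp (-γ * t) * ‖X‖ := by
  refine exists_exponential_decay_apply (E := Op (e × n)) (envLindblad n H L) (centering σ)
    (fun X => ?_) (fun X => ?_) (fun X => ?_)
  · rw [centering_apply σ (centering σ X), partialTrace_centering hσ, Matrix.kronecker_zero,
      sub_zero]
  · rw [centering_apply, centering_apply, partialTrace_envLindblad, Matrix.kronecker_zero,
      sub_zero, map_sub, envLindblad_kronecker, hst, Matrix.zero_kronecker, sub_zero]
  · have := tendsto_opFlow_envLindblad hr (centering σ X)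
    rwa [partialTrace_centering hσ, Matrix.kronecker_zero] at this

end Environment

/-! ### Linear functionals of operator integrals -/

section OpIntegral

variable {m : Type*} [Fintype m] [DecidableEq m]

theorem linear_eq_sum_entries (ℓ : Op m →ₗ[ℂ] ℂ) (X : Op m) :
    ℓ X = ∑ i, ∑ j, X i j * ℓ (Matrix.single i j 1) := by
  conv_lhs => rw [Matrix.matrix_eq_sum_single X]
  simp only [map_sum]
  refine Finset.sum_congr rfl fun a _ => Finset.sum_congr rfl fun b _ => ?_
  have : Matrix.single a b (X a b) = X a b • Matrix.single a b (1 : ℂ) := by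
    rw [Matrix.smul_single, smul_eq_mul, mul_one]
  rw [this, map_smul, smul_eq_mul]

variable {A : ℝ → Op m}

theorem integrableOn_linear
    (hA : ∀ i j, IntegrableOn (fun t => A t i j) (Set.Ioi (0 : ℝ))) (ℓ : Op m →ₗ[ℂ] ℂ) :
    IntegrableOn (fun t => ℓ (A t)) (Set.Ioi (0 : ℝ)) := by
  rw [funext fun t => linear_eq_sum_entries ℓ (A t)]
  exact integrable_finsetSum _ fun i _ => integrable_finsetSum _ fun j _ => (hA i j).mul_const _

theorem linear_opIntegralInfty
    (hA : ∀ i j, IntegrableOn (fun t => A t i j) (Set.Ioi (0 : ℝ))) (ℓ : Op m →ₗ[ℂ] ℂ) :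
    ℓ (opIntegralInfty A) = ∫ t in Set.Ioi (0 : ℝ), ℓ (A t) := by
  rw [funext fun t => linear_eq_sum_entries ℓ (A t), linear_eq_sum_entries ℓ (opIntegralInfty A)]
  rw [integral_finsetSum _ fun i _ => integrable_finsetSum _ fun j _ => (hA i j).mul_const _]
  refine Finset.sum_congr rfl fun i _ => ?_
  rw [integral_finsetSum _ fun j _ => (hA i j).mul_const _]
  refine Finset.sum_congr rfl fun j _ => ?_
  rw [integral_mul_const]
  rfl

end OpIntegral

/-! ### The Leibniz defect and its Duhamel integral -/

section Noise

attribute [local instance] Matrix.normedAddCommGroup Matrix.normedSpace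

variable {e n : Type*} [Fintype e] [DecidableEq e] [Fintype n] [DecidableEq n]
  {J : Type*} [Fintype J]

/-- `ρ ↦ XρY`. -/
def sandwich (X Y : Op n) : Op n →ₗ[ℂ] Op n := LinearMap.mulLeft ℂ X ∘ₗ LinearMap.mulRight ℂ Y

theorem sandwich_apply (X Y ρ : Op n) : sandwich X Y ρ = X * ρ * Y := (mul_assoc X ρ Y).symm

/-- `-i[K, ·]`. -/
def adMap (K : Op n) : Op n →ₗ[ℂ] Op n :=
  -(Complex.I • (LinearMap.mulLeft ℂ K - LinearMap.mulRight ℂ K))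

theorem adMap_apply (K X : Op n) : adMap K X = -(Complex.I • ⁅K, X⁆) := rfl

theorem adMap_mul (K X Y : Op n) : adMap K (X * Y) = adMap K X * Y + X * adMap K Y := by
  simp only [adMap_apply, Ring.lie_def, neg_mul, mul_neg, smul_mul_assoc, mul_smul_comm, ← neg_add,
    ← smul_add]
  congr 2
  noncomm_ring

theorem adMap_conjTranspose {K : Op n} (hK : K.IsHermitian) (X : Op n) :
    adMap K Xᴴ = (adMap K X)ᴴ := by
  simp only [adMap_apply, Ring.lie_def, Matrix.conjTranspose_neg, Matrix.conjTranspose_smul,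
    Matrix.conjTranspose_sub, Matrix.conjTranspose_mul, hK.eq, Complex.star_def, Complex.conj_I]
  rw [neg_smul, ← smul_neg, neg_sub, neg_neg]

theorem adMap_kronecker (K : Op n) (X : Op e) (Y : Op n) :
    adMap ((1 : Op e) ⊗ₖ K) (X ⊗ₖ Y) = X ⊗ₖ adMap K Y := by
  simp only [adMap_apply, Ring.lie_def, ← Matrix.mul_kronecker_mul, one_mul, mul_one]
  simp only [← kronLeft_apply, map_neg, map_smul, map_sub]

theorem adMap_envLindblad (H : Op e) (L : J → Op e) (K : Op n) (X : Op (e × n)) :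
    adMap ((1 : Op e) ⊗ₖ K) (envLindblad n H L X)
      = envLindblad n H L (adMap ((1 : Op e) ⊗ₖ K) X) := by
  have : adMap ((1 : Op e) ⊗ₖ K) ∘ₗ envLindblad n H L
      = envLindblad n H L ∘ₗ adMap ((1 : Op e) ⊗ₖ K) := ext_kronecker fun X Y => by
    simp [envLindblad_kronecker, adMap_kronecker]
  exact LinearMap.congr_fun this X

theorem adMap_centering (σ : Op e) (K : Op n) (X : Op (e × n)) :
    adMap ((1 : Op e) ⊗ₖ K) (centering σ X) = centering σ (adMap ((1 : Op e) ⊗ₖ K) X) := by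
  have : adMap ((1 : Op e) ⊗ₖ K) ∘ₗ centering σ
      = centering σ ∘ₗ adMap ((1 : Op e) ⊗ₖ K) := ext_kronecker fun X Y => by
    simp [centering_apply, adMap_kronecker, partialTrace_kronecker, Matrix.kronecker_smul]
  exact LinearMap.congr_fun this X

variable (L : J → Op e) (σ : Op e)

/-- `∑_μ [L_μ, X] σ [L_μ, Y]†`. -/
def noise (X Y : Op e) : Op e := ∑ s, ⁅L s, X⁆ * σ * (⁅L s, Y⁆)ᴴ

variable (f₀ f₁ : Op e) (B : Op n) (c : ℝ)

/-- `[L_μ, f₀] ⊗ B† + e^{2ict} [L_μ, f₁] ⊗ B`. -/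
def jump (s : J) (t : ℝ) : Op (e × n) :=
  ⁅L s, f₀⁆ ⊗ₖ Bᴴ + Complex.exp (2 * Complex.I * c * t) • (⁅L s, f₁⁆ ⊗ₖ B)

/-- `ρ ↦ ∑_μ W_μ(t) (σ ⊗ ρ) W_μ(t)†`, expanded. -/
def noiseMap (t : ℝ) : Op n →ₗ[ℂ] Op (e × n) :=
  kronLeft (noise L σ f₀ f₀) ∘ₗ sandwich Bᴴ B + kronLeft (noise L σ f₁ f₁) ∘ₗ sandwich B Bᴴ
    + Complex.exp (2 * Complex.I * c * t) • (kronLeft (noise L σ f₁ f₀) ∘ₗ sandwich B B)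
    + Complex.exp (-(2 * Complex.I * c * t)) • (kronLeft (noise L σ f₀ f₁) ∘ₗ sandwich Bᴴ Bᴴ)

theorem star_exp_phase (t : ℝ) : star (Complex.exp (2 * Complex.I * c * t))
    = Complex.exp (-(2 * Complex.I * c * t)) := by
  rw [Complex.star_def, ← Complex.exp_conj]
  congr 1
  simp [map_ofNat]

theorem exp_phase_mul (t : ℝ) : Complex.exp (2 * Complex.I * c * t)
    * Complex.exp (-(2 * Complex.I * c * t)) = 1 := by
  rw [← Complex.exp_add, add_neg_cancel, Complex.exp_zero]

theorem noiseMap_apply (t : ℝ) (ρ : Op n) : noiseMap L σ f₀ f₁ B c t ρ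
    = noise L σ f₀ f₀ ⊗ₖ (Bᴴ * ρ * B) + noise L σ f₁ f₁ ⊗ₖ (B * ρ * Bᴴ)
    + Complex.exp (2 * Complex.I * c * t) • (noise L σ f₁ f₀ ⊗ₖ (B * ρ * B))
    + Complex.exp (-(2 * Complex.I * c * t)) • (noise L σ f₀ f₁ ⊗ₖ (Bᴴ * ρ * Bᴴ)) := by
  simp [noiseMap, sandwich_apply]

/-- Complete positivity is read off this form; the time dependence and the partial trace are read
off the expanded one. -/
theorem noiseMap_eq_sum (t : ℝ) (ρ : Op n) : noiseMap L σ f₀ f₁ B c t ρ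
    = ∑ s, jump L f₀ f₁ B c s t * (σ ⊗ₖ ρ) * (jump L f₀ f₁ B c s t)ᴴ := by
  have hs : ∀ s, jump L f₀ f₁ B c s t * (σ ⊗ₖ ρ) * (jump L f₀ f₁ B c s t)ᴴ
      = kronRight (Bᴴ * ρ * B) (⁅L s, f₀⁆ * σ * (⁅L s, f₀⁆)ᴴ)
      + kronRight (B * ρ * Bᴴ) (⁅L s, f₁⁆ * σ * (⁅L s, f₁⁆)ᴴ)
      + Complex.exp (2 * Complex.I * c * t)
        • kronRight (B * ρ * B) (⁅L s, f₁⁆ * σ * (⁅L s, f₀⁆)ᴴ)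
      + Complex.exp (-(2 * Complex.I * c * t))
        • kronRight (Bᴴ * ρ * Bᴴ) (⁅L s, f₀⁆ * σ * (⁅L s, f₁⁆)ᴴ) := fun s => by
    simp only [jump, Matrix.conjTranspose_add, Matrix.conjTranspose_smul, star_exp_phase,
      Matrix.conjTranspose_kronecker, Matrix.conjTranspose_conjTranspose, add_mul, mul_add,
      smul_mul_assoc, mul_smul_comm, ← Matrix.mul_kronecker_mul, smul_add,
      smul_smul,
      mul_comm (Complex.exp (-(2 * Complex.I * c * t))), exp_phase_mul, one_smul, kronRight_apply]
    abel
  simp only [hs, Finset.sum_add_distrib, ← Finset.smul_sum, ← map_sum]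
  exact noiseMap_apply L σ f₀ f₁ B c t ρ

variable {L σ}

theorem isCP_noiseMap (hσ : σ.PosSemidef) (t : ℝ) : IsCP (noiseMap L σ f₀ f₁ B c t) := by
  have h : IsCP fun ρ : Op n => ∑ s, jump L f₀ f₁ B c s t * (σ ⊗ₖ ρ) * (jump L f₀ f₁ B c s t)ᴴ :=
    IsCP.sum _ fun s _ => (isCP_conj (jump L f₀ f₁ B c s t)).comp (isCP_kronecker hσ)
  have e : ⇑(noiseMap L σ f₀ f₁ B c t) = _ := funext fun ρ => noiseMap_eq_sum L σ f₀ f₁ B c t ρ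
  rw [e]
  exact h

theorem isCP_partialTrace : IsCP (partialTrace : Op (e × n) → Op n) := by
  refine isCP_of_kraus (fun a : e => Matrix.of fun (b : n) (x : e × n) =>
    if x = (a, b) then (1 : ℂ) else 0) fun X => ?_
  ext b b'
  simp [partialTrace, Matrix.sum_apply, Matrix.mul_apply]

variable {HB : Op n} (hB : ⁅HB, Bᴴ⁆ = (c : ℂ) • Bᴴ) (hHB : HB.IsHermitian)

theorem adMap_Bdag {HB B : Op n} {c : ℝ} (hB : ⁅HB, Bᴴ⁆ = (c : ℂ) • Bᴴ) :
    adMap HB Bᴴ = -(Complex.I * c) • Bᴴ := by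
  rw [adMap_apply, hB, smul_smul, neg_smul]

theorem adMap_B {HB B : Op n} {c : ℝ} (hHB : HB.IsHermitian) (hB : ⁅HB, Bᴴ⁆ = (c : ℂ) • Bᴴ) :
    adMap HB B = (Complex.I * c) • B := by
  have h := adMap_conjTranspose hHB Bᴴ
  rw [Matrix.conjTranspose_conjTranspose, adMap_Bdag hB, Matrix.conjTranspose_smul,
    Matrix.conjTranspose_conjTranspose] at h
  rw [h]
  simp

theorem adMap_sandwich (K X Y ρ : Op n) {x y : ℂ} (hX : adMap K X = x • X)
    (hY : adMap K Y = y • Y) :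
    adMap K (X * ρ * Y) = (x + y) • (X * ρ * Y) + X * adMap K ρ * Y := by
  rw [adMap_mul, adMap_mul, hX, hY, add_mul, smul_mul_assoc, smul_mul_assoc, mul_smul_comm, add_smul]
  abel

theorem hasDerivAt_exp_mul (z : ℂ) (t : ℝ) :
    HasDerivAt (fun t : ℝ => Complex.exp (z * t)) (Complex.exp (z * t) * z) t := by
  have h1 : HasDerivAt (fun t : ℝ => z * (t : ℂ)) z t := by
    simpa using (Complex.ofRealCLM.hasDerivAt (x := t)).const_mul z
  exact h1.cexp

/-- The phase `e^{2ict}` is chosen for this: `B†ρB` and `BρB†` carry no frequency, `BρB` carries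
`2ic` and `B†ρB†` carries `-2ic`. Moving in `t` thus amounts to conjugating the map by the target's
rotation. -/
theorem hasDerivAt_noiseMap (hHB : HB.IsHermitian) (hB : ⁅HB, Bᴴ⁆ = (c : ℂ) • Bᴴ) (ρ : Op n)
    (t : ℝ) :
    HasDerivAt (fun t => noiseMap L σ f₀ f₁ B c t ρ)
      (adMap ((1 : Op e) ⊗ₖ HB) (noiseMap L σ f₀ f₁ B c t ρ)
        - noiseMap L σ f₀ f₁ B c t (adMap HB ρ)) t := by
  have h0 := adMap_Bdag hB
  have h1 := adMap_B hHB hB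
  have e1 := hasDerivAt_exp_mul (2 * Complex.I * c) t
  have e2 := hasDerivAt_exp_mul (-(2 * Complex.I * c)) t
  simp only [neg_mul (2 * Complex.I * (c : ℂ))] at e2
  have hd := ((hasDerivAt_const t (noise L σ f₀ f₀ ⊗ₖ (Bᴴ * ρ * B) + noise L σ f₁ f₁ ⊗ₖ (B * ρ * Bᴴ))).add
    (e1.smul_const (noise L σ f₁ f₀ ⊗ₖ (B * ρ * B)))).add
    (e2.smul_const (noise L σ f₀ f₁ ⊗ₖ (Bᴴ * ρ * Bᴴ)))
  have hf : (fun t => noiseMap L σ f₀ f₁ B c t ρ) = _ :=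
    funext fun t => noiseMap_apply L σ f₀ f₁ B c t ρ
  rw [hf]
  convert! hd using 1
  rw [noiseMap_apply, noiseMap_apply]
  simp only [map_add, map_smul, adMap_kronecker, adMap_sandwich _ _ _ _ h0 h1,
    adMap_sandwich _ _ _ _ h1 h0, adMap_sandwich _ _ _ _ h0 h0, adMap_sandwich _ _ _ _ h1 h1,
    Matrix.kronecker_add, Matrix.kronecker_smul]
  module

/-- The first integrand of the quadratic correction. -/
def noiseFlow (H : Op e) (L : J → Op e) (σ f₀ f₁ : Op e) (B : Op n) (c t : ℝ) :
    Op n →ₗ[ℂ] Op (e × n) :=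
  (opFlow (envLindblad n H L) t).toLinearMap ∘ₗ centering σ ∘ₗ noiseMap L σ f₀ f₁ B c t

theorem noiseFlow_apply (H : Op e) (t : ℝ) (ρ : Op n) : noiseFlow H L σ f₀ f₁ B c t ρ
    = opFlow (envLindblad n H L) t (centering σ (noiseMap L σ f₀ f₁ B c t ρ)) := rfl

variable {H : Op e}

/-- The commutator with `1 ⊗ HB` commutes with the environment generator and with centering. The
derivative is therefore the operator of the invariance equation applied to the integrand itself. -/
theorem hasDerivAt_noiseFlow (hHB : HB.IsHermitian) (hB : ⁅HB, Bᴴ⁆ = (c : ℂ) • Bᴴ) (ρ : Op n)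
    (t : ℝ) :
    HasDerivAt (fun t => noiseFlow H L σ f₀ f₁ B c t ρ)
      (envLindblad n H L (noiseFlow H L σ f₀ f₁ B c t ρ)
        + adMap ((1 : Op e) ⊗ₖ HB) (noiseFlow H L σ f₀ f₁ B c t ρ)
        - noiseFlow H L σ f₀ f₁ B c t (adMap HB ρ)) t := by
  have h1 := hasDerivAt_noiseMap (L := L) (σ := σ) f₀ f₁ B c hHB hB ρ t
  have h2 : HasDerivAt (fun t => centering σ (noiseMap L σ f₀ f₁ B c t ρ)) (centering σ
      (adMap ((1 : Op e) ⊗ₖ HB) (noiseMap L σ f₀ f₁ B c t ρ)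
        - noiseMap L σ f₀ f₁ B c t (adMap HB ρ))) t := by
    have h := ((LinearMap.toContinuousLinearMap (centering σ)).restrictScalars ℝ).hasFDerivAt
      (x := noiseMap L σ f₀ f₁ B c t ρ) |>.comp_hasDerivAt t h1
    exact h
  have h3 := hasDerivAt_opFlow_apply (envLindblad n H L) t h2
  convert! h3 using 1
  rw [map_sub, map_sub, ← adMap_centering,
    ← map_opFlow _ _ _ (fun X => adMap_envLindblad H L HB X) t, add_sub_assoc]
  rfl

/-- The relaxation data of the environment. -/
structure SteadyEnv (H : Op e) (L : J → Op e) (σ : Op e) : Prop where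
  herm : H.IsHermitian
  density : IsDensity σ
  stationary : lindblad H L σ = 0
  relaxing : Relaxing (lindbladMap H L) σ

theorem norm_noiseMap_le (t : ℝ) (ρ : Op n) : ‖noiseMap L σ f₀ f₁ B c t ρ‖
    ≤ ‖noise L σ f₀ f₀ ⊗ₖ (Bᴴ * ρ * B)‖ + ‖noise L σ f₁ f₁ ⊗ₖ (B * ρ * Bᴴ)‖
      + ‖noise L σ f₁ f₀ ⊗ₖ (B * ρ * B)‖ + ‖noise L σ f₀ f₁ ⊗ₖ (Bᴴ * ρ * Bᴴ)‖ := by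
  have hn1 : ‖Complex.exp (2 * Complex.I * c * t)‖ = 1 := by
    rw [Complex.norm_exp]; simp
  have hn2 : ‖Complex.exp (-(2 * Complex.I * c * t))‖ = 1 := by
    rw [Complex.norm_exp]; simp
  rw [noiseMap_apply]
  refine (norm_add_le _ _).trans (add_le_add ((norm_add_le _ _).trans (add_le_add
    (norm_add_le _ _) ?_)) ?_)
  · rw [norm_smul, hn1, one_mul]
  · rw [norm_smul, hn2, one_mul]

theorem exists_noiseFlow_bound (hE : SteadyEnv H L σ) (ρ : Op n) : ∃ C γ : ℝ, 0 < γ ∧ ∀ t, 0 ≤ t →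
    ∀ i j, ‖noiseFlow H L σ f₀ f₁ B c t ρ i j‖ ≤ C * Real.exp (-γ * t) := by
  obtain ⟨C, γ, hγ, h⟩ := centering_exponential_decay (n := n) hE.density.2 hE.stationary
    hE.relaxing
  refine ⟨|C| * (‖noise L σ f₀ f₀ ⊗ₖ (Bᴴ * ρ * B)‖ + ‖noise L σ f₁ f₁ ⊗ₖ (B * ρ * Bᴴ)‖
      + ‖noise L σ f₁ f₀ ⊗ₖ (B * ρ * B)‖ + ‖noise L σ f₀ f₁ ⊗ₖ (Bᴴ * ρ * Bᴴ)‖), γ, hγ,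
    fun t ht i j => ?_⟩
  refine (Matrix.norm_entry_le_entrywise_sup_norm _).trans ((h t ht _).trans ?_)
  have := norm_noiseMap_le (L := L) (σ := σ) f₀ f₁ B c t ρ
  exact (mul_le_mul (mul_le_mul_of_nonneg_right (le_abs_self C) (Real.exp_nonneg _)) this
    (norm_nonneg _) (by positivity)).trans (le_of_eq (by ring))

theorem integrableOn_noiseFlow (hE : SteadyEnv H L σ) (hHB : HB.IsHermitian)
    (hB : ⁅HB, Bᴴ⁆ = (c : ℂ) • Bᴴ) (ρ : Op n) (i j : e × n) :
    IntegrableOn (fun t => noiseFlow H L σ f₀ f₁ B c t ρ i j) (Set.Ioi (0 : ℝ)) := by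
  obtain ⟨C, γ, hγ, h⟩ := exists_noiseFlow_bound f₀ f₁ B c hE ρ
  have hcont : Continuous fun t => noiseFlow H L σ f₀ f₁ B c t ρ i j :=
    continuous_iff_continuousAt.2 fun t =>
      (hasDerivAt_pi.1 (hasDerivAt_pi.1 (hasDerivAt_noiseFlow f₀ f₁ B c hHB hB ρ t) i) j).continuousAt
  refine Integrable.mono' ((integrableOn_exp_mul_Ioi (neg_lt_zero.2 hγ) 0).const_mul C)
    hcont.aestronglyMeasurable ?_
  exact (ae_restrict_iff' measurableSet_Ioi).2 (Eventually.of_forall fun t ht =>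
    h t (le_of_lt ht) i j)

theorem tendsto_noiseFlow (hE : SteadyEnv H L σ) (ρ : Op n) (i j : e × n) :
    Tendsto (fun t => noiseFlow H L σ f₀ f₁ B c t ρ i j) atTop (𝓝 0) := by
  obtain ⟨C, γ, hγ, h⟩ := exists_noiseFlow_bound f₀ f₁ B c hE ρ
  have hlim : Tendsto (fun t => C * Real.exp (-γ * t)) atTop (𝓝 0) := by
    have h1 : Tendsto (fun t : ℝ => -γ * t) atTop atBot :=
      tendsto_id.const_mul_atTop_of_neg (neg_lt_zero.2 hγ)
    simpa using (Real.tendsto_exp_atBot.comp h1).const_mul C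
  refine squeeze_zero_norm' ?_ hlim
  filter_upwards [eventually_ge_atTop 0] with t ht using h t ht i j

/-- The improper integral in the quadratic correction. -/
def noiseIntegral (H : Op e) (L : J → Op e) (σ f₀ f₁ : Op e) (B : Op n) (c : ℝ) (ρ : Op n) :
    Op (e × n) := opIntegralInfty fun t => noiseFlow H L σ f₀ f₁ B c t ρ

/-- `noiseIntegral` as a linear map. -/
def noiseIntegralMap (hE : SteadyEnv H L σ) (hHB : HB.IsHermitian)
    (hB : ⁅HB, Bᴴ⁆ = (c : ℂ) • Bᴴ) : Op n →ₗ[ℂ] Op (e × n) where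
  toFun := noiseIntegral H L σ f₀ f₁ B c
  map_add' X Y := by
    ext i j
    have h := integrableOn_noiseFlow f₀ f₁ B c hE hHB hB
    change (∫ t in Set.Ioi (0 : ℝ), noiseFlow H L σ f₀ f₁ B c t (X + Y) i j)
      = (∫ t in Set.Ioi (0 : ℝ), noiseFlow H L σ f₀ f₁ B c t X i j)
        + ∫ t in Set.Ioi (0 : ℝ), noiseFlow H L σ f₀ f₁ B c t Y i j
    rw [← integral_add (h X i j) (h Y i j)]
    simp only [map_add, Matrix.add_apply]
  map_smul' z X := by
    ext i j
    change (∫ t in Set.Ioi (0 : ℝ), noiseFlow H L σ f₀ f₁ B c t (z • X) i j)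
      = z * ∫ t in Set.Ioi (0 : ℝ), noiseFlow H L σ f₀ f₁ B c t X i j
    rw [← integral_const_mul]
    simp only [map_smul, Matrix.smul_apply, smul_eq_mul]

/-- The fundamental theorem of calculus on `[0, ∞)`: the left side integrates the derivative of
`noiseFlow`, which decays at infinity and starts at the centered noise. -/
theorem noiseIntegral_balance (hE : SteadyEnv H L σ) (hHB : HB.IsHermitian)
    (hB : ⁅HB, Bᴴ⁆ = (c : ℂ) • Bᴴ) (ρ : Op n) :
    envLindblad n H L (noiseIntegral H L σ f₀ f₁ B c ρ)
      + adMap ((1 : Op e) ⊗ₖ HB) (noiseIntegral H L σ f₀ f₁ B c ρ)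
      - noiseIntegral H L σ f₀ f₁ B c (adMap HB ρ)
      = -centering σ (noiseMap L σ f₀ f₁ B c 0 ρ) := by
  ext i j
  have h := integrableOn_noiseFlow f₀ f₁ B c hE hHB hB
  let ℓ : (Op (e × n) →ₗ[ℂ] Op (e × n)) → Op (e × n) →ₗ[ℂ] ℂ := fun T =>
    Matrix.entryLinearMap ℂ ℂ i j ∘ₗ T
  have h1 := linear_opIntegralInfty (h ρ) (ℓ (envLindblad n H L))
  have h2 := linear_opIntegralInfty (h ρ) (ℓ (adMap ((1 : Op e) ⊗ₖ HB)))
  have i1 := integrableOn_linear (h ρ) (ℓ (envLindblad n H L))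
  have i2 := integrableOn_linear (h ρ) (ℓ (adMap ((1 : Op e) ⊗ₖ HB)))
  have h3 : noiseIntegral H L σ f₀ f₁ B c (adMap HB ρ) i j
      = ∫ t in Set.Ioi (0 : ℝ), noiseFlow H L σ f₀ f₁ B c t (adMap HB ρ) i j := rfl
  have hftc := integral_Ioi_of_hasDerivAt_of_tendsto' (a := (0 : ℝ))
    (f := fun t => noiseFlow H L σ f₀ f₁ B c t ρ i j) (m := (0 : ℂ))
    (fun t _ => hasDerivAt_pi.1 (hasDerivAt_pi.1 (hasDerivAt_noiseFlow f₀ f₁ B c hHB hB ρ t) i) j)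
    ((i1.add i2).sub (h (adMap HB ρ) i j)) (tendsto_noiseFlow f₀ f₁ B c hE ρ i j)
  have hsplit := integral_sub (i1.add i2) (h (adMap HB ρ) i j)
  have hsplit2 := integral_add i1 i2
  have h0 : noiseFlow H L σ f₀ f₁ B c 0 ρ = centering σ (noiseMap L σ f₀ f₁ B c 0 ρ) := by
    rw [noiseFlow_apply, opFlow_zero]
  rw [Matrix.sub_apply, Matrix.add_apply, Matrix.neg_apply, ← h0, ← zero_sub, ← hftc, h3]
  refine Eq.trans ?_ hsplit.symm
  congr 1
  refine Eq.trans ?_ hsplit2.symm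
  rw [← h1, ← h2]
  rfl

theorem trace_centering (hσ : σ.trace = 1) (X : Op (e × n)) : (centering σ X).trace = 0 := by
  rw [← trace_partialTrace, partialTrace_centering hσ, Matrix.trace_zero]

theorem trace_noiseIntegral (hE : SteadyEnv H L σ) (hHB : HB.IsHermitian)
    (hB : ⁅HB, Bᴴ⁆ = (c : ℂ) • Bᴴ) (ρ : Op n) : (noiseIntegral H L σ f₀ f₁ B c ρ).trace = 0 := by
  have h := linear_opIntegralInfty (integrableOn_noiseFlow f₀ f₁ B c hE hHB hB ρ)
    (Matrix.traceLinearMap (e × n) ℂ ℂ)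
  refine h.trans ?_
  have h0 : ∀ t, (noiseFlow H L σ f₀ f₁ B c t ρ).trace = 0 := fun t => by
    rw [noiseFlow_apply, trace_opFlow (fun X => trace_lindblad _ _ X), trace_centering hE.density.2]
  simp [h0]

end Noise

/-! ### Choice of the averaging time -/

section QuadraticPositivity

attribute [local instance] Matrix.normedAddCommGroup Matrix.normedSpace

variable {e n : Type*} [Fintype e] [DecidableEq e] [Fintype n] [DecidableEq n]
  {J : Type*} [Fintype J]

theorem posSemidef_noise {L : J → Op e} {σ : Op e} (hσ : σ.PosSemidef) (X : Op e) :
    (noise L σ X X).PosSemidef :=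
  Matrix.posSemidef_sum _ fun _ _ => hσ.mul_mul_conjTranspose_same _

theorem conjTranspose_noise {L : J → Op e} {σ : Op e} (hσ : σ.IsHermitian) (X Y : Op e) :
    (noise L σ X Y)ᴴ = noise L σ Y X := by
  simp only [noise, Matrix.conjTranspose_sum, Matrix.conjTranspose_mul,
    Matrix.conjTranspose_conjTranspose, hσ.eq, Matrix.mul_assoc]

/-- The diagonal part of `Tr_A` of the noise map. -/
def meanNoise (L : J → Op e) (σ f₀ f₁ : Op e) (B : Op n) : Op n →ₗ[ℂ] Op n :=
  (noise L σ f₀ f₀).trace • sandwich Bᴴ B + (noise L σ f₁ f₁).trace • sandwich B Bᴴ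

theorem meanNoise_apply (L : J → Op e) (σ f₀ f₁ : Op e) (B ρ : Op n) :
    meanNoise L σ f₀ f₁ B ρ = (noise L σ f₀ f₀).trace • (Bᴴ * ρ * B)
      + (noise L σ f₁ f₁).trace • (B * ρ * Bᴴ) := by
  simp [meanNoise, sandwich_apply]

theorem partialTrace_noiseMap (L : J → Op e) (σ f₀ f₁ : Op e) (B : Op n) (c t : ℝ) (ρ : Op n) :
    partialTrace (noiseMap L σ f₀ f₁ B c t ρ) = meanNoise L σ f₀ f₁ B ρ
      + Complex.exp (2 * Complex.I * c * t) • ((noise L σ f₁ f₀).trace • (B * ρ * B))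
      + Complex.exp (-(2 * Complex.I * c * t)) • ((noise L σ f₀ f₁).trace • (Bᴴ * ρ * Bᴴ)) := by
  rw [noiseMap_apply, meanNoise_apply, ← partialTraceMap_apply]
  simp only [map_add, map_smul, partialTraceMap_apply, partialTrace_kronecker]

/-- The oscillating terms cancel between times that differ by half a period. -/
theorem partialTrace_noiseMap_add (L : J → Op e) (σ f₀ f₁ : Op e) (B : Op n) {c : ℝ} (hc : c ≠ 0)
    (t : ℝ) (ρ : Op n) :
    partialTrace (noiseMap L σ f₀ f₁ B c t ρ)
      + partialTrace (noiseMap L σ f₀ f₁ B c (t + Real.pi / (2 * c)) ρ)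
      = (2 : ℂ) • meanNoise L σ f₀ f₁ B ρ := by
  have hcC : (c : ℂ) ≠ 0 := by exact_mod_cast hc
  have e0 : 2 * Complex.I * c * ((t + Real.pi / (2 * c) : ℝ) : ℂ)
      = 2 * Complex.I * c * t + Real.pi * Complex.I := by
    push_cast; field_simp
  have e1 : Complex.exp (2 * Complex.I * c * ((t + Real.pi / (2 * c) : ℝ) : ℂ))
      = -Complex.exp (2 * Complex.I * c * t) := by
    rw [e0, Complex.exp_add, Complex.exp_pi_mul_I, mul_neg_one]
  have e2 : Complex.exp (-(2 * Complex.I * c * ((t + Real.pi / (2 * c) : ℝ) : ℂ)))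
      = -Complex.exp (-(2 * Complex.I * c * t)) := by
    rw [Complex.exp_neg, e1, inv_neg, ← Complex.exp_neg]
  rw [partialTrace_noiseMap, partialTrace_noiseMap, e1, e2]
  module

variable {H : Op e} {L : J → Op e} {σ : Op e}

theorem isCP_meanNoise (hσ : σ.PosSemidef) (f₀ f₁ : Op e) (B : Op n) :
    IsCP (meanNoise L σ f₀ f₁ B) := by
  have h : ∀ X : Op e, ((noise L σ X X).trace.re : ℂ) = (noise L σ X X).trace := fun X =>
    Complex.ext rfl ((Complex.le_def.1 (posSemidef_noise hσ X).trace_nonneg).2)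
  have h0 : ∀ X : Op e, 0 ≤ (noise L σ X X).trace.re := fun X =>
    (Complex.le_def.1 (posSemidef_noise hσ X).trace_nonneg).1
  have h1 := ((isCP_conj Bᴴ).smul (h0 f₀)).add ((isCP_conj B).smul (h0 f₁))
  simp only [h, Matrix.conjTranspose_conjTranspose] at h1
  have e : ⇑(meanNoise L σ f₀ f₁ B) = _ := funext fun ρ => meanNoise_apply L σ f₀ f₁ B ρ
  rw [e]
  exact h1

theorem choi_add {m p : Type*} [Fintype m] [DecidableEq m] (Φ Ψ : Op m → Op p) :
    choi (fun X => Φ X + Ψ X) = choi Φ + choi Ψ := rfl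

theorem choi_sub {m p : Type*} [Fintype m] [DecidableEq m] (Φ Ψ : Op m → Op p) :
    choi (fun X => Φ X - Ψ X) = choi Φ - choi Ψ := rfl

theorem choi_smul {m p : Type*} [Fintype m] [DecidableEq m] (z : ℂ) (Φ : Op m → Op p) :
    choi (fun X => z • Φ X) = z • choi Φ := rfl

/-- For a suitable averaging time, the improper integral and the mean noise together form a
completely positive map. -/
theorem exists_isCP_noise (f₀ f₁ : Op e) (B : Op n) {c : ℝ} (hc : c ≠ 0) {HB : Op n}
    (hE : SteadyEnv H L σ) (hHB : HB.IsHermitian) (hB : ⁅HB, Bᴴ⁆ = (c : ℂ) • Bᴴ) :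
    ∃ τ : ℝ, 0 < τ ∧ IsCP fun ρ => noiseIntegral H L σ f₀ f₁ B c ρ
      + (τ : ℂ) • (σ ⊗ₖ meanNoise L σ f₀ f₁ B ρ) := by
  let A : ℝ → Op ((e × n) × n) := fun t => choi (noiseFlow H L σ f₀ f₁ B c t)
  let C : ℝ → Op ((e × n) × n) := fun t =>
    choi fun ρ : Op n => opFlow (envLindblad n H L) t (noiseMap L σ f₀ f₁ B c t ρ)
  let D : ℝ → Op ((e × n) × n) := fun t =>
    choi fun ρ : Op n => σ ⊗ₖ partialTrace (noiseMap L σ f₀ f₁ B c t ρ)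
  let X : Op ((e × n) × n) := choi (noiseIntegral H L σ f₀ f₁ B c)
  let Y : Op ((e × n) × n) := choi fun ρ : Op n => σ ⊗ₖ meanNoise L σ f₀ f₁ B ρ
  have hAint : ∀ x y, IntegrableOn (fun t => A t x y) (Set.Ioi (0 : ℝ)) := fun x y =>
    integrableOn_noiseFlow f₀ f₁ B c hE hHB hB _ _ _
  have hXA : X = opIntegralInfty A := rfl
  -- The flow fixes `σ ⊗ Y`, so the integrand is a difference of two completely positive maps, and
  -- only `-D t` threatens positivity.
  have hACD : ∀ t, A t = C t - D t := fun t => by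
    have : ⇑(noiseFlow H L σ f₀ f₁ B c t) = fun ρ =>
        opFlow (envLindblad n H L) t (noiseMap L σ f₀ f₁ B c t ρ)
          - σ ⊗ₖ partialTrace (noiseMap L σ f₀ f₁ B c t ρ) := funext fun ρ => by
      rw [noiseFlow_apply, centering_apply, map_sub, opFlow_stationary hE.stationary]
    simp only [A, this]
    exact choi_sub _ _
  have hHn : (H ⊗ₖ (1 : Op n)).IsHermitian := by
    rw [Matrix.IsHermitian, Matrix.conjTranspose_kronecker, hE.herm.eq, Matrix.conjTranspose_one]
  have hC : ∀ t, 0 ≤ t → (C t).PosSemidef := fun t ht =>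
    ((isCP_opFlow hHn _ ht).comp (isCP_noiseMap f₀ f₁ B c hE.density.1 t)).posSemidef_choi
  have hD : ∀ t, (D t).PosSemidef := fun t =>
    ((isCP_kronecker hE.density.1).comp
      (isCP_partialTrace.comp (isCP_noiseMap f₀ f₁ B c hE.density.1 t))).posSemidef_choi
  have hY : Y.PosSemidef :=
    ((isCP_kronecker hE.density.1).comp (isCP_meanNoise hE.density.1 f₀ f₁ B)).posSemidef_choi
  have hDY : ∀ t, D t + D (t + Real.pi / (2 * c)) = (2 : ℂ) • Y := fun t => by
    have : ∀ ρ : Op n, σ ⊗ₖ partialTrace (noiseMap L σ f₀ f₁ B c t ρ)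
        + σ ⊗ₖ partialTrace (noiseMap L σ f₀ f₁ B c (t + Real.pi / (2 * c)) ρ)
        = (2 : ℂ) • (σ ⊗ₖ meanNoise L σ f₀ f₁ B ρ) := fun ρ => by
      rw [← Matrix.kronecker_add, partialTrace_noiseMap_add L σ f₀ f₁ B hc, Matrix.kronecker_smul]
    simp only [D, Y]
    rw [← choi_add, ← choi_smul, funext this]
  -- Two positive matrices with sum `2Y` both vanish on the kernel of `Y`; on that kernel the
  -- integrand is the positive `C t`.
  have hDv : ∀ v, Y *ᵥ v = 0 → ∀ t, D t *ᵥ v = 0 := fun v hv t => by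
    refine posSemidef_mulVec_eq_zero (hD t) ?_
    have h0 : star v ⬝ᵥ (D t *ᵥ v) + star v ⬝ᵥ (D (t + Real.pi / (2 * c)) *ᵥ v) = 0 := by
      rw [← dotProduct_add, ← Matrix.add_mulVec, hDY, Matrix.smul_mulVec, hv, smul_zero,
        dotProduct_zero]
    exact le_antisymm (h0 ▸ le_add_of_nonneg_right ((hD _).dotProduct_mulVec_nonneg v))
      ((hD t).dotProduct_mulVec_nonneg v)
  have hXH : X.IsHermitian := by
    ext x y
    rw [Matrix.conjTranspose_apply, hXA]
    change star (∫ t in Set.Ioi (0 : ℝ), A t y x) = ∫ t in Set.Ioi (0 : ℝ), A t x y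
    rw [Complex.star_def, ← integral_conj]
    refine setIntegral_congr_fun measurableSet_Ioi fun t ht => ?_
    have h1 : (A t).IsHermitian := by
      rw [hACD]
      exact (hC t (le_of_lt ht)).isHermitian.sub (hD t).isHermitian
    exact h1.apply x y
  have hAv : ∀ v, Y *ᵥ v = 0 → ∀ t, A t *ᵥ v = C t *ᵥ v := fun v hv t => by
    rw [hACD, Matrix.sub_mulVec, hDv v hv, sub_zero]
  let ℓ : ((e × n) × n → ℂ) → Op ((e × n) × n) →ₗ[ℂ] ℂ := fun v =>
    { toFun := fun Z => star v ⬝ᵥ (Z *ᵥ v)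
      map_add' := fun Z Z' => by rw [Matrix.add_mulVec, dotProduct_add]
      map_smul' := fun z Z => by rw [Matrix.smul_mulVec, dotProduct_smul]; rfl }
  have hform : ∀ v, star v ⬝ᵥ (X *ᵥ v) = ∫ t in Set.Ioi (0 : ℝ), star v ⬝ᵥ (A t *ᵥ v) := fun v =>
    linear_opIntegralInfty hAint (ℓ v)
  have hformi : ∀ v, IntegrableOn (fun t => star v ⬝ᵥ (A t *ᵥ v)) (Set.Ioi (0 : ℝ)) := fun v =>
    integrableOn_linear hAint (ℓ v)
  have hre : ∀ v, (star v ⬝ᵥ (X *ᵥ v)).re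
      = ∫ t in Set.Ioi (0 : ℝ), (star v ⬝ᵥ (A t *ᵥ v)).re := fun v => by
    rw [hform]
    exact (integral_re (hformi v)).symm
  have hnonneg : ∀ v, Y *ᵥ v = 0 → ∀ t ∈ Set.Ioi (0 : ℝ), 0 ≤ (star v ⬝ᵥ (A t *ᵥ v)).re :=
    fun v hv t ht => by
      rw [hAv v hv]
      exact (Complex.le_def.1 ((hC t (le_of_lt ht)).dotProduct_mulVec_nonneg v)).1
  obtain ⟨τ, hτ, hpos⟩ := exists_posSemidef_add_smul hXH hY
    (fun v hv => by
      rw [hre]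
      exact setIntegral_nonneg measurableSet_Ioi (hnonneg v hv))
    (fun v hv h0 => by
      rw [hre] at h0
      have hae := (setIntegral_eq_zero_iff_of_nonneg_ae
        ((ae_restrict_iff' measurableSet_Ioi).2 (Eventually.of_forall (hnonneg v hv)))
        (hformi v).re).1 h0
      -- A nonnegative integrand with zero integral vanishes almost everywhere, and an isotropic
      -- vector of `C t ≥ 0` lies in its kernel.
      have hae2 : ∀ᵐ t ∂(volume.restrict (Set.Ioi (0 : ℝ))), A t *ᵥ v = 0 := by
        have hmem : ∀ᵐ t ∂(volume.restrict (Set.Ioi (0 : ℝ))), t ∈ Set.Ioi (0 : ℝ) :=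
          ae_restrict_mem measurableSet_Ioi
        filter_upwards [hae, hmem] with t h1 ht
        rw [hAv v hv]
        refine posSemidef_mulVec_eq_zero (hC t (le_of_lt ht)) ?_
        rw [← hAv v hv]
        refine Complex.ext h1 ?_
        rw [hAv v hv]
        exact quadForm_im (hC t (le_of_lt ht)).isHermitian v
      funext x
      let ℓ' : Op ((e × n) × n) →ₗ[ℂ] ℂ :=
        { toFun := fun Z => (Z *ᵥ v) x
          map_add' := fun Z Z' => by rw [Matrix.add_mulVec]; rfl
          map_smul' := fun z Z => by rw [Matrix.smul_mulVec]; rfl }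
      have h2 : (X *ᵥ v) x = ∫ t in Set.Ioi (0 : ℝ), (A t *ᵥ v) x :=
        linear_opIntegralInfty hAint ℓ'
      rw [h2]
      refine integral_eq_zero_of_ae ?_
      filter_upwards [hae2] with t ht
      rw [ht]
      rfl)
  refine ⟨τ, hτ, ?_⟩
  exact isCP_of_posSemidef_choi (noiseIntegralMap f₀ f₁ B c hE hHB hB
    + (τ : ℂ) • (kronLeft σ ∘ₗ meanNoise L σ f₀ f₁ B)) hpos

end QuadraticPositivity

/-! ### Corrector equations and second-order invariance for one environment -/

section Correctors

variable {e n : Type*} [Fintype e] [DecidableEq e] [Fintype n] [DecidableEq n]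
  {J : Type*} [Fintype J]

/-- The first-order equations for a single environment. -/
structure FirstCorrector (H : Op e) (L : J → Op e) (σ a f₀ f₁ : Op e) (c : ℝ) : Prop where
  eq₀ : lindblad H L (f₀ * σ) = -(a * σ) + (Complex.I * c) • (f₀ * σ)
  eq₁ : lindblad H L (f₁ * σ) = -(aᴴ * σ) - (Complex.I * c) • (f₁ * σ)

/-- The second-order equations for a single environment. -/
structure SecondCorrector (H : Op e) (L : J → Op e) (σ a f₀ f₁ : Op e) (c : ℝ)
    (u₀₀ u₀₁ u₁₀ u₁₁ : Op e) : Prop where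
  eq₀₀ : lindblad H L (u₀₀ * σ) = aᴴ * f₀ * σ - (aᴴ * f₀ * σ).trace • σ
  eq₁₁ : lindblad H L (u₁₁ * σ) = a * f₁ * σ - (a * f₁ * σ).trace • σ
  eq₀₁ : lindblad H L (u₀₁ * σ) = aᴴ * f₁ * σ - (2 * Complex.I * c) • (u₀₁ * σ)
  eq₁₀ : lindblad H L (u₁₀ * σ) = a * f₀ * σ + (2 * Complex.I * c) • (u₁₀ * σ)

variable {H : Op e} {L : J → Op e} {σ a f₀ f₁ u₀₀ u₀₁ u₁₀ u₁₁ : Op e} {c : ℝ} {HB B : Op n}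

theorem lindblad_herm_mul (hE : SteadyEnv H L σ) (X : Op e) :
    lindblad H L (σ * Xᴴ) = (lindblad H L (X * σ))ᴴ := by
  rw [← lindblad_conjTranspose hE.herm, Matrix.conjTranspose_mul, hE.density.1.isHermitian.eq]

theorem FirstCorrector.adj₀ (h : FirstCorrector H L σ a f₀ f₁ c) (hE : SteadyEnv H L σ) :
    lindblad H L (σ * f₀ᴴ) = -(σ * aᴴ) - (Complex.I * c) • (σ * f₀ᴴ) := by
  rw [lindblad_herm_mul hE, h.eq₀]
  simp [hE.density.1.isHermitian.eq, sub_eq_add_neg]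

theorem FirstCorrector.adj₁ (h : FirstCorrector H L σ a f₀ f₁ c) (hE : SteadyEnv H L σ) :
    lindblad H L (σ * f₁ᴴ) = -(σ * a) + (Complex.I * c) • (σ * f₁ᴴ) := by
  rw [lindblad_herm_mul hE, h.eq₁]
  simp [hE.density.1.isHermitian.eq, sub_eq_add_neg]

/-- The Leibniz defect at the stationary state. Its trace is fixed by the first-order equations,
which ties the noise strengths to the correlations of `a` with `f₀`, `f₁`. -/
theorem noise_eq (hE : SteadyEnv H L σ) (X Y : Op e) : noise L σ X Y
    = lindblad H L (X * σ * Yᴴ) - lindblad H L (X * σ) * Yᴴ - X * lindblad H L (σ * Yᴴ) := by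
  rw [lindblad_mul_mul, hE.stationary, mul_zero, zero_mul, noise]
  abel

theorem trace_noise (hE : SteadyEnv H L σ) (X Y : Op e) : (noise L σ X Y).trace
    = -(lindblad H L (X * σ) * Yᴴ).trace - (X * lindblad H L (σ * Yᴴ)).trace := by
  rw [noise_eq hE, Matrix.trace_sub, Matrix.trace_sub, trace_lindblad, zero_sub]

theorem FirstCorrector.trace_noise₀₀ (h : FirstCorrector H L σ a f₀ f₁ c) (hE : SteadyEnv H L σ) :
    (noise L σ f₀ f₀).trace = (a * σ * f₀ᴴ).trace + (f₀ * σ * aᴴ).trace := by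
  rw [trace_noise hE, h.eq₀, h.adj₀ hE]
  simp only [add_mul, mul_sub, neg_mul, mul_neg, smul_mul_assoc, mul_smul_comm, Matrix.trace_add,
    Matrix.trace_sub, Matrix.trace_neg, Matrix.trace_smul, smul_eq_mul, Matrix.mul_assoc]
  ring

theorem FirstCorrector.trace_noise₁₁ (h : FirstCorrector H L σ a f₀ f₁ c) (hE : SteadyEnv H L σ) :
    (noise L σ f₁ f₁).trace = (aᴴ * σ * f₁ᴴ).trace + (f₁ * σ * a).trace := by
  rw [trace_noise hE, h.eq₁, h.adj₁ hE]
  simp only [sub_mul, mul_add, neg_mul, mul_neg, smul_mul_assoc, mul_smul_comm,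
    Matrix.trace_add, Matrix.trace_sub, Matrix.trace_neg, Matrix.trace_smul, smul_eq_mul,
    Matrix.mul_assoc]
  ring

theorem FirstCorrector.trace_noise₁₀ (h : FirstCorrector H L σ a f₀ f₁ c) (hE : SteadyEnv H L σ) :
    (noise L σ f₁ f₀).trace = (aᴴ * σ * f₀ᴴ).trace + (f₁ * σ * aᴴ).trace
      + 2 * Complex.I * c * (f₁ * σ * f₀ᴴ).trace := by
  rw [trace_noise hE, h.eq₁, h.adj₀ hE]
  simp only [sub_mul, mul_sub, neg_mul, mul_neg, smul_mul_assoc, mul_smul_comm,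
    Matrix.trace_sub, Matrix.trace_neg, Matrix.trace_smul, smul_eq_mul,
    Matrix.mul_assoc]
  ring

/-- `f₀ ⊗ B† + f₁ ⊗ B`. -/
def couple (f₀ f₁ : Op e) (B : Op n) : Op (e × n) := f₀ ⊗ₖ Bᴴ + f₁ ⊗ₖ B

/-- `u₀₀ ⊗ BB† + u₁₁ ⊗ B†B + u₀₁ ⊗ BB + u₁₀ ⊗ B†B†`. -/
def couple₂ (u₀₀ u₀₁ u₁₀ u₁₁ : Op e) (B : Op n) : Op (e × n) :=
  u₀₀ ⊗ₖ (B * Bᴴ) + u₁₁ ⊗ₖ (Bᴴ * B) + u₀₁ ⊗ₖ (B * B) + u₁₀ ⊗ₖ (Bᴴ * Bᴴ)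

theorem conjTranspose_couple (f₀ f₁ : Op e) (B : Op n) :
    (couple f₀ f₁ B)ᴴ = f₀ᴴ ⊗ₖ B + f₁ᴴ ⊗ₖ Bᴴ := by
  simp [couple, Matrix.conjTranspose_kronecker]

theorem isHermitian_couple (a : Op e) (B : Op n) : (couple a aᴴ B).IsHermitian := by
  rw [Matrix.IsHermitian, conjTranspose_couple, couple, Matrix.conjTranspose_conjTranspose,
    add_comm]

/-- Identifies the Leibniz defect of `M(σ ⊗ ρ)M†` with the noise map at time zero. -/
theorem jump_zero (s : J) : jump L f₀ f₁ B c s 0 = ⁅L s ⊗ₖ (1 : Op n), couple f₀ f₁ B⁆ := by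
  have h : ∀ (X Y : Op e) (Z : Op n), ⁅X, Y⁆ ⊗ₖ Z = (X * Y) ⊗ₖ Z - (Y * X) ⊗ₖ Z := fun X Y Z => by
    rw [Ring.lie_def, ← kronRight_apply, map_sub, kronRight_apply, kronRight_apply]
  rw [jump, Complex.ofReal_zero, mul_zero, Complex.exp_zero, one_smul, h, h, Ring.lie_def, couple,
    mul_add, add_mul]
  simp only [← Matrix.mul_kronecker_mul, one_mul, mul_one]
  abel

theorem conjTranspose_kron (hE : SteadyEnv H L σ) (ρ : Op n) : (σ ⊗ₖ ρ)ᴴ = σ ⊗ₖ ρᴴ := by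
  rw [Matrix.conjTranspose_kronecker, hE.density.1.isHermitian.eq]

theorem adMap_couple (hHB : HB.IsHermitian) (hB : ⁅HB, Bᴴ⁆ = (c : ℂ) • Bᴴ) (f₀ f₁ : Op e) :
    adMap ((1 : Op e) ⊗ₖ HB) (couple f₀ f₁ B)
      = (Complex.I * c) • (f₁ ⊗ₖ B) - (Complex.I * c) • (f₀ ⊗ₖ Bᴴ) := by
  rw [couple, map_add, adMap_kronecker, adMap_kronecker, adMap_Bdag hB, adMap_B hHB hB]
  simp only [neg_smul, Matrix.kronecker_smul, ← kronLeft_apply, map_neg, map_smul]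
  abel

theorem isHermitian_one_kron (hHB : HB.IsHermitian) : ((1 : Op e) ⊗ₖ HB).IsHermitian := by
  rw [Matrix.IsHermitian, Matrix.conjTranspose_kronecker, hHB.eq, Matrix.conjTranspose_one]

theorem envLindblad_conjTranspose (hE : SteadyEnv H L σ) (X : Op (e × n)) :
    envLindblad n H L Xᴴ = (envLindblad n H L X)ᴴ := by
  refine lindblad_conjTranspose ?_ _ X
  rw [Matrix.IsHermitian, Matrix.conjTranspose_kronecker, hE.herm.eq, Matrix.conjTranspose_one]

theorem FirstCorrector.balance (h : FirstCorrector H L σ a f₀ f₁ c)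
    (hHB : HB.IsHermitian) (hB : ⁅HB, Bᴴ⁆ = (c : ℂ) • Bᴴ) (ρ : Op n) :
    envLindblad n H L (couple f₀ f₁ B * (σ ⊗ₖ ρ))
      + adMap ((1 : Op e) ⊗ₖ HB) (couple f₀ f₁ B) * (σ ⊗ₖ ρ)
      = -(couple a aᴴ B * (σ ⊗ₖ ρ)) := by
  rw [adMap_couple hHB hB]
  simp only [couple, add_mul, sub_mul, smul_mul_assoc, ← Matrix.mul_kronecker_mul, map_add,
    envLindblad_kronecker, h.eq₀, h.eq₁]
  simp only [← kronRight_apply, map_add, map_sub, map_neg, map_smul]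
  abel

theorem FirstCorrector.balance_adj (h : FirstCorrector H L σ a f₀ f₁ c) (hE : SteadyEnv H L σ)
    (hHB : HB.IsHermitian) (hB : ⁅HB, Bᴴ⁆ = (c : ℂ) • Bᴴ) (ρ : Op n) :
    envLindblad n H L ((σ ⊗ₖ ρ) * (couple f₀ f₁ B)ᴴ)
      + (σ ⊗ₖ ρ) * adMap ((1 : Op e) ⊗ₖ HB) (couple f₀ f₁ B)ᴴ
      = -((σ ⊗ₖ ρ) * couple a aᴴ B) := by
  have h1 := congrArg Matrix.conjTranspose (h.balance hHB hB ρᴴ)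
  rw [Matrix.conjTranspose_add, ← envLindblad_conjTranspose hE, Matrix.conjTranspose_mul,
    Matrix.conjTranspose_mul, ← adMap_conjTranspose (isHermitian_one_kron hHB),
    Matrix.conjTranspose_neg, Matrix.conjTranspose_mul, (isHermitian_couple a B).eq,
    ← conjTranspose_kron hE, Matrix.conjTranspose_conjTranspose] at h1
  exact h1

/-- Were the generator a derivation, the one-sided balances would suffice; the noise map is the
price of dissipation. -/
theorem FirstCorrector.balance_sandwich (h : FirstCorrector H L σ a f₀ f₁ c)
    (hE : SteadyEnv H L σ) (hHB : HB.IsHermitian) (hB : ⁅HB, Bᴴ⁆ = (c : ℂ) • Bᴴ) (ρ : Op n) :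
    envLindblad n H L (couple f₀ f₁ B * (σ ⊗ₖ ρ) * (couple f₀ f₁ B)ᴴ)
      + adMap ((1 : Op e) ⊗ₖ HB) (couple f₀ f₁ B * (σ ⊗ₖ ρ) * (couple f₀ f₁ B)ᴴ)
      = couple f₀ f₁ B * (σ ⊗ₖ adMap HB ρ) * (couple f₀ f₁ B)ᴴ
        - couple a aᴴ B * (σ ⊗ₖ ρ) * (couple f₀ f₁ B)ᴴ
        - couple f₀ f₁ B * (σ ⊗ₖ ρ) * couple a aᴴ B
        + noiseMap L σ f₀ f₁ B c 0 ρ := by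
  have h1 := h.balance hHB hB ρ
  have h2 := h.balance_adj hE hHB hB ρ
  have h3 := lindblad_mul_mul (H ⊗ₖ (1 : Op n)) (fun s => L s ⊗ₖ (1 : Op n)) (couple f₀ f₁ B)
    (σ ⊗ₖ ρ) (couple f₀ f₁ B)
  have h4 : lindblad (H ⊗ₖ (1 : Op n)) (fun s => L s ⊗ₖ (1 : Op n)) (σ ⊗ₖ ρ) = 0 := by
    have := envLindblad_kronecker H L σ ρ
    rw [hE.stationary, Matrix.zero_kronecker] at this
    exact this
  have h5 : noiseMap L σ f₀ f₁ B c 0 ρ = ∑ s, ⁅L s ⊗ₖ (1 : Op n), couple f₀ f₁ B⁆ * (σ ⊗ₖ ρ)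
      * (⁅L s ⊗ₖ (1 : Op n), couple f₀ f₁ B⁆)ᴴ := by
    rw [noiseMap_eq_sum]
    simp only [jump_zero]
  rw [← h5, h4, mul_zero, zero_mul, sub_zero] at h3
  have h6 : envLindblad n H L (couple f₀ f₁ B * (σ ⊗ₖ ρ) * (couple f₀ f₁ B)ᴴ)
    = envLindblad n H L (couple f₀ f₁ B * (σ ⊗ₖ ρ)) * (couple f₀ f₁ B)ᴴ
      + couple f₀ f₁ B * envLindblad n H L ((σ ⊗ₖ ρ) * (couple f₀ f₁ B)ᴴ)
      + noiseMap L σ f₀ f₁ B c 0 ρ := h3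
  rw [h6, eq_sub_of_add_eq h1, eq_sub_of_add_eq h2, adMap_mul, adMap_mul, adMap_kronecker]
  simp only [sub_mul, mul_sub, add_mul, mul_neg, neg_mul, Matrix.mul_assoc]
  abel

/-- The products `BB†`, `B†B`, `BB`, `B†B†` have frequencies `0, 0, 2ic, -2ic`. Only the first two
are resonant and leave a solvability term proportional to `σ`. -/
theorem SecondCorrector.balance
    (h : SecondCorrector H L σ a f₀ f₁ c u₀₀ u₀₁ u₁₀ u₁₁)
    (hHB : HB.IsHermitian) (hB : ⁅HB, Bᴴ⁆ = (c : ℂ) • Bᴴ) (ρ : Op n) :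
    envLindblad n H L (couple₂ u₀₀ u₀₁ u₁₀ u₁₁ B * (σ ⊗ₖ ρ))
      + adMap ((1 : Op e) ⊗ₖ HB) (couple₂ u₀₀ u₀₁ u₁₀ u₁₁ B * (σ ⊗ₖ ρ))
      = couple₂ u₀₀ u₀₁ u₁₀ u₁₁ B * (σ ⊗ₖ adMap HB ρ)
        + couple a aᴴ B * couple f₀ f₁ B * (σ ⊗ₖ ρ)
        - σ ⊗ₖ (((aᴴ * f₀ * σ).trace • (B * Bᴴ) + (a * f₁ * σ).trace • (Bᴴ * B)) * ρ) := by
  have h1 := adMap_Bdag hB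
  have h2 := adMap_B hHB hB
  simp only [couple₂, couple, add_mul, mul_add, ← Matrix.mul_kronecker_mul, map_add,
    envLindblad_kronecker, adMap_kronecker, adMap_mul, h1, h2, h.eq₀₀, h.eq₀₁, h.eq₁₀, h.eq₁₁]
  simp only [← kronRight_apply, map_add, map_sub, map_smul]
  have h3 : ∀ (X : Op e) (Y : Op n), X ⊗ₖ (-Y) = -(X ⊗ₖ Y) := fun X Y => map_neg (kronLeft X) Y
  simp only [kronRight_apply, smul_mul_assoc, mul_smul_comm, Matrix.kronecker_add,
    Matrix.kronecker_smul, neg_smul, neg_mul, mul_neg, h3]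
  module

theorem SecondCorrector.balance_adj
    (h : SecondCorrector H L σ a f₀ f₁ c u₀₀ u₀₁ u₁₀ u₁₁) (hE : SteadyEnv H L σ)
    (hHB : HB.IsHermitian) (hB : ⁅HB, Bᴴ⁆ = (c : ℂ) • Bᴴ) (ρ : Op n) :
    envLindblad n H L ((σ ⊗ₖ ρ) * (couple₂ u₀₀ u₀₁ u₁₀ u₁₁ B)ᴴ)
      + adMap ((1 : Op e) ⊗ₖ HB) ((σ ⊗ₖ ρ) * (couple₂ u₀₀ u₀₁ u₁₀ u₁₁ B)ᴴ)
      = (σ ⊗ₖ adMap HB ρ) * (couple₂ u₀₀ u₀₁ u₁₀ u₁₁ B)ᴴ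
        + (σ ⊗ₖ ρ) * (couple f₀ f₁ B)ᴴ * couple a aᴴ B
        - σ ⊗ₖ (ρ * ((aᴴ * f₀ * σ).trace • (B * Bᴴ) + (a * f₁ * σ).trace • (Bᴴ * B))ᴴ) := by
  have h1 := congrArg Matrix.conjTranspose (h.balance hHB hB ρᴴ)
  simp only [Matrix.conjTranspose_add, Matrix.conjTranspose_sub,
    ← envLindblad_conjTranspose hE, Matrix.conjTranspose_mul,
    ← adMap_conjTranspose (isHermitian_one_kron hHB), (isHermitian_couple a B).eq,
    adMap_conjTranspose hHB, conjTranspose_kron hE, Matrix.conjTranspose_conjTranspose] at h1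
  simp only [Matrix.conjTranspose_add, Matrix.mul_assoc] at h1 ⊢
  exact h1

/-- `ρ ↦ y₀ B†ρB + y₁ BρB† + w₀ BρB + w₁ B†ρB†`. -/
def quadMap (y₀ y₁ w₀ w₁ : ℂ) (B : Op n) : Op n →ₗ[ℂ] Op n :=
  y₀ • sandwich Bᴴ B + y₁ • sandwich B Bᴴ + w₀ • sandwich B B + w₁ • sandwich Bᴴ Bᴴ

theorem quadMap_apply (y₀ y₁ w₀ w₁ : ℂ) (B ρ : Op n) : quadMap y₀ y₁ w₀ w₁ B ρ
    = y₀ • (Bᴴ * ρ * B) + y₁ • (B * ρ * Bᴴ) + w₀ • (B * ρ * B) + w₁ • (Bᴴ * ρ * Bᴴ) := by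
  simp [quadMap, sandwich_apply]

theorem adMap_quadMap (hHB : HB.IsHermitian) (hB : ⁅HB, Bᴴ⁆ = (c : ℂ) • Bᴴ)
    (y₀ y₁ w₀ w₁ : ℂ) (ρ : Op n) :
    adMap HB (quadMap y₀ y₁ w₀ w₁ B ρ) = quadMap y₀ y₁ w₀ w₁ B (adMap HB ρ)
      + (2 * Complex.I * c * w₀) • (B * ρ * B) - (2 * Complex.I * c * w₁) • (Bᴴ * ρ * Bᴴ) := by
  have h1 := adMap_Bdag hB
  have h2 := adMap_B hHB hB
  simp only [quadMap_apply, map_add, map_smul, adMap_mul, h1, h2, add_mul, smul_mul_assoc,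
    mul_smul_comm, neg_smul, neg_mul, mul_neg]
  module

/-- `ρ ↦ -i M(σ ⊗ ρ) + i (σ ⊗ ρ)M†`. -/
def firstMap (σ : Op e) (M : Op (e × n)) : Op n →ₗ[ℂ] Op (e × n) :=
  -(Complex.I • (LinearMap.mulLeft ℂ M ∘ₗ kronLeft σ))
    + Complex.I • (LinearMap.mulRight ℂ Mᴴ ∘ₗ kronLeft σ)

theorem firstMap_apply (σ : Op e) (M : Op (e × n)) (ρ : Op n) : firstMap σ M ρ
    = -(Complex.I • (M * (σ ⊗ₖ ρ))) + Complex.I • ((σ ⊗ₖ ρ) * Mᴴ) := rfl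

/-- `ρ ↦ N(σ ⊗ ρ) + (σ ⊗ ρ)N† + M(σ ⊗ ρ)M† + Q(ρ)`. -/
def secondMap (σ : Op e) (M N : Op (e × n)) (Q : Op n →ₗ[ℂ] Op (e × n)) :
    Op n →ₗ[ℂ] Op (e × n) :=
  LinearMap.mulLeft ℂ N ∘ₗ kronLeft σ + LinearMap.mulRight ℂ Nᴴ ∘ₗ kronLeft σ
    + LinearMap.mulRight ℂ Mᴴ ∘ₗ LinearMap.mulLeft ℂ M ∘ₗ kronLeft σ + Q

theorem secondMap_apply (σ : Op e) (M N : Op (e × n)) (Q : Op n →ₗ[ℂ] Op (e × n)) (ρ : Op n) :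
    secondMap σ M N Q ρ
      = N * (σ ⊗ₖ ρ) + (σ ⊗ₖ ρ) * Nᴴ + M * (σ ⊗ₖ ρ) * Mᴴ + Q ρ := rfl

/-- `ρ ↦ ∫ + τ σ ⊗ meanNoise ρ + σ ⊗ quadMap ρ`. -/
def quadCorrection (f₀ f₁ : Op e) (B : Op n) (c : ℝ) (hE : SteadyEnv H L σ) (hHB : HB.IsHermitian)
    (hB : ⁅HB, Bᴴ⁆ = (c : ℂ) • Bᴴ) (τ : ℝ) (y₀ y₁ w₀ w₁ : ℂ) : Op n →ₗ[ℂ] Op (e × n) :=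
  noiseIntegralMap f₀ f₁ B c hE hHB hB + (τ : ℂ) • (kronLeft σ ∘ₗ meanNoise L σ f₀ f₁ B)
    + kronLeft σ ∘ₗ quadMap y₀ y₁ w₀ w₁ B

theorem quadCorrection_apply (f₀ f₁ : Op e) (B : Op n) (c : ℝ) (hE : SteadyEnv H L σ)
    (hHB : HB.IsHermitian) (hB : ⁅HB, Bᴴ⁆ = (c : ℂ) • Bᴴ) (τ : ℝ) (y₀ y₁ w₀ w₁ : ℂ) (ρ : Op n) :
    quadCorrection f₀ f₁ B c hE hHB hB τ y₀ y₁ w₀ w₁ ρ = noiseIntegral H L σ f₀ f₁ B c ρ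
      + (τ : ℂ) • (σ ⊗ₖ meanNoise L σ f₀ f₁ B ρ) + σ ⊗ₖ quadMap y₀ y₁ w₀ w₁ B ρ := rfl

theorem meanNoise_eq_quadMap (L : J → Op e) (σ f₀ f₁ : Op e) (B : Op n) : meanNoise L σ f₀ f₁ B
    = quadMap (noise L σ f₀ f₀).trace (noise L σ f₁ f₁).trace 0 0 B := by
  simp [meanNoise, quadMap]

/-- The improper integral removes the centered noise. The conditions on `w₀` and `w₁` make the
quadratic term remove the oscillating part of the partial trace, so of the noise only its mean
survives; `τ`, `y₀`, `y₁` are free. -/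
theorem quadCorrection_balance (hE : SteadyEnv H L σ) (hHB : HB.IsHermitian)
    (hB : ⁅HB, Bᴴ⁆ = (c : ℂ) • Bᴴ) (τ : ℝ) {y₀ y₁ w₀ w₁ : ℂ}
    (hw₀ : 2 * Complex.I * c * w₀ = -(noise L σ f₁ f₀).trace)
    (hw₁ : 2 * Complex.I * c * w₁ = (noise L σ f₀ f₁).trace) (ρ : Op n) :
    envLindblad n H L (quadCorrection f₀ f₁ B c hE hHB hB τ y₀ y₁ w₀ w₁ ρ)
      + adMap ((1 : Op e) ⊗ₖ HB) (quadCorrection f₀ f₁ B c hE hHB hB τ y₀ y₁ w₀ w₁ ρ)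
      = quadCorrection f₀ f₁ B c hE hHB hB τ y₀ y₁ w₀ w₁ (adMap HB ρ)
        - noiseMap L σ f₀ f₁ B c 0 ρ + σ ⊗ₖ meanNoise L σ f₀ f₁ B ρ := by
  have h1 := noiseIntegral_balance f₀ f₁ B c hE hHB hB ρ
  have h2 := partialTrace_noiseMap L σ f₀ f₁ B c 0 ρ
  have h3 := adMap_quadMap hHB hB y₀ y₁ w₀ w₁ ρ
  have h4 : adMap HB (meanNoise L σ f₀ f₁ B ρ) = meanNoise L σ f₀ f₁ B (adMap HB ρ) := by
    rw [meanNoise_eq_quadMap, adMap_quadMap hHB hB]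
    simp
  rw [hw₀, hw₁] at h3
  simp only [Complex.ofReal_zero, mul_zero, neg_zero, Complex.exp_zero, one_smul] at h2
  rw [centering_apply, h2] at h1
  simp only [quadCorrection_apply, map_add, map_smul, envLindblad_kronecker, hE.stationary,
    adMap_kronecker, h3, h4, Matrix.zero_kronecker, smul_zero, add_zero]
  rw [sub_eq_iff_eq_add] at h1
  simp only [Matrix.kronecker_add, Matrix.kronecker_smul, neg_smul, sub_eq_add_neg] at h1 ⊢
  have h5 : ∀ Y : Op n, σ ⊗ₖ (-Y) = -(σ ⊗ₖ Y) := fun Y => map_neg (kronLeft σ) Y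
  simp only [h5, Matrix.kronecker_smul] at h1 ⊢
  rw [← sub_eq_zero] at h1 ⊢
  rw [← h1]
  abel

/-- The effective second-order generator. -/
def effective (L : J → Op e) (σ a f₀ f₁ : Op e) (B ρ : Op n) : Op n :=
  meanNoise L σ f₀ f₁ B ρ
    - ((aᴴ * f₀ * σ).trace • (B * Bᴴ) + (a * f₁ * σ).trace • (Bᴴ * B)) * ρ
    - ρ * ((aᴴ * f₀ * σ).trace • (B * Bᴴ) + (a * f₁ * σ).trace • (Bᴴ * B))ᴴ

/-- The four balances of the terms of `secondMap` are added. The products with `a` cancel the double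
commutator from `firstMap`, the noise maps cancel each other, and the multiples of `σ` assemble to
`effective`. -/
theorem second_order_invariance (h₁ : FirstCorrector H L σ a f₀ f₁ c)
    (h₂ : SecondCorrector H L σ a f₀ f₁ c u₀₀ u₀₁ u₁₀ u₁₁) (hE : SteadyEnv H L σ)
    (hHB : HB.IsHermitian)
    (hB : ⁅HB, Bᴴ⁆ = (c : ℂ) • Bᴴ) (τ : ℝ) {y₀ y₁ w₀ w₁ : ℂ}
    (hw₀ : 2 * Complex.I * c * w₀ = -(noise L σ f₁ f₀).trace)
    (hw₁ : 2 * Complex.I * c * w₁ = (noise L σ f₀ f₁).trace) (ρ : Op n) :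
    envLindblad n H L (secondMap σ (couple f₀ f₁ B) (couple₂ u₀₀ u₀₁ u₁₀ u₁₁ B)
        (quadCorrection f₀ f₁ B c hE hHB hB τ y₀ y₁ w₀ w₁) ρ)
      + adMap (couple a aᴴ B) (firstMap σ (couple f₀ f₁ B) ρ)
      + adMap ((1 : Op e) ⊗ₖ HB) (secondMap σ (couple f₀ f₁ B) (couple₂ u₀₀ u₀₁ u₁₀ u₁₁ B)
        (quadCorrection f₀ f₁ B c hE hHB hB τ y₀ y₁ w₀ w₁) ρ)
      = σ ⊗ₖ effective L σ a f₀ f₁ B ρ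
        + secondMap σ (couple f₀ f₁ B) (couple₂ u₀₀ u₀₁ u₁₀ u₁₁ B)
          (quadCorrection f₀ f₁ B c hE hHB hB τ y₀ y₁ w₀ w₁) (adMap HB ρ) := by
  have e1 := h₂.balance hHB hB ρ
  have e2 := h₂.balance_adj hE hHB hB ρ
  have e3 := h₁.balance_sandwich hE hHB hB ρ
  have e4 := quadCorrection_balance (y₀ := y₀) (y₁ := y₁) hE hHB hB τ hw₀ hw₁ ρ
  have e5 : adMap (couple a aᴴ B) (firstMap σ (couple f₀ f₁ B) ρ)
      = -(couple a aᴴ B * couple f₀ f₁ B * (σ ⊗ₖ ρ))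
        + couple a aᴴ B * (σ ⊗ₖ ρ) * (couple f₀ f₁ B)ᴴ
        + couple f₀ f₁ B * (σ ⊗ₖ ρ) * couple a aᴴ B
        - (σ ⊗ₖ ρ) * (couple f₀ f₁ B)ᴴ * couple a aᴴ B := by
    rw [firstMap_apply, adMap_apply, Ring.lie_def]
    simp only [mul_add, add_mul, mul_neg, neg_mul, smul_mul_assoc, mul_smul_comm, smul_add,
      smul_sub, smul_neg, smul_smul, Complex.I_mul_I, neg_smul, one_smul, Matrix.mul_assoc]
    abel
  rw [effective, e5]
  simp only [secondMap_apply, map_add]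
  have h5 : ∀ Y Z : Op n, σ ⊗ₖ (Y - Z) = σ ⊗ₖ Y - σ ⊗ₖ Z := fun Y Z => map_sub (kronLeft σ) Y Z
  rw [h5, h5]
  have e := congrArg₂ (· + ·) (congrArg₂ (· + ·) e1 e2) (congrArg₂ (· + ·) e3 e4)
  simp only at e
  rw [← sub_eq_zero] at e ⊢
  rw [← e]
  abel

end Correctors

/-! ### Trace conditions and positivity of the expansion -/

section Normalized

variable {e n : Type*} [Fintype e] [DecidableEq e] [Fintype n] [DecidableEq n]
  {J : Type*} [Fintype J]
variable {H : Op e} {L : J → Op e} {σ a f₀ f₁ u₀₀ u₀₁ u₁₀ u₁₁ : Op e} {c : ℝ} {HB B : Op n}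

theorem trace_herm_mul (hσ : σ.IsHermitian) (X : Op e) : (σ * Xᴴ).trace = star (X * σ).trace := by
  rw [← Matrix.trace_conjTranspose, Matrix.conjTranspose_mul, hσ.eq]

theorem FirstCorrector.trace₀ (h : FirstCorrector H L σ a f₀ f₁ c) :
    Complex.I * c * (f₀ * σ).trace = (a * σ).trace := by
  have := congrArg Matrix.trace h.eq₀
  rw [trace_lindblad, Matrix.trace_add, Matrix.trace_neg, Matrix.trace_smul, smul_eq_mul] at this
  linear_combination -this

theorem FirstCorrector.trace₁ (h : FirstCorrector H L σ a f₀ f₁ c) :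
    Complex.I * c * (f₁ * σ).trace = -(aᴴ * σ).trace := by
  have := congrArg Matrix.trace h.eq₁
  rw [trace_lindblad, Matrix.trace_sub, Matrix.trace_neg, Matrix.trace_smul, smul_eq_mul] at this
  linear_combination this

theorem trace_conjTranspose_mul_herm (hσ : σ.IsHermitian) (X : Op e) :
    (Xᴴ * σ).trace = star (X * σ).trace := by
  rw [Matrix.trace_mul_comm, trace_herm_mul hσ]

theorem I_mul_ofReal_ne_zero (hc : c ≠ 0) : Complex.I * (c : ℂ) ≠ 0 :=
  mul_ne_zero Complex.I_ne_zero (by exact_mod_cast hc)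

theorem star_I_mul_ofReal (c : ℝ) : star (Complex.I * (c : ℂ)) = -(Complex.I * c) := by
  simp

/-- This makes the two halves of `firstMap` have opposite traces. It follows from taking traces in
the first-order equations, where the generator drops out and `c ≠ 0` can be divided out. -/
theorem FirstCorrector.star_trace₀ (h : FirstCorrector H L σ a f₀ f₁ c) (hσ : σ.IsHermitian)
    (hc : c ≠ 0) : star (f₀ * σ).trace = (f₁ * σ).trace := by
  have h0 := congrArg star h.trace₀
  have h1 := h.trace₁
  rw [star_mul', star_I_mul_ofReal] at h0
  rw [trace_conjTranspose_mul_herm hσ] at h1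
  refine mul_left_cancel₀ (I_mul_ofReal_ne_zero hc) ?_
  linear_combination -h0 - h1

theorem trace_kron_mul_kron (X : Op e) (Y ρ : Op n) :
    (X ⊗ₖ Y * (σ ⊗ₖ ρ)).trace = (X * σ).trace * (Y * ρ).trace := by
  rw [← Matrix.mul_kronecker_mul, Matrix.trace_kronecker]

theorem trace_firstMap (h : FirstCorrector H L σ a f₀ f₁ c) (hσ : σ.IsHermitian) (hc : c ≠ 0)
    (ρ : Op n) : (firstMap σ (couple f₀ f₁ B) ρ).trace = 0 := by
  have h1 := h.star_trace₀ hσ hc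
  have h2 : star (f₁ * σ).trace = (f₀ * σ).trace := by rw [← h1, star_star]
  rw [firstMap_apply, conjTranspose_couple, couple, add_mul, mul_add]
  simp only [Matrix.trace_add, Matrix.trace_neg, Matrix.trace_smul, trace_kron_mul_kron,
    trace_herm_mul hσ, Matrix.trace_mul_comm ρ, h1, h2, smul_eq_mul]
  ring

theorem trace_quadMap (y₀ y₁ w₀ w₁ : ℂ) (B ρ : Op n) : (quadMap y₀ y₁ w₀ w₁ B ρ).trace
    = y₀ * (B * Bᴴ * ρ).trace + y₁ * (Bᴴ * B * ρ).trace + w₀ * (B * B * ρ).trace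
      + w₁ * (Bᴴ * Bᴴ * ρ).trace := by
  have h : ∀ X Y : Op n, (X * ρ * Y).trace = (Y * X * ρ).trace := fun X Y => by
    rw [Matrix.trace_mul_comm, Matrix.mul_assoc]
  simp only [quadMap_apply, Matrix.trace_add, Matrix.trace_smul, smul_eq_mul, h]

theorem trace_couple_sandwich (ρ : Op n) :
    (couple f₀ f₁ B * (σ ⊗ₖ ρ) * (couple f₀ f₁ B)ᴴ).trace
      = (f₀ * σ * f₀ᴴ).trace * (B * Bᴴ * ρ).trace + (f₁ * σ * f₁ᴴ).trace * (Bᴴ * B * ρ).trace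
        + (f₁ * σ * f₀ᴴ).trace * (B * B * ρ).trace
        + (f₀ * σ * f₁ᴴ).trace * (Bᴴ * Bᴴ * ρ).trace := by
  have h : ∀ X Y : Op n, (X * ρ * Y).trace = (Y * X * ρ).trace := fun X Y => by
    rw [Matrix.trace_mul_comm, Matrix.mul_assoc]
  rw [conjTranspose_couple, couple]
  simp only [add_mul, mul_add, ← Matrix.mul_kronecker_mul,
    Matrix.trace_add, Matrix.trace_kronecker, h]
  ring

theorem trace_couple₂_mul (ρ : Op n) : (couple₂ u₀₀ u₀₁ u₁₀ u₁₁ B * (σ ⊗ₖ ρ)).trace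
    = (u₀₀ * σ).trace * (B * Bᴴ * ρ).trace + (u₁₁ * σ).trace * (Bᴴ * B * ρ).trace
      + (u₀₁ * σ).trace * (B * B * ρ).trace + (u₁₀ * σ).trace * (Bᴴ * Bᴴ * ρ).trace := by
  simp only [couple₂, add_mul, Matrix.trace_add, trace_kron_mul_kron]

theorem trace_mul_couple₂ (hσ : σ.IsHermitian) (ρ : Op n) :
    ((σ ⊗ₖ ρ) * (couple₂ u₀₀ u₀₁ u₁₀ u₁₁ B)ᴴ).trace
      = star (u₀₀ * σ).trace * (B * Bᴴ * ρ).trace + star (u₁₁ * σ).trace * (Bᴴ * B * ρ).trace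
        + star (u₁₀ * σ).trace * (B * B * ρ).trace
        + star (u₀₁ * σ).trace * (Bᴴ * Bᴴ * ρ).trace := by
  simp only [couple₂, mul_add, Matrix.conjTranspose_add, Matrix.conjTranspose_kronecker,
    Matrix.conjTranspose_mul, Matrix.conjTranspose_conjTranspose, Matrix.trace_add,
    trace_kron_mul_kron, Matrix.trace_mul_comm ρ, trace_herm_mul hσ]
  ring

/-- The trace is a combination of `Tr(BB†ρ)`, `Tr(B†Bρ)`, `Tr(BBρ)` and `Tr(B†B†ρ)`. The first two
coefficients vanish by the normalization of `u₀₀` and `u₁₁`; the other two leave no freedom and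
vanish by the corrector equations. -/
theorem trace_secondMap (h₁ : FirstCorrector H L σ a f₀ f₁ c)
    (h₂ : SecondCorrector H L σ a f₀ f₁ c u₀₀ u₀₁ u₁₀ u₁₁) (hE : SteadyEnv H L σ) (hc : c ≠ 0)
    (hHB : HB.IsHermitian) (hB : ⁅HB, Bᴴ⁆ = (c : ℂ) • Bᴴ) (τ : ℝ) {y₀ y₁ w₀ w₁ : ℂ}
    (hw₀ : 2 * Complex.I * c * w₀ = -(noise L σ f₁ f₀).trace)
    (hw₁ : 2 * Complex.I * c * w₁ = (noise L σ f₀ f₁).trace)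
    (hu₀ : (u₀₀ * σ).trace + star (u₀₀ * σ).trace + (f₀ * σ * f₀ᴴ).trace
      + τ * (noise L σ f₀ f₀).trace + y₀ = 0)
    (hu₁ : (u₁₁ * σ).trace + star (u₁₁ * σ).trace + (f₁ * σ * f₁ᴴ).trace
      + τ * (noise L σ f₁ f₁).trace + y₁ = 0) (ρ : Op n) :
    (secondMap σ (couple f₀ f₁ B) (couple₂ u₀₀ u₀₁ u₁₀ u₁₁ B)
        (quadCorrection f₀ f₁ B c hE hHB hB τ y₀ y₁ w₀ w₁) ρ).trace = 0 := by
  have hσ := hE.density.1.isHermitian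
  have h10 := h₁.trace_noise₁₀ hE
  have hn : star (noise L σ f₁ f₀).trace = (noise L σ f₀ f₁).trace := by
    rw [← Matrix.trace_conjTranspose, conjTranspose_noise hσ]
  have e01 := congrArg Matrix.trace h₂.eq₀₁
  have e10 := congrArg Matrix.trace h₂.eq₁₀
  rw [trace_lindblad, Matrix.trace_sub, Matrix.trace_smul, smul_eq_mul] at e01
  rw [trace_lindblad, Matrix.trace_add, Matrix.trace_smul, smul_eq_mul] at e10
  have t1 : (aᴴ * σ * f₀ᴴ).trace = star (a * f₀ * σ).trace := by
    rw [← Matrix.trace_conjTranspose, Matrix.conjTranspose_mul, Matrix.conjTranspose_mul, hσ.eq,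
      ← Matrix.mul_assoc]
    exact (Matrix.trace_mul_cycle _ _ _).trans (Matrix.trace_mul_cycle _ _ _)
  have t2 : (f₁ * σ * aᴴ).trace = (aᴴ * f₁ * σ).trace := by
    rw [Matrix.trace_mul_comm, Matrix.mul_assoc]
  have t3 : (f₀ * σ * f₁ᴴ).trace = star (f₁ * σ * f₀ᴴ).trace := by
    rw [← Matrix.trace_conjTranspose, Matrix.conjTranspose_mul, Matrix.conjTranspose_mul, hσ.eq,
      Matrix.conjTranspose_conjTranspose, Matrix.mul_assoc]
  have hk : 2 * Complex.I * (c : ℂ) ≠ 0 := by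
    rw [mul_assoc]; exact mul_ne_zero two_ne_zero (I_mul_ofReal_ne_zero hc)
  have hks : star (2 * Complex.I * (c : ℂ)) = -(2 * Complex.I * c) := by simp
  have e10s := congrArg star e10
  rw [star_add, star_mul', hks, star_zero] at e10s
  -- After multiplication by `2ic`, this is the sum of the traces of the second-order equations and
  -- of the noise identity.
  have hw : (u₀₁ * σ).trace + star (u₁₀ * σ).trace + (f₁ * σ * f₀ᴴ).trace + w₀ = 0 := by
    refine mul_left_cancel₀ hk ?_
    rw [mul_zero]
    linear_combination hw₀ - h10 + e01 + e10s - t1 - t2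
  have hw' : (u₁₀ * σ).trace + star (u₀₁ * σ).trace + (f₀ * σ * f₁ᴴ).trace + w₁ = 0 := by
    have hww : w₁ = star w₀ := by
      refine mul_left_cancel₀ hk ?_
      have := congrArg star hw₀
      rw [star_mul', hks, star_neg, hn] at this
      linear_combination hw₁ + this
    have := congrArg star hw
    simp only [star_add, star_star, star_zero] at this
    rw [t3, hww]
    linear_combination this
  rw [secondMap_apply, quadCorrection_apply]
  simp only [Matrix.trace_add, Matrix.trace_smul, trace_couple₂_mul, trace_mul_couple₂ hσ,
    trace_couple_sandwich, trace_noiseIntegral f₀ f₁ B c hE hHB hB, meanNoise_eq_quadMap,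
    Matrix.trace_kronecker, hE.density.2, trace_quadMap, smul_eq_mul]
  linear_combination (B * Bᴴ * ρ).trace * hu₀ + (Bᴴ * B * ρ).trace * hu₁
    + (B * B * ρ).trace * hw + (Bᴴ * Bᴴ * ρ).trace * hw'

theorem isCPTPUpTo_expansion (h₁ : FirstCorrector H L σ a f₀ f₁ c)
    (h₂ : SecondCorrector H L σ a f₀ f₁ c u₀₀ u₀₁ u₁₀ u₁₁) (hE : SteadyEnv H L σ) (hc : c ≠ 0)
    (hHB : HB.IsHermitian) (hB : ⁅HB, Bᴴ⁆ = (c : ℂ) • Bᴴ) (τ : ℝ) {y₀ y₁ w₀ w₁ : ℂ}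
    (hw₀ : 2 * Complex.I * c * w₀ = -(noise L σ f₁ f₀).trace)
    (hw₁ : 2 * Complex.I * c * w₁ = (noise L σ f₀ f₁).trace)
    (hu₀ : (u₀₀ * σ).trace + star (u₀₀ * σ).trace + (f₀ * σ * f₀ᴴ).trace
      + τ * (noise L σ f₀ f₀).trace + y₀ = 0)
    (hu₁ : (u₁₁ * σ).trace + star (u₁₁ * σ).trace + (f₁ * σ * f₁ᴴ).trace
      + τ * (noise L σ f₁ f₁).trace + y₁ = 0)
    (hτ : IsCP fun ρ => noiseIntegral H L σ f₀ f₁ B c ρ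
      + (τ : ℂ) • (σ ⊗ₖ meanNoise L σ f₀ f₁ B ρ))
    (hq : IsCP (quadMap y₀ y₁ w₀ w₁ B)) :
    IsCPTPUpTo 3 fun ε ρ => σ ⊗ₖ ρ + (ε : ℂ) • firstMap σ (couple f₀ f₁ B) ρ
      + (ε : ℂ) ^ 2 • secondMap σ (couple f₀ f₁ B) (couple₂ u₀₀ u₀₁ u₁₀ u₁₁ B)
        (quadCorrection f₀ f₁ B c hE hHB hB τ y₀ y₁ w₀ w₁) ρ := by
  set M := couple f₀ f₁ B with hM
  set N := couple₂ u₀₀ u₀₁ u₁₀ u₁₁ B with hN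
  set Q := quadCorrection f₀ f₁ B c hE hHB hB τ y₀ y₁ w₀ w₁ with hQ
  have hQcp : IsCP Q := hτ.add ((isCP_kronecker hE.density.1).comp hq)
  -- The last two maps are the `ε³` and `ε⁴` coefficients of `(1 - iεM + ε²N)(σ ⊗ ρ)(1 - iεM +
  -- ε²N)†`, which complete the expansion to a completely positive map.
  refine isCPTPUpTo_three (kronLeft σ) (firstMap σ M) (secondMap σ M N Q)
    (-(Complex.I • (LinearMap.mulRight ℂ Nᴴ ∘ₗ LinearMap.mulLeft ℂ M ∘ₗ kronLeft σ))
      + Complex.I • (LinearMap.mulRight ℂ Mᴴ ∘ₗ LinearMap.mulLeft ℂ N ∘ₗ kronLeft σ))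
    (LinearMap.mulRight ℂ Nᴴ ∘ₗ LinearMap.mulLeft ℂ N ∘ₗ kronLeft σ)
    (isCP_kronecker hE.density.1) (fun X => ?_)
    (fun X => trace_firstMap h₁ hE.density.1.isHermitian hc X)
    (fun X => trace_secondMap h₁ h₂ hE hc hHB hB τ hw₀ hw₁ hu₀ hu₁ X) fun ε hε => ?_
  · rw [kronLeft_apply, Matrix.trace_kronecker, hE.density.2, one_mul]
  · have hW := ((isCP_conj (1 - (Complex.I * (ε : ℂ)) • M + (ε : ℂ) ^ 2 • N)).comp
      (isCP_kronecker (m := n) hE.density.1)).add (hQcp.smul (sq_nonneg ε))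
    convert hW using 2 with X
    simp only [firstMap_apply, secondMap_apply, kronLeft_apply, LinearMap.add_apply,
      LinearMap.neg_apply, LinearMap.smul_apply, LinearMap.comp_apply, LinearMap.mulRight_apply,
      LinearMap.mulLeft_apply, Matrix.conjTranspose_add, Matrix.conjTranspose_sub,
      Matrix.conjTranspose_one, Matrix.conjTranspose_smul, star_I_mul_ofReal, star_pow,
      Complex.star_def, Complex.conj_ofReal, add_mul, sub_mul, mul_add, mul_sub, one_mul, mul_one,
      smul_mul_assoc, mul_smul_comm, Complex.ofReal_pow]
    have hI : Complex.I ^ 2 = -1 := Complex.I_sq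
    match_scalars <;> ring_nf
    simp [hI]

end Normalized

/-! ### Reduction of several environments to one -/

section Composite

variable {ι : Type*} [Fintype ι] [DecidableEq ι] {d : ι → Type*}
  [∀ i, Fintype (d i)] [∀ i, DecidableEq (d i)] {J : ι → Type*} [∀ i, Fintype (J i)]
  {H : ∀ i, Op (d i)} {L : ∀ i, J i → Op (d i)} {ρ : ∀ i, Op (d i)}

/-- `∑_i X_i`, each `X_i` acting on its own factor. -/
def total (X : ∀ i, Op (d i)) : Op (∀ i, d i) := ∑ i, site i (X i)

/-- The operators of all factors. -/
def allSites (L : ∀ i, J i → Op (d i)) (s : Σ i, J i) : Op (∀ i, d i) := site s.1 (L s.1 s.2)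

theorem total_conjTranspose (X : ∀ i, Op (d i)) : (total X)ᴴ = total fun i => (X i)ᴴ := by
  simp only [total, Matrix.conjTranspose_sum, site_conjTranspose]

theorem total_mul (X : ∀ i, Op (d i)) (Y : Op (∀ i, d i)) :
    total X * Y = ∑ i, site i (X i) * Y := Finset.sum_mul _ _ _

theorem SteadyEnv.composite (h : ∀ i, SteadyEnv (H i) (L i) (ρ i)) :
    SteadyEnv (total H) (allSites L) (tensor ρ) where
  herm := by
    rw [Matrix.IsHermitian, total_conjTranspose]
    exact congrArg total (funext fun i => (h i).herm.eq)
  density := isDensity_tensor fun i => (h i).density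
  stationary := tensorLindblad_stationary fun i => (h i).stationary
  relaxing := relaxing_tensorLindblad fun i => (h i).relaxing

theorem lindblad_site_mul_tensor (hst : ∀ i, lindblad (H i) (L i) (ρ i) = 0) (k : ι)
    {X Y : Op (d k)} (h : lindblad (H k) (L k) (X * ρ k) = Y * ρ k) :
    lindblad (total H) (allSites L) (site k X * tensor ρ) = site k Y * tensor ρ := by
  have h0 := tensorLindblad_apply H L (site k X * tensor ρ)
  refine h0.trans ?_
  rw [site_mul_tensor, site_mul_tensor, Finset.sum_eq_single k]
  · rw [lindblad_site_tensor, Function.update_self, h, Function.update_idem]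
  · intro i _ hi
    rw [lindblad_site_tensor, Function.update_of_ne hi, hst]
    ext x y
    exact Finset.prod_eq_zero (Finset.mem_univ i) (by simp)
  · simp

theorem lindblad_onSub_mul_tensor (hst : ∀ i, lindblad (H i) (L i) (ρ i) = 0) (s : Finset ι)
    {U W : Op (∀ i : s, d i)}
    (h : tensorLindblad (fun i : s => H i) (fun i : s => L i) (U * tensor fun i : s => ρ i)
      = W * tensor fun i : s => ρ i) :
    lindblad (total H) (allSites L) (onSub s U * tensor ρ) = onSub s W * tensor ρ := by
  have h0 := tensorLindblad_onSub hst s U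
  rw [h, ← onSub_mul, Matrix.mul_assoc, ← tensor_eq_onSub_mul_offSub] at h0
  exact h0

theorem FirstCorrector.composite {a f₀ f₁ : ∀ i, Op (d i)} {c : ℝ}
    (hst : ∀ i, lindblad (H i) (L i) (ρ i) = 0)
    (h : ∀ i, FirstCorrector (H i) (L i) (ρ i) (a i) (f₀ i) (f₁ i) c) :
    FirstCorrector (total H) (allSites L) (tensor ρ) (total a) (total f₀) (total f₁) c where
  eq₀ := by
    have : ∀ i, lindblad (total H) (allSites L) (site i (f₀ i) * tensor ρ)
        = siteHom i (-(a i) + (Complex.I * c) • f₀ i) * tensor ρ := fun i =>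
      lindblad_site_mul_tensor hst i (by
        rw [(h i).eq₀, add_mul, neg_mul, smul_mul_assoc])
    rw [total_mul f₀, lindblad_sum, Finset.sum_congr rfl fun i _ => this i, total_mul a]
    simp only [map_add, map_neg, map_smul, siteHom_apply, add_mul, neg_mul, smul_mul_assoc,
      Finset.sum_add_distrib, Finset.sum_neg_distrib, Finset.smul_sum]
  eq₁ := by
    have : ∀ i, lindblad (total H) (allSites L) (site i (f₁ i) * tensor ρ)
        = siteHom i (-(a i)ᴴ - (Complex.I * c) • f₁ i) * tensor ρ := fun i =>
      lindblad_site_mul_tensor hst i (by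
        rw [(h i).eq₁, sub_mul, neg_mul, smul_mul_assoc])
    rw [total_conjTranspose, total_mul f₁, lindblad_sum, Finset.sum_congr rfl fun i _ => this i,
      total_mul fun i => (a i)ᴴ]
    simp only [map_sub, map_neg, map_smul, siteHom_apply, sub_mul, neg_mul, smul_mul_assoc,
      Finset.sum_sub_distrib, Finset.sum_neg_distrib, Finset.smul_sum]

/-- A jump at site `k` sees only the summand at `k`, so the noise has no cross terms between
different jump sites. -/
theorem lie_site_total (X : ∀ i, Op (d i)) (k : ι) (Y : Op (d k)) :
    ⁅site k Y, total X⁆ = site k ⁅Y, X k⁆ := by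
  rw [Ring.lie_def, total, Finset.mul_sum, Finset.sum_mul, ← Finset.sum_sub_distrib,
    Finset.sum_eq_single k]
  · rw [← siteHom_apply, ← siteHom_apply, ← siteHom_apply, Ring.lie_def, map_sub, map_mul, map_mul]
  · intro i _ hi
    rw [sub_eq_zero]
    exact commute_site hi.symm Y (X i)
  · simp

theorem trace_site_sandwich (hρ : ∀ i, (ρ i).trace = 1) (k : ι) (X Y : Op (d k)) :
    (site k X * tensor ρ * (site k Y)ᴴ).trace = (X * ρ k * Yᴴ).trace := by
  rw [Matrix.trace_mul_comm, ← Matrix.mul_assoc, site_conjTranspose, site_mul,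
    trace_site_mul_tensor k _ hρ, Matrix.trace_mul_comm _ (Yᴴ), Matrix.mul_assoc]

theorem trace_noise_total (hρ : ∀ i, (ρ i).trace = 1) (X Y : ∀ i, Op (d i)) :
    (noise (allSites L) (tensor ρ) (total X) (total Y)).trace
      = ∑ i, (noise (L i) (ρ i) (X i) (Y i)).trace := by
  simp only [noise, Matrix.trace_sum, Fintype.sum_sigma, allSites, lie_site_total,
    trace_site_sandwich hρ]

theorem trace_site_mul_site (hρ : ∀ i, (ρ i).trace = 1) {k l : ι} (hkl : k ≠ l) (X : Op (d k))
    (Y : Op (d l)) :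
    (site k X * site l Y * tensor ρ).trace = (X * ρ k).trace * (Y * ρ l).trace := by
  rw [Matrix.mul_assoc, site_mul_tensor, site_mul_tensor, trace_tensor,
    Fintype.prod_eq_mul k l hkl]
  · rw [Function.update_self, Function.update_of_ne hkl, Function.update_of_ne hkl.symm,
      Function.update_self]
  · rintro i ⟨h1, h2⟩
    rw [Function.update_of_ne h1, Function.update_of_ne h2, hρ]

/-- Distinct sites are uncorrelated in the product state, so cross terms factor into products of
means; these become the `δ^(k,k')` terms. -/
theorem trace_total_mul_total (hρ : ∀ i, (ρ i).trace = 1) (X Y : ∀ i, Op (d i)) :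
    (total X * total Y * tensor ρ).trace
      = ∑ k, (X k * Y k * ρ k).trace
        + ∑ k, ∑ l ∈ Finset.univ.erase k, (X k * ρ k).trace * (Y l * ρ l).trace := by
  rw [total, total, Finset.sum_mul_sum, Finset.sum_mul, Matrix.trace_sum, ← Finset.sum_add_distrib]
  refine Finset.sum_congr rfl fun k _ => ?_
  rw [Finset.sum_mul, Matrix.trace_sum, ← Finset.add_sum_erase _ _ (Finset.mem_univ k), site_mul,
    trace_site_mul_tensor k _ hρ]
  congr 1
  exact Finset.sum_congr rfl fun l hl =>
    trace_site_mul_site hρ (Finset.ne_of_mem_erase hl).symm _ _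

end Composite

/-! ### Integrals of oscillating phases -/

section OscillatingIntegrals

variable {m : Type*} [Fintype m] [DecidableEq m]

theorem opIntegral_phase (c T : ℝ) (X₁ X₂ X₃ : Op m) :
    opIntegral T (fun t => X₁ + Complex.exp (2 * Complex.I * c * t) • X₂
        + Complex.exp (-(2 * Complex.I * c * t)) • X₃)
      = (T : ℂ) • X₁ + (∫ t in (0 : ℝ)..T, Complex.exp (2 * Complex.I * c * t)) • X₂
        + (∫ t in (0 : ℝ)..T, Complex.exp (-(2 * Complex.I * c * t))) • X₃ := by
  ext i j
  have h1 : Continuous fun t : ℝ => Complex.exp (2 * Complex.I * c * t) := by fun_prop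
  have h2 : Continuous fun t : ℝ => Complex.exp (-(2 * Complex.I * c * t)) := by fun_prop
  change (∫ t in (0 : ℝ)..T, (X₁ i j + Complex.exp (2 * Complex.I * c * t) * X₂ i j
    + Complex.exp (-(2 * Complex.I * c * t)) * X₃ i j)) = T * X₁ i j
      + (∫ t in (0 : ℝ)..T, Complex.exp (2 * Complex.I * c * t)) * X₂ i j
      + (∫ t in (0 : ℝ)..T, Complex.exp (-(2 * Complex.I * c * t))) * X₃ i j
  rw [intervalIntegral.integral_add, intervalIntegral.integral_add,
    intervalIntegral.integral_mul_const, intervalIntegral.integral_mul_const,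
    intervalIntegral.integral_const, sub_zero, Complex.real_smul]
  all_goals exact Continuous.intervalIntegrable (by fun_prop) 0 T

theorem integral_phase {c : ℝ} (hc : c ≠ 0) (T : ℝ) :
    ∫ t in (0 : ℝ)..T, Complex.exp (2 * Complex.I * c * t)
      = (Complex.exp (2 * Complex.I * c * T) - 1) / (2 * Complex.I * c) := by
  have hk : 2 * Complex.I * (c : ℂ) ≠ 0 := by
    rw [mul_assoc]; exact mul_ne_zero two_ne_zero (I_mul_ofReal_ne_zero hc)
  rw [integral_exp_mul_complex hk]
  simp

theorem integral_phase_neg {c : ℝ} (hc : c ≠ 0) (T : ℝ) :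
    ∫ t in (0 : ℝ)..T, Complex.exp (-(2 * Complex.I * c * t))
      = -(Complex.exp (-(2 * Complex.I * c * T)) - 1) / (2 * Complex.I * c) := by
  have hk : 2 * Complex.I * (c : ℂ) ≠ 0 := by
    rw [mul_assoc]; exact mul_ne_zero two_ne_zero (I_mul_ofReal_ne_zero hc)
  have h := integral_exp_mul_complex (a := 0) (b := T) (neg_ne_zero.2 hk)
  simp only [neg_mul] at h ⊢
  rw [h]
  simp [div_neg, ← neg_div]

/-- Over half a period only the constant term survives. -/
theorem opIntegral_phase_pi {c : ℝ} (hc : c ≠ 0) (X₁ X₂ X₃ : Op m) :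
    opIntegral (Real.pi / c) (fun t => X₁ + Complex.exp (2 * Complex.I * c * t) • X₂
        + Complex.exp (-(2 * Complex.I * c * t)) • X₃)
      = ((Real.pi / c : ℝ) : ℂ) • X₁ := by
  have hcC : (c : ℂ) ≠ 0 := by exact_mod_cast hc
  have e0 : 2 * Complex.I * c * ((Real.pi / c : ℝ) : ℂ) = 2 * Real.pi * Complex.I := by
    push_cast; field_simp
  rw [opIntegral_phase, integral_phase hc, integral_phase_neg hc, e0, Complex.exp_neg,
    Complex.exp_two_pi_mul_I]
  simp

/-- The phase runs from `1` to `-1`, so the oscillating terms survive. The prefactor `c` compensates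
the orientation of the interval when `c < 0`. -/
theorem opIntegral_phase_half_pi {c : ℝ} (hc : c ≠ 0) (X₁ X₂ X₃ : Op m) :
    (c : ℂ) • opIntegral (Real.pi / (2 * c)) (fun t => X₁ + Complex.exp (2 * Complex.I * c * t) • X₂
        + Complex.exp (-(2 * Complex.I * c * t)) • X₃)
      = ((Real.pi / 2 : ℝ) : ℂ) • X₁ + Complex.I • X₂ - Complex.I • X₃ := by
  have hcC : (c : ℂ) ≠ 0 := by exact_mod_cast hc
  have e0 : 2 * Complex.I * c * ((Real.pi / (2 * c) : ℝ) : ℂ) = Real.pi * Complex.I := by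
    push_cast; field_simp
  rw [opIntegral_phase, integral_phase hc, integral_phase_neg hc, e0, Complex.exp_neg,
    Complex.exp_pi_mul_I]
  have hI : Complex.I⁻¹ = -Complex.I := Complex.inv_I
  match_scalars
  · field_simp
  · field_simp
    rw [Complex.I_sq]; norm_num
  · field_simp
    rw [Complex.I_sq]; norm_num

end OscillatingIntegrals

/-! ### Lindblad form of the effective generator -/

section EffectiveGenerator

variable {e n : Type*} [Fintype e] [DecidableEq e] [Fintype n] [DecidableEq n]
  {J : Type*} [Fintype J] {H : Op e} {L : J → Op e} {σ a f₀ f₁ : Op e} {c : ℝ}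

/-- A fluctuation–dissipation relation: the decay rate is the trace of a positive operator. It both
matches the jump terms with the drift and shows that the rate is nonnegative. -/
theorem FirstCorrector.trace_noise₀ (h : FirstCorrector H L σ a f₀ f₁ c) (hE : SteadyEnv H L σ) :
    (noise L σ f₀ f₀).trace = 2 * ((aᴴ * f₀ * σ).trace.re : ℂ) := by
  have hσ := hE.density.1.isHermitian
  have h1 : (f₀ * σ * aᴴ).trace = (aᴴ * f₀ * σ).trace := by
    rw [Matrix.trace_mul_comm, Matrix.mul_assoc]
  have h2 : (a * σ * f₀ᴴ).trace = star (f₀ * σ * aᴴ).trace := by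
    rw [← Matrix.trace_conjTranspose, Matrix.conjTranspose_mul, Matrix.conjTranspose_mul, hσ.eq,
      Matrix.conjTranspose_conjTranspose, Matrix.mul_assoc]
  rw [h.trace_noise₀₀ hE, h2, h1, add_comm, Complex.star_def, Complex.add_conj]
  push_cast; ring

theorem FirstCorrector.trace_noise₁ (h : FirstCorrector H L σ a f₀ f₁ c) (hE : SteadyEnv H L σ) :
    (noise L σ f₁ f₁).trace = 2 * ((a * f₁ * σ).trace.re : ℂ) := by
  have hσ := hE.density.1.isHermitian
  have h1 : (f₁ * σ * a).trace = (a * f₁ * σ).trace := by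
    rw [Matrix.trace_mul_comm, Matrix.mul_assoc]
  have h2 : (aᴴ * σ * f₁ᴴ).trace = star (f₁ * σ * a).trace := by
    rw [← Matrix.trace_conjTranspose, Matrix.conjTranspose_mul, Matrix.conjTranspose_mul, hσ.eq,
      Matrix.mul_assoc]
  rw [h.trace_noise₁₁ hE, h2, h1, add_comm, Complex.star_def, Complex.add_conj]
  push_cast; ring

theorem effective_eq (h : FirstCorrector H L σ a f₀ f₁ c) (hE : SteadyEnv H L σ) (B ρ : Op n) :
    effective L σ a f₀ f₁ B ρ
      = -((Complex.I * ((aᴴ * f₀ * σ).trace.im : ℂ)) • ⁅B * Bᴴ, ρ⁆)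
        - (Complex.I * ((a * f₁ * σ).trace.im : ℂ)) • ⁅Bᴴ * B, ρ⁆
        + (2 * ((aᴴ * f₀ * σ).trace.re : ℂ)) • dissipator Bᴴ ρ
        + (2 * ((a * f₁ * σ).trace.re : ℂ)) • dissipator B ρ := by
  have hs : ∀ z : ℂ, star z = (z.re : ℂ) - Complex.I * z.im := fun z => by
    apply Complex.ext <;> simp
  have hz : ∀ z : ℂ, z = (z.re : ℂ) + Complex.I * z.im := fun z => by
    apply Complex.ext <;> simp
  rw [effective, meanNoise_apply, h.trace_noise₀ hE, h.trace_noise₁ hE]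
  generalize (aᴴ * f₀ * σ).trace = z
  generalize (a * f₁ * σ).trace = w
  simp only [Matrix.conjTranspose_add, Matrix.conjTranspose_smul, Matrix.conjTranspose_mul,
    Matrix.conjTranspose_conjTranspose, hs]
  conv_lhs =>
    enter [1, 2]
    rw [hz z, hz w]
  simp only [dissipator, Ring.lie_def, Matrix.conjTranspose_conjTranspose, add_mul, mul_add,
    smul_mul_assoc, mul_smul_comm, smul_sub]
  module

theorem isLindbladian_effective (h : FirstCorrector H L σ a f₀ f₁ c) (hE : SteadyEnv H L σ)
    (B : Op n) : IsLindbladian (effective L σ a f₀ f₁ B) := by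
  have hpos : ∀ X, 0 ≤ (noise L σ X X).trace.re := fun X =>
    (Complex.le_def.1 (posSemidef_noise hE.density.1 X).trace_nonneg).1
  have h0 : 0 ≤ 2 * (aᴴ * f₀ * σ).trace.re := by
    have := hpos f₀
    rw [h.trace_noise₀ hE] at this
    simpa using this
  have h1 : 0 ≤ 2 * (a * f₁ * σ).trace.re := by
    have := hpos f₁
    rw [h.trace_noise₁ hE] at this
    simpa using this
  have hd : ∀ {x : ℝ}, 0 ≤ x → ∀ X ρ : Op n,
      dissipator (((Real.sqrt x : ℝ) : ℂ) • X) ρ = (x : ℂ) • dissipator X ρ := fun {x} hx X ρ => by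
    have hsq : ((Real.sqrt x : ℝ) : ℂ) * ((Real.sqrt x : ℝ) : ℂ) = x := by
      rw [← Complex.ofReal_mul, Real.mul_self_sqrt hx]
    simp only [dissipator, Matrix.conjTranspose_smul, Complex.star_def, Complex.conj_ofReal,
      smul_mul_assoc, mul_smul_comm, smul_smul, smul_sub, hsq, mul_comm (x : ℂ), mul_assoc]
  refine ⟨((aᴴ * f₀ * σ).trace.im : ℂ) • (B * Bᴴ) + ((a * f₁ * σ).trace.im : ℂ) • (Bᴴ * B), ?_, 2,
    ![((Real.sqrt (2 * (aᴴ * f₀ * σ).trace.re) : ℝ) : ℂ) • Bᴴ,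
      ((Real.sqrt (2 * (a * f₁ * σ).trace.re) : ℝ) : ℂ) • B], fun ρ => ?_⟩
  · simp [Matrix.IsHermitian]
  · rw [effective_eq h hE, lindblad, Fin.sum_univ_two]
    simp only [Matrix.cons_val_zero, Matrix.cons_val_one, hd h0, hd h1]
    simp only [Ring.lie_def, add_mul, mul_add, smul_mul_assoc, mul_smul_comm, Complex.ofReal_mul,
      Complex.ofReal_ofNat]
    module

end EffectiveGenerator

/-! ### The model as a single composite environment -/

namespace Model

variable {K : ℕ} {dA mA : Fin K → ℕ} {n : ℕ} (M : Model K dA mA n)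

/-- `∑_k X^(k)` on `H_A`. -/
abbrev totA (X : ∀ k, Op (Fin (dA k))) : OpA dA := total (d := fun k => Fin (dA k)) X

/-- All decoherence operators, on `H_A`. -/
abbrev envL : (Σ k, Fin (mA k)) → OpA dA := allSites (d := fun k => Fin (dA k)) M.LA

/-- `∑_{k,k'} U_{jh}^(k,k')` on `H_A`. -/
def totU (U : Fin 2 → Fin 2 → ∀ k k', OpPair dA k k') (j h : Fin 2) : OpA dA :=
  ∑ k, ∑ k', onSub (d := fun k => Fin (dA k)) {k, k'} (U j h k k')

theorem steadyEnv_site (k : Fin K) : SteadyEnv (M.HA k) (M.LA k) (M.ρA k) where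
  herm := M.HA_herm k
  density := (M.relaxes k).density
  stationary := (M.relaxes k).stationary
  relaxing := RelaxesTo.relaxing (T := lindbladMap (M.HA k) (M.LA k)) (M.relaxes k)

theorem steadyEnv : SteadyEnv (totA M.HA) M.envL M.ρtot :=
  SteadyEnv.composite fun k => M.steadyEnv_site k

/-- The Hamiltonian of a pair of environment parts. -/
abbrev pairH (k k' : Fin K) : OpPair dA k k' :=
  total (d := fun i : ({k, k'} : Finset (Fin K)) => Fin (dA i)) fun i => M.HA i

/-- The decoherence operators of a pair of environment parts. -/
abbrev pairL (k k' : Fin K) :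
    (Σ i : ({k, k'} : Finset (Fin K)), Fin (mA i)) → OpPair dA k k' :=
  allSites (d := fun i : ({k, k'} : Finset (Fin K)) => Fin (dA i)) fun i => M.LA i

theorem steadyEnv_pair (k k' : Fin K) :
    SteadyEnv (M.pairH k k') (M.pairL k k') (M.ρpair k k') :=
  SteadyEnv.composite fun i => M.steadyEnv_site i

theorem LApair_eq (k k' : Fin K) (X : OpPair dA k k') :
    M.LApair k k' X = lindblad (M.pairH k k') (M.pairL k k') X :=
  (tensorLindblad_apply (d := fun i : ({k, k'} : Finset (Fin K)) => Fin (dA i))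
    (fun i => M.HA i) (fun i => M.LA i) X).symm

theorem LAtot_eq : (M.LAtot : OpAB dA n → OpAB dA n)
    = envLindblad (Fin n) (totA M.HA) M.envL := by
  funext X
  rw [LAtot, sum_lindblad]
  have h : ∑ k, siteA k (M.HA k) ⊗ₖ (1 : Op (Fin n)) = totA M.HA ⊗ₖ (1 : Op (Fin n)) :=
    (map_sum (kronRight (1 : Op (Fin n))) _ _).symm
  rw [h]
  rfl

theorem Lint_eq (X : OpAB dA n) :
    M.Lint X = adMap (couple (totA M.A) (totA M.A)ᴴ M.B) X := by
  have h : couple (totA M.A) (totA M.A)ᴴ M.B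
      = ∑ k, (siteA k (M.A k) ⊗ₖ M.Bᴴ + siteA k (M.A k)ᴴ ⊗ₖ M.B) := by
    rw [couple, total_conjTranspose, Finset.sum_add_distrib]
    exact congrArg₂ (· + ·) (map_sum (kronRight M.Bᴴ) _ _) (map_sum (kronRight M.B) _ _)
  rw [h, adMap_apply, Lint, Ring.lie_def, Finset.sum_mul, Finset.mul_sum, ← Finset.sum_sub_distrib,
    Finset.smul_sum, Finset.sum_neg_distrib]
  rfl

theorem opM_eq (F : Fin 2 → ∀ k, Op (Fin (dA k))) :
    M.opM F = couple (totA (F 0)) (totA (F 1)) M.B := by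
  rw [opM, couple]
  simp only [Fin.sum_univ_two, Finset.sum_add_distrib]
  exact congrArg₂ (· + ·) (map_sum (kronRight M.Bᴴ) _ _).symm (map_sum (kronRight M.B) _ _).symm

theorem opN_eq (U : Fin 2 → Fin 2 → ∀ k k', OpPair dA k k') :
    M.opN U = couple₂ (totU U 0 0) (totU U 0 1) (totU U 1 0) (totU U 1 1) M.B := by
  have h : ∀ (j i : Fin 2) (Y : Op (Fin n)), totU U j i ⊗ₖ Y
      = ∑ k, ∑ k', onSub (d := fun k => Fin (dA k)) {k, k'} (U j i k k') ⊗ₖ Y := fun j i Y => by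
    rw [totU, ← kronRight_apply]
    simp only [map_sum, kronRight_apply]
  rw [opN, couple₂, h, h, h, h]
  simp only [Fin.sum_univ_two, Finset.sum_add_distrib, Bj, Matrix.cons_val_zero,
    Matrix.cons_val_one, Matrix.conjTranspose_conjTranspose]
  abel

theorem K1_eq (F : Fin 2 → ∀ k, Op (Fin (dA k))) :
    M.K1 F = firstMap M.ρtot (couple (totA (F 0)) (totA (F 1)) M.B) := by
  funext ρs
  rw [K1, opM_eq]
  rfl

variable {M} {c : ℝ} {F : Fin 2 → ∀ k, Op (Fin (dA k))}

theorem FirstOrderEqs.site (hF : M.FirstOrderEqs c F) (k : Fin K) :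
    FirstCorrector (M.HA k) (M.LA k) (M.ρA k) (M.A k) (F 0 k) (F 1 k) c where
  eq₀ := by
    have := (hF k).1
    rw [sub_eq_zero] at this
    rw [← this]
    abel
  eq₁ := by
    have := (hF k).2
    rw [add_assoc] at this
    rw [eq_neg_of_add_eq_zero_left this]
    abel

theorem FirstOrderEqs.total (hF : M.FirstOrderEqs c F) :
    FirstCorrector (totA M.HA) M.envL M.ρtot (totA M.A) (totA (F 0)) (totA (F 1)) c :=
  FirstCorrector.composite (fun k => (M.relaxes k).stationary) fun k => hF.site k

theorem exists_firstOrderEqs (M : Model K dA mA n) (hc : c ≠ 0) : ∃ F, M.FirstOrderEqs c F := by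
  have h : ∀ k, ∃ Z₀ Z₁ : Op (Fin (dA k)),
      lindblad (M.HA k) (M.LA k) (Z₀ * M.ρA k) + M.A k * M.ρA k
        - (Complex.I * c) • (Z₀ * M.ρA k) = 0 ∧
      lindblad (M.HA k) (M.LA k) (Z₁ * M.ρA k) + (M.A k)ᴴ * M.ρA k
        + (Complex.I * c) • (Z₁ * M.ρA k) = 0 := fun k => by
    have hE := M.steadyEnv_site k
    obtain ⟨Z₀, h₀⟩ := exists_resolvent hE.density.1 hE.stationary hE.relaxing (neg_ne_zero.2 hc)
      (-(M.A k))
    obtain ⟨Z₁, h₁⟩ := exists_resolvent hE.density.1 hE.stationary hE.relaxing hc (-(M.A k)ᴴ)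
    refine ⟨Z₀, Z₁, ?_, ?_⟩
    · rw [Complex.ofReal_neg, mul_neg, neg_smul, neg_mul, ← sub_eq_zero] at h₀
      rw [← h₀]
      abel
    · rw [neg_mul, ← sub_eq_zero] at h₁
      rw [← h₁]
      abel
  choose Z₀ Z₁ h using h
  exact ⟨![Z₀, Z₁], h⟩

theorem onSub_left (k k' : Fin K) (X : Op (Fin (dA k))) :
    onSub (d := fun k => Fin (dA k)) {k, k'} (left k k' X) = siteA k X :=
  onSub_site (d := fun k => Fin (dA k)) {k, k'} ⟨k, by simp⟩ X

theorem onSub_right (k k' : Fin K) (Y : Op (Fin (dA k'))) :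
    onSub (d := fun k => Fin (dA k)) {k, k'} (right k k' Y) = siteA k' Y :=
  onSub_site (d := fun k => Fin (dA k)) {k, k'} ⟨k', by simp⟩ Y

theorem onSub_left_mul_right (k k' : Fin K) (X : Op (Fin (dA k))) (Y : Op (Fin (dA k'))) :
    onSub (d := fun k => Fin (dA k)) {k, k'} (left k k' X * right k k' Y)
      = siteA k X * siteA k' Y := by
  rw [← onSub_mul (d := fun k => Fin (dA k)) {k, k'}, onSub_left, onSub_right]

theorem trace_onSub_pair (M : Model K dA mA n) (k k' : Fin K) (X : OpPair dA k k') :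
    (onSub (d := fun k => Fin (dA k)) {k, k'} X * M.ρtot).trace = (X * M.ρpair k k').trace :=
  trace_onSub_mul_tensor (d := fun k => Fin (dA k)) {k, k'} X (ρ := M.ρA)
    fun i => (M.relaxes i).density.2

theorem lindblad_onSub_pair (M : Model K dA mA n) (k k' : Fin K) {X Y : OpPair dA k k'}
    (h : M.LApair k k' (X * M.ρpair k k') = Y * M.ρpair k k') :
    lindblad (totA M.HA) M.envL (onSub (d := fun k => Fin (dA k)) {k, k'} X * M.ρtot)
      = onSub (d := fun k => Fin (dA k)) {k, k'} Y * M.ρtot :=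
  lindblad_onSub_mul_tensor (fun i => (M.relaxes i).stationary) _ ((M.LApair_eq k k' _).symm.trans h)

/-- Pair equations add up because `∑_{k,k'} X_k Y_{k'}` is the product of the totals. The case `k =
k'` needs no separate treatment, as `{k, k'}` is then a singleton. The scalars `w` account for the
traces subtracted when `h = j`. -/
theorem lindblad_totU (M : Model K dA mA n) {U : Fin 2 → Fin 2 → ∀ k k', OpPair dA k k'}
    {j h : Fin 2} {z : ℂ} {w : Fin K → Fin K → ℂ} {X Y : ∀ k, Op (Fin (dA k))}
    (hU : ∀ k k', M.LApair k k' (U j h k k' * M.ρpair k k')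
      = (left k k' (X k) * right k k' (Y k') - z • U j h k k' - w k k' • 1) * M.ρpair k k') :
    lindblad (totA M.HA) M.envL (totU U j h * M.ρtot)
      = totA X * totA Y * M.ρtot - z • (totU U j h * M.ρtot)
        - (∑ k, ∑ k', w k k') • M.ρtot := by
  have h1 : ∀ k k', lindblad (totA M.HA) M.envL
        (onSub (d := fun k => Fin (dA k)) {k, k'} (U j h k k') * M.ρtot)
      = (siteA k (X k) * siteA k' (Y k')
          - z • onSub (d := fun k => Fin (dA k)) {k, k'} (U j h k k') - w k k' • 1) * M.ρtot :=
    fun k k' => by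
      rw [M.lindblad_onSub_pair k k' (hU k k'), ← onSubHom_apply, map_sub, map_sub, map_smul,
        map_smul, map_one, onSubHom_apply, onSubHom_apply, onSub_left_mul_right]
  rw [totU]
  simp only [Finset.sum_mul, lindblad_sum, h1]
  simp only [sub_mul, Finset.sum_sub_distrib, smul_mul_assoc, one_mul, ← Finset.sum_smul,
    ← Finset.smul_sum, ← Finset.sum_mul]
  congr 3
  exact (Finset.sum_mul_sum _ _ _ _).symm

variable {τ : ℝ} {U : Fin 2 → Fin 2 → ∀ k k', OpPair dA k k'}

theorem trace_pair_sum (M : Model K dA mA n) (X Y : ∀ k, Op (Fin (dA k))) :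
    ∑ k, ∑ k', (left k k' (X k) * right k k' (Y k') * M.ρpair k k').trace
      = (totA X * totA Y * M.ρtot).trace := by
  have h : ∀ k k', (left k k' (X k) * right k k' (Y k') * M.ρpair k k').trace
      = (siteA k (X k) * siteA k' (Y k') * M.ρtot).trace := fun k k' => by
    rw [← onSub_left_mul_right, trace_onSub_pair]
  simp only [h, ← Matrix.trace_sum, ← Finset.sum_mul]
  congr 2
  exact (Finset.sum_mul_sum _ _ _ _).symm

/-- The off-diagonal trace condition says precisely that the argument of `Spair` is traceless, so
the projection can be dropped. -/
theorem SecondOrderEqs.offdiag (hU : M.SecondOrderEqs c F τ U) {j h : Fin 2} (hjh : h ≠ j) :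
    lindblad (totA M.HA) M.envL (totU U j h * M.ρtot)
      = totA (fun k => (M.Aj j k)ᴴ) * totA (F h) * M.ρtot
        - (2 * Complex.I * c * idxDiff h j) • (totU U j h * M.ρtot) := by
  have h1 := M.lindblad_totU (U := U) (j := j) (h := h) (z := 2 * Complex.I * c * idxDiff h j)
    (w := 0) (X := fun k => (M.Aj j k)ᴴ) (Y := F h) fun k k' => by
      have h2 := hU.balance j h k k'
      rw [Spair, Matrix.trace_sub, hU.trace_offdiag j h hjh, sub_self, zero_smul, sub_zero] at h2
      rw [Pi.zero_apply, Pi.zero_apply, zero_smul, sub_zero, sub_mul, smul_mul_assoc,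
        eq_neg_of_add_eq_zero_left h2, neg_sub]
  simpa using h1

theorem SecondOrderEqs.diag (hU : M.SecondOrderEqs c F τ U) (j : Fin 2) :
    lindblad (totA M.HA) M.envL (totU U j j * M.ρtot)
      = totA (fun k => (M.Aj j k)ᴴ) * totA (F j) * M.ρtot
        - (totA (fun k => (M.Aj j k)ᴴ) * totA (F j) * M.ρtot).trace • M.ρtot := by
  have h1 := M.lindblad_totU (U := U) (j := j) (h := j) (z := 0)
    (w := fun k k' => (left k k' (M.Aj j k)ᴴ * right k k' (F j k') * M.ρpair k k').trace)
    (X := fun k => (M.Aj j k)ᴴ) (Y := F j) fun k k' => by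
      have h2 := hU.balance j j k k'
      rw [idxDiff, sub_self, mul_zero, zero_smul, zero_sub, Spair, Matrix.trace_neg, neg_smul,
        sub_neg_eq_add] at h2
      rw [zero_smul, sub_zero, sub_mul, smul_mul_assoc, one_mul, eq_neg_of_add_eq_zero_left h2]
      abel
  rw [M.trace_pair_sum (fun k => (M.Aj j k)ᴴ) (F j), zero_smul, sub_zero] at h1
  exact h1

theorem SecondOrderEqs.total (hU : M.SecondOrderEqs c F τ U) :
    SecondCorrector (totA M.HA) M.envL M.ρtot (totA M.A) (totA (F 0)) (totA (F 1)) c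
      (totU U 0 0) (totU U 0 1) (totU U 1 0) (totU U 1 1) := by
  have ha : totA (fun k => (M.Aj 0 k)ᴴ) = (totA M.A)ᴴ := (total_conjTranspose _).symm
  have ha' : totA (fun k => (M.Aj 1 k)ᴴ) = totA M.A :=
    congrArg totA (funext fun k => Matrix.conjTranspose_conjTranspose (M.A k))
  refine ⟨?_, ?_, ?_, ?_⟩
  · rw [← ha]; exact hU.diag 0
  · have := hU.diag 1
    rwa [ha'] at this
  · have := hU.offdiag (j := 0) (h := 1) one_ne_zero
    rw [ha] at this
    simpa [idxDiff] using this
  · have := hU.offdiag (j := 1) (h := 0) zero_ne_one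
    rw [ha'] at this
    simpa [idxDiff] using this

theorem SecondOrderEqs.trace_totU (hU : M.SecondOrderEqs c F τ U) (j : Fin 2) :
    (totU U j j * M.ρtot).trace = -M.fConst c F τ j := by
  rw [totU, fConst]
  simp only [Finset.sum_mul, Matrix.trace_sum, trace_onSub_pair, hU.trace_diag,
    Finset.sum_neg_distrib]

/-- Diagonal indices give a resonant equation whose right side is made traceless and whose solution
has a free trace. Off-diagonal ones have frequency `±2c ≠ 0`, and the trace condition is then
automatic. -/
theorem exists_secondOrderEqs (M : Model K dA mA n) (hc : c ≠ 0)
    (F : Fin 2 → ∀ k, Op (Fin (dA k))) (τ : ℝ) : ∃ U, M.SecondOrderEqs c F τ U := by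
  have h : ∀ (j h : Fin 2) (k k' : Fin K), ∃ Z : OpPair dA k k',
      M.LApair k k' (Z * M.ρpair k k')
        + M.Spair k k' ((2 * Complex.I * c * idxDiff h j) • (Z * M.ρpair k k')
          - left k k' (M.Aj j k)ᴴ * right k k' (F h k') * M.ρpair k k') = 0 ∧
      (h ≠ j → ((2 * Complex.I * c * idxDiff h j) • (Z * M.ρpair k k')).trace
        = (left k k' (M.Aj j k)ᴴ * right k k' (F h k') * M.ρpair k k').trace) ∧
      (h = j → (Z * M.ρpair k k').trace = -M.gauge c F τ j k k') := fun j h k k' => by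
    have hE := M.steadyEnv_pair k k'
    set Y := left k k' (M.Aj j k)ᴴ * right k k' (F h k') with hY
    by_cases hjh : h = j
    · subst hjh
      have ht : ((Y - (Y * M.ρpair k k').trace • 1) * M.ρpair k k').trace = 0 := by
        rw [sub_mul, smul_mul_assoc, one_mul, Matrix.trace_sub, Matrix.trace_smul, hE.density.2,
          smul_eq_mul, mul_one, sub_self]
      obtain ⟨Z, h1, h2⟩ := exists_traceless_inverse hE.density hE.stationary hE.relaxing ht
        (-M.gauge c F τ h k k')
      refine ⟨Z, ?_, fun h => absurd rfl h, fun _ => h2⟩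
      rw [LApair_eq, h1, idxDiff, sub_self, mul_zero, zero_smul, zero_sub, Spair, Matrix.trace_neg,
        neg_smul, sub_mul, smul_mul_assoc, one_mul]
      abel
    · have hr : ∃ s : ℝ, s ≠ 0 ∧ 2 * Complex.I * c * idxDiff h j = Complex.I * s := by
        refine ⟨2 * c * (((h : ℕ) : ℝ) - ((j : ℕ) : ℝ)), ?_, ?_⟩
        · refine mul_ne_zero (mul_ne_zero two_ne_zero hc) (sub_ne_zero.2 fun h' => hjh ?_)
          exact Fin.ext (by exact_mod_cast h')
        · rw [idxDiff]
          push_cast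
          ring
      obtain ⟨s, hs, hsc⟩ := hr
      obtain ⟨Z, h1⟩ := exists_resolvent hE.density.1 hE.stationary hE.relaxing hs Y
      have h2 : ((Complex.I * s) • (Z * M.ρpair k k')).trace = (Y * M.ρpair k k').trace := by
        have := congrArg Matrix.trace h1
        rwa [Matrix.trace_add, trace_lindblad, zero_add] at this
      refine ⟨Z, ?_, fun _ => by rw [hsc, h2], fun h => absurd h hjh⟩
      rw [LApair_eq, hsc, Spair, Matrix.trace_sub, h2, sub_self, zero_smul, sub_zero, ← h1]
      abel
  choose U hU using h
  exact ⟨U, fun j h k k' => (hU j h k k').1, fun j h hjh k k' => (hU j h k k').2.1 hjh,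
    fun j k k' => (hU j j k k').2.2 rfl⟩

end Model

theorem sum_erase_eq_sum_Iio {K : ℕ} (g : Fin K → Fin K → ℂ) :
    ∑ k, ∑ l ∈ Finset.univ.erase k, g k l = ∑ k, ∑ l ∈ Finset.Iio k, (g k l + g l k) := by
  have h1 : ∀ k, ∑ l ∈ Finset.univ.erase k, g k l
      = ∑ l ∈ Finset.Iio k, g k l + ∑ l ∈ Finset.Ioi k, g k l := fun k => by
    rw [← Finset.sum_union (Finset.disjoint_left.2 fun l h h' =>
      lt_asymm (Finset.mem_Iio.1 h) (Finset.mem_Ioi.1 h'))]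
    refine Finset.sum_congr (Finset.ext fun l => ?_) fun _ _ => rfl
    simp [lt_or_lt_iff_ne]
  simp only [h1, Finset.sum_add_distrib]
  congr 1
  exact Finset.sum_comm' fun k l => by simp

/-! ### Quadratic maps on the target -/

section Quad

variable {n : Type*} [Fintype n] [DecidableEq n]

theorem quadMap_add (y₀ y₁ w₀ w₁ y₀' y₁' w₀' w₁' : ℂ) (B : Op n) :
    quadMap (y₀ + y₀') (y₁ + y₁') (w₀ + w₀') (w₁ + w₁') B
      = quadMap y₀ y₁ w₀ w₁ B + quadMap y₀' y₁' w₀' w₁' B := by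
  simp only [quadMap]
  module

theorem quadMap_sum {α : Type*} (s : Finset α) (y₀ y₁ w₀ w₁ : α → ℂ) (B : Op n) :
    quadMap (∑ i ∈ s, y₀ i) (∑ i ∈ s, y₁ i) (∑ i ∈ s, w₀ i) (∑ i ∈ s, w₁ i) B
      = ∑ i ∈ s, quadMap (y₀ i) (y₁ i) (w₀ i) (w₁ i) B := by
  simp only [quadMap, Finset.sum_smul, Finset.sum_add_distrib]

theorem isCP_quadMap_diag {x y : ℝ} (hx : 0 ≤ x) (hy : 0 ≤ y) (B : Op n) :
    IsCP (quadMap (x : ℂ) (y : ℂ) 0 0 B) := by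
  have h := ((isCP_conj Bᴴ).smul hx).add ((isCP_conj B).smul hy)
  simp only [Matrix.conjTranspose_conjTranspose] at h
  have e : ⇑(quadMap (x : ℂ) (y : ℂ) 0 0 B) = _ := funext fun ρ => quadMap_apply _ _ _ _ B ρ
  rw [e]
  simpa using h

theorem ofReal_norm_sq (b : ℂ) : ((‖b‖ ^ 2 : ℝ) : ℂ) = b * star b := by
  rw [Complex.star_def, Complex.mul_conj, Complex.normSq_eq_norm_sq]

/-- The average of `w(t) ρ w(t)†` over a quarter of the period dominates its oscillating part. -/
theorem isCP_quadMap_osc (b : ℂ) (B : Op n) :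
    IsCP (quadMap ((Real.pi / 2 : ℝ) : ℂ) ((Real.pi / 2 * ‖b‖ ^ 2 : ℝ) : ℂ) (-(Complex.I * b))
      (Complex.I * star b) B) := by
  have hpi : 0 ≤ Real.pi / 2 - 1 := by linarith [Real.two_le_pi]
  -- One unit of each diagonal weight completes the square `(B† - ibB)ρ(B† - ibB)†`; the rest is
  -- diagonal, nonnegative because `π/2 ≥ 1`.
  have h := (isCP_quadMap_diag hpi (mul_nonneg hpi (sq_nonneg ‖b‖)) B).add
    (isCP_conj (Bᴴ - (Complex.I * b) • B))
  convert h using 2 with ρ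
  have hI : Complex.I * Complex.I = -1 := Complex.I_mul_I
  simp only [quadMap_apply, Complex.ofReal_mul, ofReal_norm_sq, Matrix.conjTranspose_sub,
    Matrix.conjTranspose_smul, Matrix.conjTranspose_conjTranspose, star_mul', Complex.star_def,
    Complex.conj_I, sub_mul, mul_sub, smul_mul_assoc, mul_smul_comm, Complex.ofReal_sub,
    Complex.ofReal_one]
  match_scalars
  · ring
  · linear_combination (b * (starRingEnd ℂ) b) * hI
  · ring
  · ring

end Quad

/-! ### Evaluation of the explicit formulas of the model -/

namespace Model

variable {K : ℕ} {dA mA : Fin K → ℕ} {n : ℕ} (M : Model K dA mA n)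
variable {c : ℝ} {F : Fin 2 → ∀ k, Op (Fin (dA k))}

theorem trace_ρA (k : Fin K) : (M.ρA k).trace = 1 := (M.relaxes k).density.2

theorem trace_Fbar_sum (F : Fin 2 → ∀ k, Op (Fin (dA k))) (h j : Fin 2) :
    ∑ k, (M.Fbar F h j k).trace = (noise M.envL M.ρtot (totA (F h)) (totA (F j))).trace :=
  (trace_noise_total (d := fun k => Fin (dA k)) (L := M.LA) M.trace_ρA (F h) (F j)).symm

theorem fConst_eq (c : ℝ) (F : Fin 2 → ∀ k, Op (Fin (dA k))) (τ : ℝ) (j : Fin 2) :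
    M.fConst c F τ j = (totA (F j) * M.ρtot * (totA (F j))ᴴ).trace
      + τ * (noise M.envL M.ρtot (totA (F j)) (totA (F j))).trace
      + ∑ k, ((Real.pi / 2 * ‖(![1, M.b c F k] : Fin 2 → ℂ) j‖ ^ 2 : ℝ) : ℂ) := by
  have h1 : ∀ k k', (left k k' (F j k) * M.ρpair k k' * (right k k' (F j k'))ᴴ).trace
      = (siteA k (F j k) * M.ρtot * (siteA k' (F j k'))ᴴ).trace := fun k k' => by
    rw [Matrix.trace_mul_comm, ← Matrix.mul_assoc, ← trace_onSub_pair,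
      ← onSub_mul (d := fun k => Fin (dA k)) {k, k'}, onSub_left,
      ← onSub_conjTranspose (d := fun k => Fin (dA k)) {k, k'}, onSub_right, Matrix.mul_assoc,
      Matrix.trace_mul_comm]
  have h2 : ∑ k, ∑ k', (siteA k (F j k) * M.ρtot * (siteA k' (F j k'))ᴴ).trace
      = (totA (F j) * M.ρtot * (totA (F j))ᴴ).trace := by
    simp only [← Matrix.trace_sum]
    congr 1
    have e : totA (F j) = ∑ k, siteA k (F j k) := rfl
    rw [e, Finset.sum_mul, Matrix.conjTranspose_sum]
    exact (Finset.sum_mul_sum _ _ _ _).symm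
  rw [fConst, ← h2, ← trace_Fbar_sum]
  simp only [gauge, h1, Finset.sum_add_distrib, Finset.sum_ite_eq, Finset.mem_univ, if_true,
    Finset.mul_sum]
  ring

theorem Aconj_trace (k : Fin K) : ((M.A k)ᴴ * M.ρA k).trace = star (M.z0 k) :=
  trace_conjTranspose_mul_herm (M.relaxes k).density.1.isHermitian _

/-- Pairing `(k, l)` with `(l, k)` adds complex conjugates, whence the real part in `δ`. -/
theorem sum_δ (c : ℝ) : ((∑ k, ∑ l ∈ Finset.Iio k, M.δ c k l : ℝ) : ℂ)
    = -(∑ k, ∑ l ∈ Finset.univ.erase k, star (M.z0 k) * M.z0 l) / c := by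
  rw [sum_erase_eq_sum_Iio, neg_div, Finset.sum_div, ← Finset.sum_neg_distrib, Complex.ofReal_sum]
  refine Finset.sum_congr rfl fun k _ => ?_
  rw [Finset.sum_div, ← Finset.sum_neg_distrib, Complex.ofReal_sum]
  refine Finset.sum_congr rfl fun l _ => ?_
  have h : star (M.z0 k) * M.z0 l + star (M.z0 l) * M.z0 k
      = ((2 * (M.z0 k * conj (M.z0 l)).re : ℝ) : ℂ) := by
    rw [← Complex.add_conj, map_mul, Complex.conj_conj, Complex.star_def]
    ring
  rw [h, δ]
  push_cast
  ring

variable {M}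

/-- The trace of the first-order equation gives `Tr(F_1 ρ̄) = -(i/c) z_0`. Hence the cross terms are
purely imaginary: they shift the Hamiltonian and leave the rates unchanged. -/
theorem FirstOrderEqs.trace_A_F₀ (hF : M.FirstOrderEqs c F) (hc : c ≠ 0) :
    ((totA M.A)ᴴ * totA (F 0) * M.ρtot).trace
      = ∑ k, M.z1 F k + Complex.I * ((∑ k, ∑ l ∈ Finset.Iio k, M.δ c k l : ℝ) : ℂ) := by
  have hcC : (c : ℂ) ≠ 0 := by exact_mod_cast hc
  have hk := I_mul_ofReal_ne_zero hc
  have h0 : ∀ l, (F 0 l * M.ρA l).trace = -(Complex.I / c) * M.z0 l := fun l => by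
    refine mul_left_cancel₀ hk ((hF.site l).trace₀.trans ?_)
    field_simp
    rw [Complex.I_sq, neg_mul, one_mul, neg_neg]
    rfl
  rw [total_conjTranspose]
  refine (trace_total_mul_total (d := fun k => Fin (dA k)) M.trace_ρA _ _).trans ?_
  rw [sum_δ]
  congr 1
  · exact Finset.sum_congr rfl fun k _ => by
      rw [z1, Matrix.trace_mul_comm (F 0 k * M.ρA k), Matrix.mul_assoc]
  · simp only [h0, Aconj_trace, neg_div, mul_neg, Finset.sum_div, Finset.mul_sum,
      ← Finset.sum_neg_distrib]
    refine Finset.sum_congr rfl fun k _ => Finset.sum_congr rfl fun l _ => ?_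
    ring

theorem FirstOrderEqs.trace_A_F₁ (hF : M.FirstOrderEqs c F) (hc : c ≠ 0) :
    (totA M.A * totA (F 1) * M.ρtot).trace
      = ∑ k, M.z2 F k - Complex.I * ((∑ k, ∑ l ∈ Finset.Iio k, M.δ c k l : ℝ) : ℂ) := by
  have hcC : (c : ℂ) ≠ 0 := by exact_mod_cast hc
  have hk := I_mul_ofReal_ne_zero hc
  have h0 : ∀ l, (F 1 l * M.ρA l).trace = Complex.I / c * star (M.z0 l) := fun l => by
    refine mul_left_cancel₀ hk ((hF.site l).trace₁.trans ?_)
    rw [Aconj_trace]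
    field_simp
    rw [Complex.I_sq, mul_neg_one]
  refine (trace_total_mul_total (d := fun k => Fin (dA k)) M.trace_ρA _ _).trans ?_
  have hsymm : ∑ k, ∑ l ∈ Finset.univ.erase k, star (M.z0 k) * M.z0 l
      = ∑ k, ∑ l ∈ Finset.univ.erase k, M.z0 k * star (M.z0 l) := by
    rw [sum_erase_eq_sum_Iio, sum_erase_eq_sum_Iio]
    exact Finset.sum_congr rfl fun k _ => Finset.sum_congr rfl fun l _ => by ring
  rw [sum_δ, hsymm, sub_eq_add_neg]
  congr 1
  · exact Finset.sum_congr rfl fun k _ => by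
      rw [z2, Matrix.trace_mul_comm (F 1 k * M.ρA k), Matrix.mul_assoc]
  · have hz : ∀ k, (M.A k * M.ρA k).trace = M.z0 k := fun _ => rfl
    simp only [h0, hz, neg_div, mul_neg, neg_neg, Finset.sum_div, Finset.mul_sum]
    refine Finset.sum_congr rfl fun k _ => Finset.sum_congr rfl fun l _ => ?_
    ring

/-- The shifts of the two imaginary parts are opposite, so they combine `BB†` and `B†B` into the
commutator `[B, B†]`. -/
theorem FirstOrderEqs.Ls2_eq (hF : M.FirstOrderEqs c F) (hc : c ≠ 0) :
    M.Ls2 c F = effective M.envL M.ρtot (totA M.A) (totA (F 0)) (totA (F 1)) M.B := by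
  funext ρs
  rw [effective_eq hF.total M.steadyEnv, hF.trace_A_F₀ hc, hF.trace_A_F₁ hc, Ls2]
  set D : ℝ := ∑ k, ∑ l ∈ Finset.Iio k, M.δ c k l with hD
  have hδ : ∑ k, ∑ k' ∈ Finset.Iio k, -((Complex.I * (M.δ c k k' : ℂ)) • ⁅⁅M.B, M.Bᴴ⁆, ρs⁆)
      = -((Complex.I * (D : ℂ)) • ⁅⁅M.B, M.Bᴴ⁆, ρs⁆) := by
    simp only [Finset.sum_neg_distrib, ← Finset.sum_smul, ← Finset.mul_sum, hD, Complex.ofReal_sum]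
  have hlie : ⁅⁅M.B, M.Bᴴ⁆, ρs⁆ = ⁅M.B * M.Bᴴ, ρs⁆ - ⁅M.Bᴴ * M.B, ρs⁆ := by
    simp only [Ring.lie_def, sub_mul, mul_sub]
    abel
  rw [hδ, hlie]
  have hre : ∀ z : ℂ, (z + Complex.I * (D : ℂ)).re = z.re := fun z => by simp
  have him : ∀ z : ℂ, (z + Complex.I * (D : ℂ)).im = z.im + D := fun z => by simp
  have hre' : ∀ z : ℂ, (z - Complex.I * (D : ℂ)).re = z.re := fun z => by simp
  have him' : ∀ z : ℂ, (z - Complex.I * (D : ℂ)).im = z.im - D := fun z => by simp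
  simp only [hre, him, hre', him', Complex.re_sum, Complex.im_sum, Complex.ofReal_add,
    Complex.ofReal_sub, Complex.ofReal_sum, Finset.sum_add_distrib, Finset.sum_sub_distrib,
    Finset.sum_neg_distrib, ← Finset.sum_smul, ← Finset.mul_sum]
  module

variable (M) (c F)

theorem sumW_eq (ρs : Op (Fin n)) (t : ℝ) :
    M.sumW c F ρs t = noiseMap M.envL M.ρtot (totA (F 0)) (totA (F 1)) M.B c t ρs := by
  rw [noiseMap_eq_sum, Fintype.sum_sigma, sumW]
  refine Finset.sum_congr rfl fun k _ => Finset.sum_congr rfl fun μ _ => ?_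
  have h : jump M.envL (totA (F 0)) (totA (F 1)) M.B c ⟨k, μ⟩ t = M.opW c F k μ t := by
    have h1 : ∀ X, ⁅M.envL ⟨k, μ⟩, totA X⁆ = siteA k ⁅M.LA k μ, X k⁆ := fun X =>
      lie_site_total (d := fun k => Fin (dA k)) X k (M.LA k μ)
    rw [jump, h1, h1]
    rfl
  rw [h]
  rfl

theorem K2Integrand_eq (ρs : Op (Fin n)) (t : ℝ) : M.K2Integrand c F ρs t
    = noiseFlow (totA M.HA) M.envL M.ρtot (totA (F 0)) (totA (F 1)) M.B c t ρs := by
  rw [K2Integrand, LAtot_eq, semigroup_eq, sumW_eq, noiseFlow_apply]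
  rfl

theorem GMap_eq (hc : c ≠ 0) (ρs : Op (Fin n)) : M.GMap c F ρs
    = ((Real.pi / c : ℝ) : ℂ) • meanNoise M.envL M.ρtot (totA (F 0)) (totA (F 1)) M.B ρs := by
  rw [GMap]
  simp only [sumW_eq, noiseMap_apply]
  rw [opIntegral_phase_pi hc, ← partialTraceMap_apply, map_smul, map_add, partialTraceMap_apply,
    partialTraceMap_apply, partialTrace_kronecker, partialTrace_kronecker, meanNoise_apply]

theorem gMap_eq (hc : c ≠ 0) (ρs : Op (Fin n)) : (c : ℂ) • M.gMap c F ρs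
    = ∑ k, quadMap ((Real.pi / 2 : ℝ) : ℂ) ((Real.pi / 2 * ‖M.b c F k‖ ^ 2 : ℝ) : ℂ)
      (-(Complex.I * M.b c F k)) (Complex.I * star (M.b c F k)) M.B ρs := by
  rw [gMap, Finset.smul_sum]
  refine Finset.sum_congr rfl fun k _ => ?_
  generalize hb : M.b c F k = b
  have h : ∀ t : ℝ, M.opw c F k t * ρs * (M.opw c F k t)ᴴ
      = (M.Bᴴ * ρs * M.B + (b * star b) • (M.B * ρs * M.Bᴴ))
        + Complex.exp (2 * Complex.I * c * t) • (star b • (M.Bᴴ * ρs * M.Bᴴ))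
        + Complex.exp (-(2 * Complex.I * c * t)) • (b • (M.B * ρs * M.B)) := fun t => by
    have he : star (Complex.exp (-(2 * Complex.I * c * t)))
        = Complex.exp (2 * Complex.I * c * t) := by rw [← star_exp_phase, star_star]
    have he' := exp_phase_mul c t
    rw [opw, hb]
    simp only [Matrix.conjTranspose_add, Matrix.conjTranspose_smul,
      Matrix.conjTranspose_conjTranspose, star_mul', he, add_mul, mul_add, smul_mul_assoc,
      mul_smul_comm]
    match_scalars
    · ring
    · ring
    · ring
    · linear_combination (b * star b) * he'
  simp only [h]
  rw [opIntegral_phase_half_pi hc, quadMap_apply]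
  simp only [Complex.ofReal_mul, ofReal_norm_sq]
  module

theorem K2Q_eq (hc : c ≠ 0) (hB : ⁅M.HB, M.Bᴴ⁆ = (c : ℂ) • M.Bᴴ) (τ : ℝ) (ρs : Op (Fin n)) :
    M.K2Q c F τ ρs = quadCorrection (totA (F 0)) (totA (F 1)) M.B c M.steadyEnv M.HB_herm hB τ
      (M.fConst c F τ 0 + ∑ _k : Fin K, ((Real.pi / 2 : ℝ) : ℂ))
      (M.fConst c F τ 1 + ∑ k, ((Real.pi / 2 * ‖M.b c F k‖ ^ 2 : ℝ) : ℂ))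
      (0 + ∑ k, -(Complex.I * M.b c F k)) (0 + ∑ k, Complex.I * star (M.b c F k)) ρs := by
  have hcC : (c : ℂ) ≠ 0 := by exact_mod_cast hc
  have hpi : (Real.pi : ℂ) ≠ 0 := by exact_mod_cast Real.pi_ne_zero
  have hI : opIntegralInfty (M.K2Integrand c F ρs)
      = noiseIntegral (totA M.HA) M.envL M.ρtot (totA (F 0)) (totA (F 1)) M.B c ρs :=
    congrArg opIntegralInfty (funext fun t => M.K2Integrand_eq c F ρs t)
  have hf : M.fMap c F τ ρs = quadMap (M.fConst c F τ 0) (M.fConst c F τ 1) 0 0 M.B ρs := by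
    rw [fMap, Fin.sum_univ_two, quadMap_apply, zero_smul, zero_smul, add_zero, add_zero]
    simp only [Bj, Matrix.cons_val_zero, Matrix.cons_val_one, Matrix.conjTranspose_conjTranspose]
  rw [K2Q, hI, GMap_eq M c F hc, ← Matrix.kronecker_smul, ← Matrix.kronecker_smul, gMap_eq M c F hc,
    hf, quadCorrection_apply, quadMap_add, quadMap_sum, LinearMap.add_apply, LinearMap.sum_apply,
    Matrix.kronecker_add, smul_smul, ← Matrix.kronecker_smul]
  have hs : ((c * τ / Real.pi : ℝ) : ℂ) * ((Real.pi / c : ℝ) : ℂ) = τ := by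
    push_cast; field_simp
  rw [hs]
  abel

theorem K2_eq (hc : c ≠ 0) (hB : ⁅M.HB, M.Bᴴ⁆ = (c : ℂ) • M.Bᴴ) (τ : ℝ)
    (U : Fin 2 → Fin 2 → ∀ k k', OpPair dA k k') :
    M.K2 c F τ U = secondMap M.ρtot (couple (totA (F 0)) (totA (F 1)) M.B)
      (couple₂ (totU U 0 0) (totU U 0 1) (totU U 1 0) (totU U 1 1) M.B)
      (quadCorrection (totA (F 0)) (totA (F 1)) M.B c M.steadyEnv M.HB_herm hB τ
        (M.fConst c F τ 0 + ∑ _k : Fin K, ((Real.pi / 2 : ℝ) : ℂ))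
        (M.fConst c F τ 1 + ∑ k, ((Real.pi / 2 * ‖M.b c F k‖ ^ 2 : ℝ) : ℂ))
        (0 + ∑ k, -(Complex.I * M.b c F k)) (0 + ∑ k, Complex.I * star (M.b c F k))) := by
  funext ρs
  rw [K2, opN_eq, opM_eq, K2Q_eq M c F hc hB, secondMap_apply]
  rfl

theorem sum_b (hc : c ≠ 0) : 2 * c * ∑ k, M.b c F k
    = -(noise M.envL M.ρtot (totA (F 1)) (totA (F 0))).trace := by
  have hcC : (c : ℂ) ≠ 0 := by exact_mod_cast hc
  rw [← trace_Fbar_sum, Finset.mul_sum, ← Finset.sum_neg_distrib]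
  refine Finset.sum_congr rfl fun k _ => ?_
  rw [b]
  field_simp

/-- The definition of `b^(k)` is made for this cancellation. -/
theorem osc_coeff₀ (hc : c ≠ 0) : 2 * Complex.I * c * (0 + ∑ k, -(Complex.I * M.b c F k))
    = -(noise M.envL M.ρtot (totA (F 1)) (totA (F 0))).trace := by
  rw [← sum_b M c F hc, Finset.sum_neg_distrib, ← Finset.mul_sum]
  linear_combination (-(2 * (c : ℂ) * ∑ k, M.b c F k)) * Complex.I_mul_I

theorem osc_coeff₁ (hc : c ≠ 0) : 2 * Complex.I * c * (0 + ∑ k, Complex.I * star (M.b c F k))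
    = (noise M.envL M.ρtot (totA (F 0)) (totA (F 1))).trace := by
  have h := congrArg star (sum_b M c F hc)
  rw [star_neg, ← Matrix.trace_conjTranspose,
    conjTranspose_noise M.steadyEnv.density.1.isHermitian, star_mul', star_sum] at h
  have h2 : star (2 * (c : ℂ)) = 2 * c := by simp
  rw [h2] at h
  rw [← Finset.mul_sum]
  linear_combination (2 * (c : ℂ) * ∑ k, star (M.b c F k)) * Complex.I_mul_I - h

theorem fConst_nonneg {τ : ℝ} (hτ : 0 < τ) (j : Fin 2) : 0 ≤ M.fConst c F τ j := by
  rw [fConst_eq]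
  have hρ : M.ρtot.PosSemidef := M.steadyEnv.density.1
  have hτ' : (0 : ℂ) ≤ (τ : ℂ) := by exact_mod_cast hτ.le
  refine add_nonneg (add_nonneg (hρ.mul_mul_conjTranspose_same _).trace_nonneg
    (mul_nonneg hτ' (posSemidef_noise hρ _).trace_nonneg)) (Finset.sum_nonneg fun k _ => ?_)
  have : 0 ≤ Real.pi / 2 * ‖(![1, M.b c F k] : Fin 2 → ℂ) j‖ ^ 2 := by positivity
  exact_mod_cast this

theorem isCP_quad {τ : ℝ} (hτ : 0 < τ) : IsCP (quadMap
    (M.fConst c F τ 0 + ∑ _k : Fin K, ((Real.pi / 2 : ℝ) : ℂ))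
    (M.fConst c F τ 1 + ∑ k, ((Real.pi / 2 * ‖M.b c F k‖ ^ 2 : ℝ) : ℂ))
    (0 + ∑ k, -(Complex.I * M.b c F k)) (0 + ∑ k, Complex.I * star (M.b c F k)) M.B) := by
  have hf : ∀ j, M.fConst c F τ j = ((M.fConst c F τ j).re : ℂ) ∧ 0 ≤ (M.fConst c F τ j).re :=
    fun j => by
      have h := Complex.le_def.1 (M.fConst_nonneg c F hτ j)
      exact ⟨Complex.ext rfl (by simpa using h.2.symm), h.1⟩
  rw [quadMap_add, quadMap_sum, (hf 0).1, (hf 1).1]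
  have h := (isCP_quadMap_diag (hf 0).2 (hf 1).2 M.B).add
    (IsCP.sum Finset.univ fun k _ => isCP_quadMap_osc (M.b c F k) M.B)
  convert h using 2 with ρ
  rw [LinearMap.add_apply, LinearMap.sum_apply]

variable {M c F}

/-- `U` and its adjoint contribute `-2 f_j`. One `f_j` cancels the `fMap` term, the other cancels
`M(σ ⊗ ρ)M†`, the mean noise and the finite integral. That `f_j` is real is used for the adjoint. -/
theorem SecondOrderEqs.trace_balance {τ : ℝ} {U : Fin 2 → Fin 2 → ∀ k k', OpPair dA k k'}
    (hU : M.SecondOrderEqs c F τ U) (hτ : 0 < τ) (j : Fin 2) :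
    (totU U j j * M.ρtot).trace + star (totU U j j * M.ρtot).trace
      + (totA (F j) * M.ρtot * (totA (F j))ᴴ).trace
      + τ * (noise M.envL M.ρtot (totA (F j)) (totA (F j))).trace
      + (M.fConst c F τ j
        + ∑ k, ((Real.pi / 2 * ‖(![1, M.b c F k] : Fin 2 → ℂ) j‖ ^ 2 : ℝ) : ℂ)) = 0 := by
  have hs : star (M.fConst c F τ j) = M.fConst c F τ j :=
    Complex.conj_eq_iff_im.2 (Complex.le_def.1 (M.fConst_nonneg c F hτ j)).2.symm
  rw [hU.trace_totU, star_neg, hs]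
  linear_combination -M.fConst_eq c F τ j

end Model

end AdiabaticElimination

end

open AdiabaticElimination
theorem theorem2 {K : ℕ} {dA mA : Fin K → ℕ} {n : ℕ} (M : Model K dA mA n)
    (c : ℝ) (hc : c ≠ 0) (hB : ⁅M.HB, M.Bᴴ⁆ = (c : ℂ) • M.Bᴴ) (hLB : M.LB = 0) :
    (∃ F, M.FirstOrderEqs c F) ∧
    ∀ F, M.FirstOrderEqs c F →
      IsLindbladian (M.Ls2 c F) ∧
      (∀ ρs i j, IntegrableOn (fun t => M.K2Integrand c F ρs t i j) (Set.Ioi (0 : ℝ))) ∧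
      ∃ τ : ℝ, 0 < τ ∧
        (∃ U, M.SecondOrderEqs c F τ U) ∧
        ∀ U, M.SecondOrderEqs c F τ U →
          M.SecondOrderInvariance M.K0 (M.K1 F) (M.K2 c F τ U) M.Ls0 0 (M.Ls2 c F) ∧
          IsCPTPUpTo 3 (fun ε ρs =>
            M.K0 ρs + (ε : ℂ) • M.K1 F ρs + (ε : ℂ) ^ 2 • M.K2 c F τ U ρs) := by
  refine ⟨M.exists_firstOrderEqs hc, fun F hF => ⟨?_, fun ρs i j => ?_, ?_⟩⟩
  · rw [hF.Ls2_eq hc]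
    exact isLindbladian_effective hF.total M.steadyEnv M.B
  · simp only [M.K2Integrand_eq c F]
    exact integrableOn_noiseFlow _ _ M.B c M.steadyEnv M.HB_herm hB ρs i j
  -- `τ` is fixed before `U`, since the trace normalization of `U` involves `τ`, while positivity of
  -- the noise term does not involve `U`.
  · obtain ⟨τ, hτ, hcp⟩ := exists_isCP_noise (Model.totA (F 0)) (Model.totA (F 1)) M.B hc
      M.steadyEnv M.HB_herm hB
    refine ⟨τ, hτ, M.exists_secondOrderEqs hc F τ, fun U hU => ⟨fun ρs => ?_, ?_⟩⟩
    · have h := second_order_invariance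
        (y₀ := M.fConst c F τ 0 + ∑ _k : Fin K, ((Real.pi / 2 : ℝ) : ℂ))
        (y₁ := M.fConst c F τ 1 + ∑ k, ((Real.pi / 2 * ‖M.b c F k‖ ^ 2 : ℝ) : ℂ))
        hF.total hU.total M.steadyEnv M.HB_herm hB τ
        (M.osc_coeff₀ c F hc) (M.osc_coeff₁ c F hc) ρs
      have h0 : onSecond M.LB (M.K1 F ρs) = 0 := by
        rw [hLB]
        rfl
      have h1 : M.K1 F ((0 : Op (Fin n) → Op (Fin n)) ρs) = 0 := by
        rw [M.K1_eq, Pi.zero_apply, map_zero]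
      rw [h0, h1, M.LAtot_eq, M.Lint_eq, M.K1_eq, M.K2_eq c F hc hB, hF.Ls2_eq hc, add_zero,
        add_zero]
      exact h
    · have h := isCPTPUpTo_expansion
        (y₀ := M.fConst c F τ 0 + ∑ _k : Fin K, ((Real.pi / 2 : ℝ) : ℂ))
        (y₁ := M.fConst c F τ 1 + ∑ k, ((Real.pi / 2 * ‖M.b c F k‖ ^ 2 : ℝ) : ℂ))
        hF.total hU.total M.steadyEnv hc M.HB_herm hB τ
        (M.osc_coeff₀ c F hc) (M.osc_coeff₁ c F hc)
        (by simpa using hU.trace_balance hτ 0) (by simpa using hU.trace_balance hτ 1) hcp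
        (M.isCP_quad c F hτ)
      rw [M.K1_eq, M.K2_eq c F hc hB]
      exact h
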